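/- Let $f_0$ be a probability density on $\mathbb{R}^d$ with compact support $X$ (so $f_0=0$ off $X$), continuous on $X$, with $f_0\ge f_{\min}>0$ on $X$ and without flat regions: there is a constant $M$ with $P\{y:|f_0(y)-f_0(x)|<\delta\}\le M\delta$ for all $x\in X$, $\delta>0$, where $P(A)=\int_A f_0(x)\,dx$. Let $x_1,x_2,\dots$ be i.i.d. with distribution $P$, and let $p(\eta)=P\{x: f_0(x)\le f_0(\eta)\}$ be the $p$-value of $\eta$. Let $K=K_n\to\infty$ with $K_n=O(n^{0.5})$. For $x\in\mathbb{R}^d$ let $D_{(j)}(x)$ be the Euclidean distance from $x$ to its $j$-th nearest neighbour in $\{x_1,\dots,x_n\}\setminus\{x\}$, let $G(x)=\frac1K\sum_{j=1}^K D_{(j)}(x)$, and let $\mathcal{P}=\{(i,j): G(x_i)>G(x_j)\}$ be the preference pairs. Let $H$ be the reproducing kernel Hilbert space of the RBF kernel $k(x,y)=\exp(-\|x-y\|^2/\sigma^2)$, $\sigma>0$, let $L(t)=\max\{0,1-t\}$ be the hinge loss, and let $$\hat g=\hat g_n=\arg\min_{g\in H}\ \frac1{|\mathcal{P}|}\sum_{(i,j)\in\mathcal{P}}L\big(g(x_i)-g(x_j)\big)+\lambda_n\|g\|_H^2$$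 (the empirical risk is $0$ if $\mathcal{P}=\emptyset$). Assume $\lambda_n>0$, $\lambda_n\to0$ and, for every $\varepsilon>0$, $\log N(\mathcal{H}_n,\varepsilon)/(n\lambda_n)\to0$, where $N(\mathcal{H}_n,\varepsilon)$ is the covering number of the ball $\mathcal{H}_n$ of radius $1/\sqrt{\lambda_n}$ in $H$ by balls of radius $\varepsilon$ for the supremum norm on $X$. Put $\hat R_n(\eta)=\frac1n\#\{i\le n:\hat g_n(\eta)<\hat g_n(x_i)\}$. Then the minimizer $\hat g_n$ exists and is unique, and as $n\to\infty$, $\hat R_n(\eta)\to p(\eta)$ in the following sense: almost surely with respect to the data $x_1,x_2,\dots$, for every distribution $\nu$ of the test point $\eta$ that has a density on $X$, $\hat R_n(\eta)\to p(\eta)$ in $\nu$-probability. Consequently the decision regions are asymptotically optimal: almost surely, for every $\alpha\in(0,1)$, the Lebesgue measure of the symmetric difference of $\{\eta\in X:\hat R_n(\eta)>\alpha\}$ and $U_{1-\alpha}=\{\eta: p(\eta)\ge\alpha\}$ tends to $0$; and $U_{1-\alpha}$ has minimal Lebesgue measure among all measurable sets $A$ with $P(A)\ge1-\alpha$. -/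

import Mathlib

open MeasureTheory ProbabilityTheory Filter Topology
open scoped ENNReal NNReal

noncomputable section

namespace RankAD

/-- The space `ℝ^d` with its Euclidean metric. -/
abbrev Pt (d : ℕ) : Type := EuclideanSpace ℝ (Fin d)

/-! ### The nominal density and the p-value -/

/-- The nominal distribution `P(A) = ∫_A f₀(x) dx`. -/
def nominal {d : ℕ} (f₀ : Pt d → ℝ) : Measure (Pt d) :=
  volume.withDensity (fun x => ENNReal.ofReal (f₀ x))

/-- `f₀` is a probability density with compact support `X`, continuous and bounded below by a
positive constant on `X`, and without flat regions. -/
structure IsNominalDensity {d : ℕ} (X : Set (Pt d)) (f₀ : Pt d → ℝ) : Prop where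
  isCompact : IsCompact X
  eq_zero : ∀ x, x ∉ X → f₀ x = 0
  continuousOn : ContinuousOn f₀ X
  lower_bound : ∃ fmin : ℝ, 0 < fmin ∧ ∀ x ∈ X, fmin ≤ f₀ x
  total_mass : ∫⁻ x, ENNReal.ofReal (f₀ x) = 1
  no_flat : ∃ M : ℝ, ∀ x ∈ X, ∀ δ : ℝ, 0 < δ →
    (nominal f₀).real {y | |f₀ y - f₀ x| < δ} ≤ M * δ

/-- The p-value `p(η) = P{x : f₀(x) ≤ f₀(η)}`. -/
def pValue {d : ℕ} (f₀ : Pt d → ℝ) (η : Pt d) : ℝ :=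
  (nominal f₀).real {x | f₀ x ≤ f₀ η}

/-- `U` has the smallest Lebesgue measure among the measurable sets of nominal probability at
least `1 - α`. -/
def IsMinVolumeSet {d : ℕ} (f₀ : Pt d → ℝ) (α : ℝ) (U : Set (Pt d)) : Prop :=
  (MeasurableSet U ∧ 1 - α ≤ (nominal f₀).real U) ∧
    ∀ A : Set (Pt d), MeasurableSet A → 1 - α ≤ (nominal f₀).real A → volume U ≤ volume A

/-! ### Average K-nearest-neighbour distances -/

/-- The distances from `x` to the sample points other than `x`, in increasing order. -/
def sortedDists {d n : ℕ} (s : Fin n → Pt d) (x : Pt d) : List ℝ :=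
  open Classical in
  ((Finset.univ.filter (fun i => s i ≠ x)).val.map (fun i => dist x (s i))).sort (· ≤ ·)

/-- `D_(j)(x)`: the distance from `x` to its `j`-th nearest neighbour (`j = 1, 2, …`) among the
sample points other than `x`. -/
def nnDist {d n : ℕ} (s : Fin n → Pt d) (j : ℕ) (x : Pt d) : ℝ :=
  (sortedDists s x).getD (j - 1) 0

/-- The average `K`-nearest-neighbour distance `G(x) = (1/K) ∑_{j=1}^K D_(j)(x)`. -/
def avgNNDist {d n : ℕ} (K : ℕ) (s : Fin n → Pt d) (x : Pt d) : ℝ :=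
  (1 / (K : ℝ)) * ∑ j ∈ Finset.Icc 1 K, nnDist s j x

/-- The preference pairs `{(i, j) : G(x_i) > G(x_j)}`. -/
def prefPairs {d n : ℕ} (K : ℕ) (s : Fin n → Pt d) : Finset (Fin n × Fin n) :=
  open Classical in
  Finset.univ.filter (fun q => avgNNDist K s (s q.2) < avgNNDist K s (s q.1))

/-! ### The reproducing kernel Hilbert space of the RBF kernel -/

/-- The RBF kernel `k(x, y) = exp(-‖x - y‖² / σ²)`. -/
def rbf {d : ℕ} (σ : ℝ) (x y : Pt d) : ℝ := Real.exp (-‖x - y‖ ^ 2 / σ ^ 2)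

/-- The RBF kernel as an operator-valued matrix (a scalar acts on `ℝ` by multiplication). -/
def rbfMatrix (d : ℕ) (σ : ℝ) : Matrix (Pt d) (Pt d) (ℝ →L[ℝ] ℝ) :=
  Matrix.of fun x y => rbf σ x y • ContinuousLinearMap.id ℝ ℝ

theorem rbf_posSemidef_aux {d : ℕ} (σ : ℝ) (v : Pt d →₀ ℝ) :
    0 ≤ v.sum fun x a => v.sum fun y b => rbf σ y x * a * b := by
  rcases eq_or_ne σ 0 with rfl | hσ
  · have : (v.sum fun x a => v.sum fun y b => rbf 0 y x * a * b) = (v.sum fun _ a => a) ^ 2 := by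
      simp [rbf, Finsupp.sum, sq, Finset.sum_mul_sum]
    rw [this]; positivity
  -- the functions `exp(-2‖z - x‖²/σ²)` of `z` are, up to a constant, a feature map in `L²`
  set c : ℝ := 2 / σ ^ 2 with hc
  have hc0 : 0 < c := by positivity
  have hint : ∀ b : ℝ, 0 < b → Integrable (fun z : Pt d => Real.exp (-b * ‖z‖ ^ 2)) := by
    intro b hb
    have h := GaussianFourier.integrable_cexp_neg_mul_sq_norm_add (V := Pt d) (b := (b : ℂ))
      (by simpa using hb) 0 0
    have h2 := h.norm
    refine h2.congr (Filter.Eventually.of_forall fun z => ?_)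
    simp only [Complex.norm_exp]
    congr 1
    simp [← Complex.ofReal_pow]
  set C : ℝ := ∫ z : Pt d, Real.exp (-(2 * c) * ‖z‖ ^ 2) with hC
  have hCpos : 0 < C := integral_exp_pos (hint (2 * c) (by positivity))
  have hid : ∀ x y z : Pt d, Real.exp (-c * ‖z - x‖ ^ 2) * Real.exp (-c * ‖z - y‖ ^ 2)
      = rbf σ y x * Real.exp (-(2 * c) * ‖z - (1 / 2 : ℝ) • (x + y)‖ ^ 2) := by
    intro x y z
    have key : ‖z - x‖ ^ 2 + ‖z - y‖ ^ 2
        = ‖y - x‖ ^ 2 / 2 + 2 * ‖z - (1 / 2 : ℝ) • (x + y)‖ ^ 2 := by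
      simp only [← real_inner_self_eq_norm_sq, inner_sub_left, inner_sub_right, inner_add_left,
        inner_add_right, inner_smul_left, inner_smul_right]
      rw [real_inner_comm x z, real_inner_comm y z, real_inner_comm x y]
      simp
      ring
    rw [rbf, ← Real.exp_add, ← Real.exp_add]
    congr 1
    have : -‖y - x‖ ^ 2 / σ ^ 2 = -c * (‖y - x‖ ^ 2 / 2) := by rw [hc]; field_simp
    rw [this]
    linear_combination (-c) * key
  have hI : ∀ x y : Pt d,
      Integrable (fun z => Real.exp (-c * ‖z - x‖ ^ 2) * Real.exp (-c * ‖z - y‖ ^ 2)) := by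
    intro x y
    simp_rw [hid]
    exact ((hint (2 * c) (by positivity)).comp_sub_right _).const_mul _
  have hval : ∀ x y : Pt d,
      ∫ z, Real.exp (-c * ‖z - x‖ ^ 2) * Real.exp (-c * ‖z - y‖ ^ 2) = rbf σ y x * C := by
    intro x y
    simp_rw [hid]
    rw [integral_const_mul,
      integral_sub_right_eq_self (fun z : Pt d => Real.exp (-(2 * c) * ‖z‖ ^ 2))]
  have hsq : (v.sum fun x a => v.sum fun y b => rbf σ y x * a * b) * C
      = ∫ z, (v.sum fun x a => a * Real.exp (-c * ‖z - x‖ ^ 2)) ^ 2 := by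
    have hexp : ∀ z : Pt d, (v.sum fun x a => a * Real.exp (-c * ‖z - x‖ ^ 2)) ^ 2
        = ∑ x ∈ v.support, ∑ y ∈ v.support, (v x * v y) *
          (Real.exp (-c * ‖z - x‖ ^ 2) * Real.exp (-c * ‖z - y‖ ^ 2)) := by
      intro z
      rw [Finsupp.sum, sq, Finset.sum_mul_sum]
      refine Finset.sum_congr rfl fun x _ => Finset.sum_congr rfl fun y _ => by ring
    simp_rw [hexp]
    rw [integral_finsetSum _ fun x _ => integrable_finsetSum _ fun y _ => (hI x y).const_mul _]
    rw [Finsupp.sum, Finset.sum_mul]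
    refine Finset.sum_congr rfl fun x _ => ?_
    rw [integral_finsetSum _ fun y _ => (hI x y).const_mul _, Finsupp.sum, Finset.sum_mul]
    refine Finset.sum_congr rfl fun y _ => ?_
    rw [integral_const_mul, hval]
    ring
  have : 0 ≤ (v.sum fun x a => v.sum fun y b => rbf σ y x * a * b) * C := by
    rw [hsq]; exact integral_nonneg fun z => sq_nonneg _
  exact nonneg_of_mul_nonneg_left this hCpos

open scoped ComplexOrder in
theorem rbfMatrix_posSemidef (d : ℕ) (σ : ℝ) : (rbfMatrix d σ).PosSemidef := by
  have htfae := (RKHS.posSemidef_tfae (K := rbfMatrix d σ)).out 0 2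
  refine htfae.mpr ⟨?_, fun v => ?_⟩
  · ext x y
    simp [rbfMatrix, rbf, norm_sub_rev x y, Matrix.conjTranspose_apply,
      ContinuousLinearMap.star_eq_adjoint, ContinuousLinearMap.adjoint_id]
  · have h := rbf_posSemidef_aux σ v
    simpa [rbfMatrix, mul_comm, mul_left_comm, mul_assoc] using h

instance instFactRbf (d : ℕ) (σ : ℝ) : Fact (rbfMatrix d σ).PosSemidef :=
  ⟨rbfMatrix_posSemidef d σ⟩

/-- The reproducing kernel Hilbert space `H` of the RBF kernel. An element `g` is a function on
`ℝ^d` with `g x = ⟨g, k(x, ·)⟩`. -/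
abbrev RBFSpace (d : ℕ) (σ : ℝ) : Type := RKHS.OfKernel (rbfMatrix d σ)

/-- The covering number, by disks of radius `ε` for the supremum norm over `X`, of the ball of
radius `R` in `H`. -/
def ballCoveringNumber {d : ℕ} (X : Set (Pt d)) (σ R : ℝ) (ε : ℝ≥0) : ℕ∞ :=
  Metric.coveringNumber ε
    ((fun g : RBFSpace d σ => UniformFun.ofFun (fun x : X => g (x : Pt d))) ''
      Metric.closedBall 0 R)

/-! ### The rank-SVM and the score -/

/-- The hinge loss. -/
def hinge (t : ℝ) : ℝ := max 0 (1 - t)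

/-- The empirical pairwise hinge risk, averaged over the preference pairs. -/
def empRisk {d n : ℕ} {σ : ℝ} (K : ℕ) (s : Fin n → Pt d) (g : RBFSpace d σ) : ℝ :=
  (1 / ((prefPairs K s).card : ℝ)) * ∑ q ∈ prefPairs K s, hinge (g (s q.1) - g (s q.2))

/-- `g` is the rank-SVM ranker: it minimizes the regularized empirical pairwise hinge risk. -/
def IsRanker {d n : ℕ} {σ : ℝ} (K : ℕ) (lam : ℝ) (s : Fin n → Pt d) (g : RBFSpace d σ) : Prop :=
  ∀ h : RBFSpace d σ, empRisk K s g + lam * ‖g‖ ^ 2 ≤ empRisk K s h + lam * ‖h‖ ^ 2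

/-- The score `R̂_n(η) = (1/n) #{i : g(η) < g(x_i)}`. -/
def score {d n : ℕ} {σ : ℝ} (s : Fin n → Pt d) (g : RBFSpace d σ) (η : Pt d) : ℝ :=
  open Classical in
  (1 / (n : ℝ)) * ((Finset.univ.filter (fun i => g η < g (s i))).card : ℝ)

end RankAD

end

/-! The score of η counts the sample points that the ranker puts above η. If the ranker decreases
along f₀, these are the points of smaller density, and their fraction is close to p(η) by
Glivenko–Cantelli. So it suffices that the ranker goes against the density on few of the pairs whose
densities differ by at least δ; pairs of closer densities are few because f₀ has no flat regions.

Preferences. Put ρ^d = K/n. At points where the sample fraction of every ball of radius t ≤ Rρ is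
f₀(x)·vol up to ερ^d, larger density forces smaller G (`exists_localCount_compare`). All but a
vanishing fraction of the sample is of this kind (`ae_eventually_fraction_not_hasLocalCount`).
Indeed nρ^d = K → ∞, so a bounded region has only e^{o(n)} unions of cubes of side θρ, and
Hoeffding's inequality holds uniformly over them. This bounds the sum of the absolute discrepancies
of the cubes and leaves few deviant ones. Lebesgue differentiation controls the oscillation of f₀.
Hence G misorders few pairs (`ae_eventually_card_misordered_le`).

Empirical risk. The space H is dense in C(X), so a fixed h ∈ H approximates -(2/δ)f₀. Its risk is
small and λ_n‖h‖² → 0, so the risk of the ranker is small too (`ae_eventually_empRisk_isRanker_le`).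

Generalization. The ranker depends on the sample, but it lies in the ball of radius 1/√λ_n, which
has uniform covers by e^{o(n)} functions. For these, the truncated hinge loss on pairs obeys a
uniform law (`ae_forall_crossMean_near`): the pairs between the two halves of the sample split into
cyclic shifts, each a family of independent pairs. So the ranker rarely misorders a sample point and
an independent η, and `abs_score_sub_levelFraction_le` turns this into L¹(P) convergence of the
score on an almost sure event.

The rest is deterministic on that event: L¹(P) convergence gives convergence in measure for every ν
≪ P, and the decision regions converge because the p-value is uniform under P. Minimality of volume
is the Neyman–Pearson argument. -/

namespace RankAD

/-! ### The nominal distribution -/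

/-- The distribution function of `f₀` under the nominal distribution. -/
noncomputable def levelMass {d : ℕ} (f₀ : Pt d → ℝ) (t : ℝ) : ℝ := (nominal f₀).real {x | f₀ x ≤ t}

namespace IsNominalDensity

variable {d : ℕ} {X : Set (Pt d)} {f₀ : Pt d → ℝ}

theorem measurable (hf : IsNominalDensity X f₀) : Measurable f₀ := by
  have h : f₀ = X.indicator f₀ := by
    ext x
    by_cases hx : x ∈ X
    · simp [hx]
    · simp [hx, hf.eq_zero x hx]
  have h2 : Measurable (X.indicator f₀) := by
    classical
    have h3 := hf.continuousOn.measurable_piecewise (g := fun _ => (0 : ℝ)) continuousOn_const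
      hf.isCompact.measurableSet
    convert h3 using 1
    exact (Set.piecewise_eq_indicator (s := X) (f := f₀)).symm
  rw [h]
  exact h2

theorem nonneg (hf : IsNominalDensity X f₀) (x : Pt d) : 0 ≤ f₀ x := by
  obtain ⟨m, hm, h⟩ := hf.lower_bound
  by_cases hx : x ∈ X
  · exact hm.le.trans (h x hx)
  · exact (hf.eq_zero x hx).ge

theorem exists_upper_bound (hf : IsNominalDensity X f₀) : ∃ C : ℝ, 0 < C ∧ ∀ x, f₀ x ≤ C := by
  obtain ⟨C, hC⟩ := (hf.isCompact.image_of_continuousOn hf.continuousOn).bddAbove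
  refine ⟨max C 1, by positivity, fun x => ?_⟩
  by_cases hx : x ∈ X
  · exact (hC ⟨x, hx, rfl⟩).trans (le_max_left _ _)
  · rw [hf.eq_zero x hx]; positivity

theorem isProbabilityMeasure (hf : IsNominalDensity X f₀) :
    IsProbabilityMeasure (nominal f₀) := by
  constructor
  rw [nominal, withDensity_apply _ MeasurableSet.univ, setLIntegral_univ, hf.total_mass]

theorem nominal_apply (A : Set (Pt d)) :
    nominal f₀ A = ∫⁻ x in A, ENNReal.ofReal (f₀ x) := by
  rw [nominal, withDensity_apply' _ A]

theorem nominal_compl (hf : IsNominalDensity X f₀) : nominal f₀ Xᶜ = 0 := by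
  rw [nominal_apply]
  refine (setLIntegral_congr_fun hf.isCompact.measurableSet.compl (g := fun _ => 0)
    fun x hx => ?_).trans (by simp)
  simp [hf.eq_zero x hx]

theorem ae_mem (hf : IsNominalDensity X f₀) : ∀ᵐ x ∂nominal f₀, x ∈ X := by
  rw [ae_iff]
  exact hf.nominal_compl

theorem nominal_le (A : Set (Pt d)) {C : ℝ} (hA : MeasurableSet A) (h : ∀ x ∈ A, f₀ x ≤ C) :
    nominal f₀ A ≤ ENNReal.ofReal C * volume A := by
  rw [nominal_apply, ← setLIntegral_const]
  exact setLIntegral_mono' hA fun x hx => ENNReal.ofReal_le_ofReal (h x hx)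

theorem le_nominal (A : Set (Pt d)) {C : ℝ} (hA : MeasurableSet A) (h : ∀ x ∈ A, C ≤ f₀ x) :
    ENNReal.ofReal C * volume A ≤ nominal f₀ A := by
  rw [nominal_apply, ← setLIntegral_const]
  exact setLIntegral_mono' hA fun x hx => ENNReal.ofReal_le_ofReal (h x hx)

theorem absolutelyContinuous (hf : IsNominalDensity X f₀) :
    volume.restrict X ≪ nominal f₀ := by
  obtain ⟨m, hm, h⟩ := hf.lower_bound
  refine Measure.AbsolutelyContinuous.mk fun A hA h0 => ?_
  rw [Measure.restrict_apply hA]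
  have h1 := le_nominal (f₀ := f₀) (A ∩ X) (hA.inter hf.isCompact.measurableSet)
    (fun x hx => h x hx.2)
  have h2 : nominal f₀ (A ∩ X) = 0 := measure_mono_null Set.inter_subset_left h0
  rw [h2, nonpos_iff_eq_zero, mul_eq_zero] at h1
  exact h1.resolve_left (by simp [hm])

theorem levelMass_mono (hf : IsNominalDensity X f₀) : Monotone (levelMass f₀) := by
  have := hf.isProbabilityMeasure
  exact fun s t hst => measureReal_mono fun x (hx : f₀ x ≤ s) => hx.trans hst

theorem levelMass_sub (hf : IsNominalDensity X f₀) {s t : ℝ} (hst : s ≤ t) :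
    levelMass f₀ t - levelMass f₀ s = (nominal f₀).real {x | s < f₀ x ∧ f₀ x ≤ t} := by
  have := hf.isProbabilityMeasure
  have h : {x | s < f₀ x ∧ f₀ x ≤ t} = {x | f₀ x ≤ t} \ {x | f₀ x ≤ s} := by
    ext x; simp [and_comm]
  have hsub : {x | f₀ x ≤ s} ⊆ {x | f₀ x ≤ t} := fun x (hx : f₀ x ≤ s) => hx.trans hst
  rw [h, measureReal_sdiff hsub (measurableSet_le hf.measurable measurable_const)]
  rfl

/-- The absence of flat regions concerns windows centred at values taken on X. A window (t, t+s]
either contains such a value, and then lies within s of it, or has no mass. -/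
theorem exists_levelMass_lipschitz (hf : IsNominalDensity X f₀) :
    ∃ M : ℝ, 0 < M ∧ ∀ t s : ℝ, 0 ≤ s → levelMass f₀ (t + s) - levelMass f₀ t ≤ M * s := by
  have := hf.isProbabilityMeasure
  obtain ⟨M, hM⟩ := hf.no_flat
  refine ⟨max M 1, by positivity, fun t s hs => ?_⟩
  rcases hs.eq_or_lt with rfl | hs
  · simp
  rw [hf.levelMass_sub (by linarith)]
  by_cases h : ∃ x ∈ X, t < f₀ x ∧ f₀ x ≤ t + s
  · obtain ⟨x, hx, h1, h2⟩ := h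
    calc (nominal f₀).real {y | t < f₀ y ∧ f₀ y ≤ t + s}
        ≤ (nominal f₀).real {y | |f₀ y - f₀ x| < s} := by
          refine measureReal_mono fun y hy => ?_
          simp only [Set.mem_ofPred_eq] at hy ⊢
          rw [abs_lt]; constructor <;> linarith [hy.1, hy.2]
      _ ≤ M * s := hM x hx s hs
      _ ≤ _ := by gcongr; exact le_max_left _ _
  · have h0 : (nominal f₀).real {y | t < f₀ y ∧ f₀ y ≤ t + s} = 0 := by
      rw [measureReal_eq_zero_iff]
      refine measure_mono_null (fun y hy hyX => h ⟨y, hyX, hy⟩) hf.nominal_compl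
    rw [h0]; positivity

theorem continuous_levelMass (hf : IsNominalDensity X f₀) : Continuous (levelMass f₀) := by
  obtain ⟨M, hM, h⟩ := hf.exists_levelMass_lipschitz
  refine (LipschitzWith.of_le_add_mul M.toNNReal fun x y => ?_).continuous
  rw [Real.coe_toNNReal _ hM.le]
  rcases le_total x y with hxy | hxy
  · have := hf.levelMass_mono hxy
    have : 0 ≤ M * dist x y := by positivity
    linarith
  · have := h y (x - y) (by linarith)
    rw [Real.dist_eq, abs_of_nonneg (by linarith)]
    rw [add_sub_cancel] at this
    linarith

theorem levelMass_of_le (hf : IsNominalDensity X f₀) {C t : ℝ} (h : ∀ x, f₀ x ≤ C) (ht : C ≤ t) :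
    levelMass f₀ t = 1 := by
  have := hf.isProbabilityMeasure
  have : {x | f₀ x ≤ t} = Set.univ := Set.eq_univ_of_forall fun x => (h x).trans ht
  rw [levelMass, this, probReal_univ]

theorem levelMass_of_lt (hf : IsNominalDensity X f₀) {m t : ℝ} (h : ∀ x ∈ X, m ≤ f₀ x)
    (ht : t < m) : levelMass f₀ t = 0 := by
  have := hf.isProbabilityMeasure
  rw [levelMass, measureReal_eq_zero_iff]
  have hsub : {x | f₀ x ≤ t} ⊆ Xᶜ := fun x (hx : f₀ x ≤ t) hxX =>
    absurd (h x hxX) (not_le.2 (lt_of_le_of_lt hx ht))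
  exact measure_mono_null hsub hf.nominal_compl

/-- Every level `α ∈ (0, 1)` is the mass below a threshold `a > 0`, and the points of `p`-value at
least `α` are those at which the density is at least `a`. -/
theorem exists_threshold (hf : IsNominalDensity X f₀) {α : ℝ} (hα : α ∈ Set.Ioo (0 : ℝ) 1) :
    ∃ a : ℝ, 0 < a ∧ levelMass f₀ a = α ∧ ∀ t, α ≤ levelMass f₀ t ↔ a ≤ t := by
  obtain ⟨m, hm, hmin⟩ := hf.lower_bound
  obtain ⟨C, hC, hmax⟩ := hf.exists_upper_bound
  set S : Set ℝ := {t | α ≤ levelMass f₀ t} with hS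
  have hclosed : IsClosed S := isClosed_le continuous_const hf.continuous_levelMass
  have hbdd : BddBelow S := ⟨0, fun t ht => by
    by_contra hlt
    have h0 := hf.levelMass_of_lt hmin (lt_trans (not_le.1 hlt) hm)
    have : α ≤ levelMass f₀ t := ht
    linarith [hα.1]⟩
  have hne : S.Nonempty := ⟨C, by
    change α ≤ levelMass f₀ C
    rw [hf.levelMass_of_le hmax le_rfl]; exact hα.2.le⟩
  have hmem : sInf S ∈ S := hclosed.csInf_mem hne hbdd
  have hiff : ∀ t, α ≤ levelMass f₀ t ↔ sInf S ≤ t := fun t =>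
    ⟨fun h => csInf_le hbdd h, fun h => le_trans hmem (hf.levelMass_mono h)⟩
  refine ⟨sInf S, ?_, ?_, hiff⟩
  · by_contra hle
    have h0 := hf.levelMass_of_lt hmin (lt_of_le_of_lt (not_lt.1 hle) hm)
    have : α ≤ levelMass f₀ (sInf S) := hmem
    linarith [hα.1]
  · refine le_antisymm ?_ hmem
    -- Below the infimum the mass is less than α, so continuity from the left excludes a mass larger
    -- than α at the infimum.
    have hlim : Tendsto (levelMass f₀) (𝓝[<] (sInf S)) (𝓝 (levelMass f₀ (sInf S))) :=
      (hf.continuous_levelMass.tendsto _).mono_left nhdsWithin_le_nhds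
    refine le_of_tendsto hlim ?_
    filter_upwards [self_mem_nhdsWithin] with t ht
    exact (not_le.1 (mt (hiff t).1 (not_le.2 ht))).le

/-- The p-value is uniformly distributed under P: by the Lipschitz bound, replacing f₀ < a by f₀ ≤ a
does not change the mass. -/
theorem nominal_pValue_lt (hf : IsNominalDensity X f₀) {α : ℝ} (hα : α ∈ Set.Ioo (0 : ℝ) 1) :
    (nominal f₀).real {η | pValue f₀ η < α} = α := by
  have := hf.isProbabilityMeasure
  obtain ⟨a, ha, haα, hiff⟩ := hf.exists_threshold hα
  obtain ⟨M, hM, hlip⟩ := hf.exists_levelMass_lipschitz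
  have hset : {η | pValue f₀ η < α} = {η | f₀ η < a} := by
    ext η
    exact lt_iff_lt_of_le_iff_le (hiff (f₀ η))
  rw [hset]
  refine le_antisymm ?_ ?_
  · rw [← haα]
    exact measureReal_mono fun x (hx : f₀ x < a) => hx.le
  · refine le_of_forall_pos_le_add fun ε hε => ?_
    have h1 := hlip (a - ε / M) (ε / M) (by positivity)
    have h2 : levelMass f₀ (a - ε / M) ≤ (nominal f₀).real {η | f₀ η < a} :=
      measureReal_mono fun x (hx : f₀ x ≤ a - ε / M) => by
        have : 0 < ε / M := by positivity
        exact lt_of_le_of_lt hx (by linarith)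
    rw [sub_add_cancel, haα, mul_div_cancel₀ _ hM.ne'] at h1
    linarith

theorem measurable_pValue (hf : IsNominalDensity X f₀) : Measurable (pValue f₀) :=
  hf.continuous_levelMass.measurable.comp hf.measurable

theorem nominal_le_pValue (hf : IsNominalDensity X f₀) {α : ℝ} (hα : α ∈ Set.Ioo (0 : ℝ) 1) :
    (nominal f₀).real {η | α ≤ pValue f₀ η} = 1 - α := by
  have := hf.isProbabilityMeasure
  have h : {η | α ≤ pValue f₀ η} = {η | pValue f₀ η < α}ᶜ := by ext; simp
  rw [h, probReal_compl_eq_one_sub (measurableSet_lt hf.measurable_pValue measurable_const),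
    hf.nominal_pValue_lt hα]

/-- Neyman–Pearson: U is the superlevel set f₀ ≥ a and has the least admissible mass, so P(U \ A) ≤
P(A \ U). The density is at least a on the first set and at most a on the second, and dividing by a
> 0 compares the volumes. -/
theorem isMinVolumeSet (hf : IsNominalDensity X f₀) {α : ℝ} (hα : α ∈ Set.Ioo (0 : ℝ) 1) :
    IsMinVolumeSet f₀ α {η | α ≤ pValue f₀ η} := by
  have := hf.isProbabilityMeasure
  obtain ⟨a, ha, haα, hiff⟩ := hf.exists_threshold hα
  have hU : MeasurableSet {η | α ≤ pValue f₀ η} := hf.measurable_pValue measurableSet_Ici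
  refine ⟨⟨hU, (hf.nominal_le_pValue hα).ge⟩, fun A hA hPA => ?_⟩
  set U := {η | α ≤ pValue f₀ η} with hUdef
  have hmemU : ∀ x, x ∈ U ↔ a ≤ f₀ x := fun x => hiff (f₀ x)
  have h1 : ENNReal.ofReal a * volume (U \ A) ≤ nominal f₀ (U \ A) :=
    le_nominal _ (hU.diff hA) fun x hx => (hmemU x).1 hx.1
  have h2 : nominal f₀ (A \ U) ≤ ENNReal.ofReal a * volume (A \ U) :=
    nominal_le _ (hA.diff hU) fun x hx => (not_le.1 (mt (hmemU x).2 hx.2)).le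
  have h3 : nominal f₀ (U \ A) ≤ nominal f₀ (A \ U) := by
    have hle : nominal f₀ U ≤ nominal f₀ A := by
      rw [← hf.nominal_le_pValue hα] at hPA
      exact (ENNReal.toReal_le_toReal (measure_ne_top _ _) (measure_ne_top _ _)).1 hPA
    rw [← measure_inter_add_sdiff U hA, ← measure_inter_add_sdiff A hU, Set.inter_comm A U] at hle
    exact (ENNReal.add_le_add_iff_left (measure_ne_top _ _)).1 hle
  have h4 : volume (U \ A) ≤ volume (A \ U) :=
    (ENNReal.mul_le_mul_iff_right (by simpa using ha) ENNReal.ofReal_ne_top).1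
      (h1.trans (h3.trans h2))
  rw [← measure_inter_add_sdiff U hA, ← measure_inter_add_sdiff A hU, Set.inter_comm A U]
  gcongr

/-- The constant is 3 and not 2 because the closed band is put inside the half-open band [α - ε, α +
2ε). -/
theorem nominal_pValue_near (hf : IsNominalDensity X f₀) {α ε : ℝ} (h0 : 0 < α - ε)
    (h1 : α + 2 * ε < 1) (hε : 0 < ε) :
    (nominal f₀).real {η | |pValue f₀ η - α| ≤ ε} ≤ 3 * ε := by
  have := hf.isProbabilityMeasure
  calc (nominal f₀).real {η | |pValue f₀ η - α| ≤ ε}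
      ≤ (nominal f₀).real ({η | pValue f₀ η < α + 2 * ε} \ {η | pValue f₀ η < α - ε}) := by
        refine measureReal_mono fun η (hη : |pValue f₀ η - α| ≤ ε) => ?_
        rw [abs_le] at hη
        simp only [Set.mem_sdiff, Set.mem_ofPred_eq, not_lt]
        constructor <;> linarith [hη.1, hη.2]
    _ = 3 * ε := by
        have hsub : {η | pValue f₀ η < α - ε} ⊆ {η | pValue f₀ η < α + 2 * ε} :=
          fun η (hη : pValue f₀ η < α - ε) => hη.trans (by linarith)
        rw [measureReal_sdiff hsub (measurableSet_lt hf.measurable_pValue measurable_const),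
          hf.nominal_pValue_lt ⟨by linarith, h1⟩, hf.nominal_pValue_lt ⟨h0, by linarith⟩]
        ring

end IsNominalDensity

/-! ### The reproducing kernel Hilbert space -/

section RBFSpace

variable {d : ℕ} {σ : ℝ}

theorem rbf_self (x : Pt d) : rbf σ x x = 1 := by simp [rbf]

theorem rbf_comm (x y : Pt d) : rbf σ x y = rbf σ y x := by
  rw [rbf, rbf, norm_sub_rev]

theorem continuous_rbf_left (y : Pt d) : Continuous fun x => rbf σ x y := by
  unfold rbf; fun_prop

/-- The kernel section `k(·, y)` as an element of the space. -/
noncomputable def kerSection (σ : ℝ) (y : Pt d) : RBFSpace d σ :=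
  RKHS.kerFun (RBFSpace d σ) y (1 : ℝ)

theorem kerSection_apply (x y : Pt d) : kerSection σ y x = rbf σ x y := by
  rw [kerSection, RKHS.kerFun_apply, RKHS.OfKernel.kernel_ofKernel]
  simp [rbfMatrix]

theorem inner_kerSection (g : RBFSpace d σ) (x : Pt d) : inner ℝ g (kerSection σ x) = g x := by
  rw [kerSection, RKHS.inner_kerFun]
  simp

theorem norm_kerSection (x : Pt d) : ‖kerSection σ x‖ = 1 := by
  have h := real_inner_self_eq_norm_sq (kerSection σ x)
  rw [inner_kerSection, kerSection_apply, rbf_self] at h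
  have := norm_nonneg (kerSection σ x)
  nlinarith

/-- The squared distance between two sections is 2 - 2k(x, y). -/
theorem continuous_kerSection : Continuous (fun x : Pt d => kerSection σ x) := by
  rw [continuous_iff_continuousAt]
  intro y
  rw [ContinuousAt, tendsto_iff_norm_sub_tendsto_zero]
  have h : ∀ x : Pt d, ‖kerSection σ x - kerSection σ y‖ = √(2 - 2 * rbf σ x y) := by
    intro x
    rw [← Real.sqrt_sq (norm_nonneg (kerSection σ x - kerSection σ y)), norm_sub_sq_real,
      norm_kerSection, norm_kerSection, inner_kerSection, kerSection_apply, rbf_comm y x]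
    congr 1; ring
  simp_rw [h]
  have hc : Continuous fun x : Pt d => √(2 - 2 * rbf σ x y) :=
    (continuous_const.sub (continuous_const.mul (continuous_rbf_left y))).sqrt
  have := hc.tendsto y
  rwa [rbf_self, mul_one, sub_self, Real.sqrt_zero] at this

theorem continuous_apply (g : RBFSpace d σ) : Continuous (fun x : Pt d => g x) := by
  simp_rw [← inner_kerSection]
  exact continuous_const.inner continuous_kerSection

/-- The exponential `exp(2⟨·, y⟩/σ²)`. -/
noncomputable def expInner (X : Set (Pt d)) (σ : ℝ) (y : Pt d) : C(X, ℝ) :=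
  ⟨fun x => Real.exp (2 * inner ℝ (x : Pt d) y / σ ^ 2), by fun_prop⟩

/-- The exponentials `exp(2⟨·, y⟩/σ²)` form a submonoid. -/
noncomputable def expSubmonoid (X : Set (Pt d)) (σ : ℝ) : Submonoid C(X, ℝ) where
  carrier := Set.range (expInner X σ)
  one_mem' := ⟨0, by ext x; simp [expInner]⟩
  mul_mem' := by
    rintro _ _ ⟨y, rfl⟩ ⟨z, rfl⟩
    refine ⟨y + z, ?_⟩
    ext x
    simp only [expInner, ContinuousMap.coe_mk, ContinuousMap.mul_apply, ← Real.exp_add,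
      inner_add_right]
    congr 1; ring

/-- The space of the RBF kernel is dense in the continuous functions on a compact set. -/
theorem exists_near_continuousOn {X : Set (Pt d)} (hX : IsCompact X) (hσ : 0 < σ)
    {u : Pt d → ℝ} (hu : ContinuousOn u X) {ε : ℝ} (hε : 0 < ε) :
    ∃ h : RBFSpace d σ, ∀ x ∈ X, |h x - u x| ≤ ε := by
  have : CompactSpace X := isCompact_iff_compactSpace.1 hX
  -- The kernel factors as exp(-‖x‖²/σ²) exp(2⟨x, y⟩/σ²) exp(-‖y‖²/σ²). The middle factors are
  -- closed under products, so the algebra they generate is their linear span, and the first factor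
  -- carries this span into H.
  set A : Subalgebra ℝ C(X, ℝ) := Algebra.adjoin ℝ (expSubmonoid X σ : Set C(X, ℝ)) with hA
  have hsep : A.SeparatesPoints := by
    intro x y hxy
    refine ⟨_, ⟨expInner X σ (x - y), Algebra.subset_adjoin ⟨_, rfl⟩, rfl⟩, fun h => hxy ?_⟩
    simp only [expInner, ContinuousMap.coe_mk] at h
    rw [Real.exp_eq_exp, div_left_inj' (by positivity)] at h
    have h0 : inner ℝ ((x : Pt d) - y) ((x : Pt d) - y) = 0 := by
      rw [inner_sub_left]; linarith
    exact Subtype.ext (sub_eq_zero.1 (inner_self_eq_zero.1 h0))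
  have hrep : ∀ φ ∈ A, ∃ h : RBFSpace d σ, ∀ x : X,
      h x = Real.exp (-‖(x : Pt d)‖ ^ 2 / σ ^ 2) * φ x := by
    intro φ hφ
    rw [hA, ← Subalgebra.mem_toSubmodule, Algebra.adjoin_eq_span, Submonoid.closure_eq] at hφ
    induction hφ using Submodule.span_induction with
    | mem φ hφ =>
      obtain ⟨y, rfl⟩ := hφ
      refine ⟨Real.exp (‖y‖ ^ 2 / σ ^ 2) • kerSection σ y, fun x => ?_⟩
      simp only [RKHS.coe_smul, Pi.smul_apply, kerSection_apply, smul_eq_mul, expInner,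
        ContinuousMap.coe_mk, rbf, ← Real.exp_add, norm_sub_sq_real]
      congr 1; ring
    | zero => exact ⟨0, fun x => by simp⟩
    | add φ ψ _ _ h1 h2 =>
      obtain ⟨g, hg⟩ := h1
      obtain ⟨g', hg'⟩ := h2
      exact ⟨g + g', fun x => by simp [hg, hg', mul_add]⟩
    | smul c φ _ h1 =>
      obtain ⟨g, hg⟩ := h1
      exact ⟨c • g, fun x => by simp [hg]; ring⟩
  -- Stone–Weierstrass is applied to u divided by the weight exp(-‖x‖²/σ²); multiplying back does
  -- not enlarge the error, as the weight is at most 1.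
  have hv : Continuous fun x : X => u x * Real.exp (‖(x : Pt d)‖ ^ 2 / σ ^ 2) :=
    (continuousOn_iff_continuous_domRestrict.1 hu).mul (by fun_prop)
  obtain ⟨φ, hφ⟩ := ContinuousMap.exists_mem_subalgebra_near_continuous_of_separatesPoints A hsep
    _ hv ε hε
  obtain ⟨h, hh⟩ := hrep φ φ.2
  refine ⟨h, fun x hx => ?_⟩
  have h1 := (hφ ⟨x, hx⟩).le
  have h2 := hh ⟨x, hx⟩
  simp only [Real.norm_eq_abs] at h1 h2
  have hexp : Real.exp (-‖x‖ ^ 2 / σ ^ 2) * Real.exp (‖x‖ ^ 2 / σ ^ 2) = 1 := by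
    rw [← Real.exp_add, neg_div, neg_add_cancel, Real.exp_zero]
  have h3 : h x - u x = Real.exp (-‖x‖ ^ 2 / σ ^ 2) *
      ((φ : C(X, ℝ)) ⟨x, hx⟩ - u x * Real.exp (‖x‖ ^ 2 / σ ^ 2)) := by
    rw [h2]; linear_combination u x * hexp
  rw [h3, abs_mul, abs_of_pos (Real.exp_pos _)]
  calc _ ≤ 1 * ε := by
        gcongr
        rw [Real.exp_le_one_iff, neg_div]
        have : 0 ≤ ‖x‖ ^ 2 / σ ^ 2 := by positivity
        linarith
    _ = ε := one_mul ε

end RBFSpace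

/-! ### Existence and uniqueness of the ranker -/

theorem hinge_nonneg (t : ℝ) : 0 ≤ hinge t := le_max_left _ _

theorem continuous_hinge : Continuous hinge := by unfold hinge; fun_prop

theorem hinge_midpoint_le (s t : ℝ) : hinge ((s + t) / 2) ≤ (hinge s + hinge t) / 2 := by
  unfold hinge
  refine max_le ?_ ?_
  · linarith [le_max_left 0 (1 - s), le_max_left 0 (1 - t)]
  · linarith [le_max_right 0 (1 - s), le_max_right 0 (1 - t)]

section Ranker

variable {d n : ℕ} {σ : ℝ} (K : ℕ) (s : Fin n → Pt d)

theorem empRisk_nonneg (g : RBFSpace d σ) : 0 ≤ empRisk K s g :=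
  mul_nonneg (by positivity) (Finset.sum_nonneg fun _ _ => hinge_nonneg _)

theorem continuous_empRisk : Continuous (fun g : RBFSpace d σ => empRisk K s g) := by
  unfold empRisk
  refine continuous_const.mul (continuous_finsetSum _ fun q _ => continuous_hinge.comp ?_)
  exact (RKHS.continuous_eval _).sub (RKHS.continuous_eval _)

theorem empRisk_midpoint_le (g h : RBFSpace d σ) :
    empRisk K s ((1 / 2 : ℝ) • (g + h)) ≤ (empRisk K s g + empRisk K s h) / 2 := by
  unfold empRisk
  rw [← mul_add, mul_div_assoc, ← Finset.sum_add_distrib, Finset.sum_div]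
  refine mul_le_mul_of_nonneg_left (Finset.sum_le_sum fun q _ => ?_) (by positivity)
  refine le_trans (le_of_eq ?_) (hinge_midpoint_le _ _)
  congr 1
  simp only [RKHS.coe_smul, RKHS.coe_add, Pi.smul_apply, Pi.add_apply, smul_eq_mul]
  ring

theorem empRisk_zero_le : empRisk K s (0 : RBFSpace d σ) ≤ 1 := by
  unfold empRisk
  simp only [RKHS.coe_zero, Pi.zero_apply, sub_zero, hinge, Finset.sum_const]
  rcases Nat.eq_zero_or_pos (prefPairs K s).card with h | h
  · simp [h]
  · have : ((prefPairs K s).card : ℝ) ≠ 0 := by positivity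
    simp [this]

/-- The regularized empirical risk is strongly midpoint convex. -/
theorem regRisk_midpoint (lam : ℝ) (g h : RBFSpace d σ) :
    empRisk K s ((1 / 2 : ℝ) • (g + h)) + lam * ‖(1 / 2 : ℝ) • (g + h)‖ ^ 2
        + lam / 4 * ‖g - h‖ ^ 2
      ≤ ((empRisk K s g + lam * ‖g‖ ^ 2) + (empRisk K s h + lam * ‖h‖ ^ 2)) / 2 := by
  have h1 := empRisk_midpoint_le K s g h
  have h2 := parallelogram_law_with_norm ℝ g h
  have h3 : ‖(1 / 2 : ℝ) • (g + h)‖ ^ 2 = ‖g + h‖ ^ 2 / 4 := by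
    rw [norm_smul, mul_pow]; norm_num; ring
  rw [h3]
  linear_combination h1 + lam / 4 * h2

/-- Strong midpoint convexity bounds the distance of two elements by their excess over the infimum.
So minimizing sequences are Cauchy, and two minimizers coincide. -/
theorem existsUnique_isRanker {lam : ℝ} (hlam : 0 < lam) :
    ∃! g : RBFSpace d σ, IsRanker K lam s g := by
  set Φ : RBFSpace d σ → ℝ := fun g => empRisk K s g + lam * ‖g‖ ^ 2 with hΦ
  have hnn : ∀ g, 0 ≤ Φ g := fun g => add_nonneg (empRisk_nonneg K s g) (by positivity)
  have hcont : Continuous Φ := (continuous_empRisk K s).add (by fun_prop)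
  have hbdd : BddBelow (Set.range Φ) := ⟨0, by rintro _ ⟨g, rfl⟩; exact hnn g⟩
  set I : ℝ := sInf (Set.range Φ) with hI
  have hIle : ∀ g, I ≤ Φ g := fun g => csInf_le hbdd ⟨g, rfl⟩
  have hdist : ∀ g h, lam / 4 * ‖g - h‖ ^ 2 ≤ (Φ g - I + (Φ h - I)) / 2 := by
    intro g h
    have h1 := regRisk_midpoint K s lam g h
    have h2 := hIle ((1 / 2 : ℝ) • (g + h))
    simp only [hΦ] at h2 ⊢
    linarith
  obtain ⟨g, hg⟩ : ∃ g, Φ g = I := by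
    obtain ⟨v, -, hv, hmem⟩ := exists_seq_tendsto_sInf (Set.range_nonempty Φ) hbdd
    choose w hw using hmem
    have hΦw : Tendsto (fun k => Φ (w k)) atTop (𝓝 I) := by simpa only [hw] using hv
    have hcauchy : CauchySeq w := by
      rw [Metric.cauchySeq_iff']
      intro ε hε
      have hε' : 0 < lam / 4 * ε ^ 2 := by positivity
      have hev := hΦw.eventually (gt_mem_nhds (show I < I + lam / 4 * ε ^ 2 by linarith))
      obtain ⟨N, hN⟩ := eventually_atTop.1 hev
      refine ⟨N, fun k hk => ?_⟩
      have h1 := hdist (w k) (w N)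
      have h2 := hN k hk
      have h3 := hN N le_rfl
      rw [dist_eq_norm]
      have h4 : lam / 4 * ‖w k - w N‖ ^ 2 < lam / 4 * ε ^ 2 := by linarith
      exact lt_of_pow_lt_pow_left₀ 2 hε.le (lt_of_mul_lt_mul_left h4 (by positivity))
    obtain ⟨g, hg⟩ := cauchySeq_tendsto_of_complete hcauchy
    exact ⟨g, tendsto_nhds_unique ((hcont.tendsto g).comp hg) hΦw⟩
  refine ⟨g, fun h => (le_of_eq hg).trans (hIle h), fun h hh => ?_⟩
  have h1 : Φ h = I := le_antisymm ((hh g).trans hg.le) (hIle h)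
  have h2 := hdist h g
  rw [hg, h1] at h2
  have h3 : ‖h - g‖ ^ 2 ≤ 0 := by
    by_contra hpos
    have : 0 < lam / 4 * ‖h - g‖ ^ 2 := mul_pos (by positivity) (not_le.1 hpos)
    linarith
  have h4 : ‖h - g‖ = 0 := by
    have := norm_nonneg (h - g)
    nlinarith
  exact sub_eq_zero.1 (norm_eq_zero.1 h4)

/-- Comparison with g = 0, whose risk is at most 1. This places the ranker in the ball whose
covering numbers are controlled. -/
theorem IsRanker.norm_le {K : ℕ} {s : Fin n → Pt d} {lam : ℝ} (hlam : 0 < lam)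
    {g : RBFSpace d σ} (hg : IsRanker K lam s g) : ‖g‖ ≤ 1 / √lam := by
  have h1 := hg 0
  have h2 := empRisk_zero_le (σ := σ) K s
  have h3 := empRisk_nonneg K s g
  rw [norm_zero] at h1
  have h4 : lam * ‖g‖ ^ 2 ≤ 1 := by nlinarith
  have h5 : √lam * ‖g‖ ≤ 1 := by
    refine le_of_sq_le_sq ?_ zero_le_one
    rw [mul_pow, Real.sq_sqrt hlam.le]
    simpa using h4
  rw [le_div_iff₀ (Real.sqrt_pos.2 hlam), mul_comm]
  exact h5

end Ranker

/-! ### Uniform laws of large numbers over slowly growing families -/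

section Concentration

variable {Ω : Type*} [MeasurableSpace Ω] {μ : Measure Ω} [IsProbabilityMeasure μ]

/-- Hoeffding's inequality for averages of `[0, 1]`-valued variables. -/
theorem hoeffding_average {m : ℕ} {Y : Fin m → Ω → ℝ} {e : ℝ}
    (hmeas : ∀ i, Measurable (Y i)) (hmem : ∀ i ω, Y i ω ∈ Set.Icc (0 : ℝ) 1)
    (hmean : ∀ i, ∫ ω, Y i ω ∂μ = e)
    (hindep : ∀ (S : Finset (Fin m)) (a : Fin m), a ∉ S →
      IndepFun (Y a) (fun ω => ∑ i ∈ S, Y i ω) μ) {ε : ℝ} (hε : 0 ≤ ε) :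
    μ {ω | ε < |(1 / (m : ℝ)) * ∑ i, Y i ω - e|} ≤
      ENNReal.ofReal (2 * Real.exp (-(2 * m * ε ^ 2))) := by
  -- Adding one term at a time needs only the independence of the new term from the partial sum.
  -- Each term contributes 1/4 = ((1 - 0)/2)² to the variance proxy.
  have hsub : ∀ S : Finset (Fin m),
      HasSubgaussianMGF (fun ω => ∑ i ∈ S, (Y i ω - e)) (S.card * (1 / 4)) μ := by
    intro S
    induction S using Finset.induction_on with
    | empty => simp
    | insert a S ha ih =>
      have h1 : HasSubgaussianMGF (fun ω => Y a ω - e) (1 / 4) μ := by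
        have := hasSubgaussianMGF_of_mem_Icc (μ := μ) (a := 0) (b := 1) (hmeas a).aemeasurable
          (Eventually.of_forall fun ω => hmem a ω)
        rw [hmean a] at this
        convert this using 1
        ext; norm_num
      have h2 : IndepFun (fun ω => Y a ω - e) (fun ω => ∑ i ∈ S, (Y i ω - e)) μ := by
        have := (hindep S a ha).comp (φ := fun t => t - e) (ψ := fun t => t - S.card * e)
          (by fun_prop) (by fun_prop)
        have heq : (fun ω => ∑ i ∈ S, (Y i ω - e)) =
            (fun t => t - S.card * e) ∘ fun ω => ∑ i ∈ S, Y i ω := by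
          ext ω; simp [Finset.sum_sub_distrib]
        rw [heq]
        exact this
      have h3 := h1.add_of_indepFun ih h2
      convert h3 using 1
      · ext ω; rw [Finset.sum_insert ha]
      · rw [Finset.card_insert_of_notMem ha]; push_cast; ring
  have hm : HasSubgaussianMGF (fun ω => ∑ i, (Y i ω - e)) (m * (1 / 4)) μ := by
    simpa using hsub Finset.univ
  rcases Nat.eq_zero_or_pos m with rfl | hmpos
  · refine prob_le_one.trans ?_
    rw [← ENNReal.ofReal_one]
    refine ENNReal.ofReal_le_ofReal ?_
    simp
  have hm0 : (0 : ℝ) < m := by exact_mod_cast hmpos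
  have hexp : -(m * ε) ^ 2 / (2 * ((m * (1 / 4) : ℝ≥0) : ℝ)) = -(2 * m * ε ^ 2) := by
    push_cast; field_simp; ring
  have hu := hm.measure_ge_le (ε := m * ε) (by positivity)
  have hl := hm.neg.measure_ge_le (ε := m * ε) (by positivity)
  rw [hexp] at hu hl
  have hsubset : {ω | ε < |(1 / (m : ℝ)) * ∑ i, Y i ω - e|} ⊆
      {ω | m * ε ≤ ∑ i, (Y i ω - e)} ∪ {ω | m * ε ≤ (-fun ω => ∑ i, (Y i ω - e)) ω} := by
    intro ω (hω : ε < |(1 / (m : ℝ)) * ∑ i, Y i ω - e|)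
    have h1 : ∑ i, (Y i ω - e) = m * ((1 / (m : ℝ)) * ∑ i, Y i ω - e) := by
      simp [Finset.sum_sub_distrib]; field_simp
    rcases lt_abs.1 hω with h | h
    · left
      change m * ε ≤ ∑ i, (Y i ω - e)
      rw [h1]; gcongr
    · right
      change m * ε ≤ -∑ i, (Y i ω - e)
      rw [h1, ← mul_neg]; gcongr
  calc _ ≤ _ := measure_mono hsubset
    _ ≤ _ := measure_union_le _ _
    _ ≤ ENNReal.ofReal (Real.exp (-(2 * m * ε ^ 2))) +
        ENNReal.ofReal (Real.exp (-(2 * m * ε ^ 2))) := by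
        gcongr
        · rw [← ENNReal.ofReal_toReal (measure_ne_top μ _)]
          exact ENNReal.ofReal_le_ofReal hu
        · rw [← ENNReal.ofReal_toReal (measure_ne_top μ _)]
          exact ENNReal.ofReal_le_ofReal hl
    _ = _ := by rw [← ENNReal.ofReal_add (by positivity) (by positivity), ← two_mul]

omit [IsProbabilityMeasure μ] in
/-- Borel–Cantelli for families whose cardinality grows subexponentially. -/
theorem ae_eventually_forall_notMem {ι : Type*} (C : ℕ → Finset ι)
    (hC : ∀ a : ℝ, 0 < a → ∀ᶠ n : ℕ in atTop, ((C n).card : ℝ) ≤ Real.exp (a * n))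
    (B : ℕ → ι → Set Ω) {c : ℝ} (hc : 0 < c)
    (hB : ∀ᶠ n : ℕ in atTop, ∀ j ∈ C n,
      μ (B n j) ≤ ENNReal.ofReal (2 * n * Real.exp (-(c * n)))) :
    ∀ᵐ ω ∂μ, ∀ᶠ n in atTop, ∀ j ∈ C n, ω ∉ B n j := by
  -- Half of the exponent c pays for the cardinality of the family; the other half keeps the series
  -- summable.
  obtain ⟨N, hN⟩ := eventually_atTop.1 ((hC (c / 2) (by positivity)).and hB)
  set S : ℕ → Set Ω := fun n => if N ≤ n then ⋃ j ∈ C n, B n j else ∅ with hS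
  have hbound : ∀ n, μ (S n) ≤ ENNReal.ofReal (2 * ((n : ℝ) ^ 1 * Real.exp (-(c / 2) * n))) := by
    intro n
    by_cases hn : N ≤ n
    · obtain ⟨h1, h2⟩ := hN n hn
      simp only [hS, hn, if_true]
      calc μ (⋃ j ∈ C n, B n j) ≤ ∑ j ∈ C n, μ (B n j) := measure_biUnion_finset_le _ _
        _ ≤ ∑ j ∈ C n, ENNReal.ofReal (2 * n * Real.exp (-(c * n))) := Finset.sum_le_sum h2
        _ = ENNReal.ofReal ((C n).card * (2 * n * Real.exp (-(c * n)))) := by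
          rw [Finset.sum_const, nsmul_eq_mul, ENNReal.ofReal_mul (by positivity)]
          simp
        _ ≤ _ := by
          refine ENNReal.ofReal_le_ofReal ?_
          calc ((C n).card : ℝ) * (2 * n * Real.exp (-(c * n)))
              ≤ Real.exp (c / 2 * n) * (2 * n * Real.exp (-(c * n))) := by gcongr
            _ = 2 * (n ^ 1 * (Real.exp (c / 2 * n) * Real.exp (-(c * n)))) := by ring
            _ = _ := by rw [← Real.exp_add]; congr 3; ring_nf
    · simp [hS, hn]
  have hsum : ∑' n, μ (S n) ≠ ∞ := by
    refine ne_top_of_le_ne_top ?_ (ENNReal.tsum_le_tsum hbound)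
    exact ((Real.summable_pow_mul_exp_neg_nat_mul 1 (by positivity)).mul_left 2).tsum_ofReal_ne_top
  filter_upwards [ae_eventually_notMem hsum] with ω hω
  filter_upwards [hω, eventually_ge_atTop N] with n hn hNn j hj hmem
  refine hn ?_
  simp only [hS, hNn, if_true, Set.mem_iUnion]
  exact ⟨j, hj, hmem⟩

/-- The average of `u` over a finite sample. -/
noncomputable def empMean {E : Type*} {n : ℕ} (s : Fin n → E) (u : E → ℝ) : ℝ :=
  (1 / (n : ℝ)) * ∑ i, u (s i)

/-- The average of `u` over the pairs formed by a point of the first `m` points of a sequence and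
one of the next `m` points. -/
noncomputable def crossMean {E : Type*} (m : ℕ) (y : ℕ → E) (u : E → E → ℝ) : ℝ :=
  (1 / (m : ℝ) ^ 2) * ∑ i : Fin m, ∑ j : Fin m, u (y i) (y (m + j))

variable {E : Type*} [MeasurableSpace E] {P : Measure E}
  {x : ℕ → Ω → E} (hx_meas : ∀ i, Measurable (x i)) (hx_indep : iIndepFun x μ)
  (hx_law : ∀ i, μ.map (x i) = P)

include hx_meas hx_law in
omit [IsProbabilityMeasure μ] in
theorem integral_comp_sample {u : E → ℝ} (hu : Measurable u) (i : ℕ) :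
    ∫ ω, u (x i ω) ∂μ = ∫ y, u y ∂P := by
  rw [← hx_law i, integral_map (hx_meas i).aemeasurable hu.aestronglyMeasurable]

include hx_meas hx_indep hx_law in
theorem measure_empMean_sub_gt_le {u : E → ℝ} (hu : Measurable u)
    (hmem : ∀ y, u y ∈ Set.Icc (0 : ℝ) 1) (n : ℕ) {ε : ℝ} (hε : 0 ≤ ε) :
    μ {ω | ε < |empMean (fun i : Fin n => x i ω) u - ∫ y, u y ∂P|} ≤
      ENNReal.ofReal (2 * Real.exp (-(2 * n * ε ^ 2))) := by
  have hi : iIndepFun (fun (i : Fin n) ω => u (x i ω)) μ :=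
    (hx_indep.precomp (g := fun i : Fin n => (i : ℕ)) Fin.val_injective).comp (fun _ => u)
      fun _ => hu
  refine hoeffding_average (Y := fun (i : Fin n) ω => u (x i ω)) (fun i => hu.comp (hx_meas i))
    (fun i ω => hmem _) (fun i => integral_comp_sample hx_meas hx_law hu i) ?_ hε
  intro S a ha
  have := (hi.indepFun_finsetSum_of_notMem (fun i => hu.comp (hx_meas i)) ha).symm
  convert this using 1
  ext ω
  simp

include hx_meas hx_indep hx_law in
/-- **Uniform law of large numbers** over families of subexponential cardinality. -/
theorem ae_forall_empMean_near {ι : Type*} (C : ℕ → Finset ι)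
    (hC : ∀ a : ℝ, 0 < a → ∀ᶠ n : ℕ in atTop, ((C n).card : ℝ) ≤ Real.exp (a * n))
    (u : ℕ → ι → E → ℝ) (hu : ∀ n, ∀ j ∈ C n, Measurable (u n j))
    (hmem : ∀ n, ∀ j ∈ C n, ∀ y, u n j y ∈ Set.Icc (0 : ℝ) 1) :
    ∀ᵐ ω ∂μ, ∀ ε : ℝ, 0 < ε → ∀ᶠ n : ℕ in atTop, ∀ j ∈ C n,
      |empMean (fun i : Fin n => x i ω) (u n j) - ∫ y, u n j y ∂P| ≤ ε := by
  -- Countably many tolerances give one null set that serves every ε.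
  have key : ∀ k : ℕ, ∀ᵐ ω ∂μ, ∀ᶠ n : ℕ in atTop, ∀ j ∈ C n,
      ω ∉ {ω | 1 / ((k : ℝ) + 1) <
        |empMean (fun i : Fin n => x i ω) (u n j) - ∫ y, u n j y ∂P|} := by
    intro k
    refine ae_eventually_forall_notMem C hC _ (c := 2 * (1 / ((k : ℝ) + 1)) ^ 2)
      (by positivity) ?_
    filter_upwards [eventually_ge_atTop 1] with n hn j hj
    refine (measure_empMean_sub_gt_le hx_meas hx_indep hx_law (hu n j hj) (hmem n j hj) n
      (by positivity)).trans (ENNReal.ofReal_le_ofReal ?_)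
    have hn' : (1 : ℝ) ≤ n := by exact_mod_cast hn
    have : -(2 * n * (1 / ((k : ℝ) + 1)) ^ 2) = -(2 * (1 / ((k : ℝ) + 1)) ^ 2 * n) := by ring
    rw [this]
    gcongr
    linarith
  filter_upwards [ae_all_iff.2 key] with ω hω ε hε
  obtain ⟨k, hk⟩ := exists_nat_one_div_lt hε
  filter_upwards [hω k] with n hn j hj
  have h1 : ¬ (1 / ((k : ℝ) + 1) <
    |empMean (fun i : Fin n => x i ω) (u n j) - ∫ y, u n j y ∂P|) := hn j hj
  exact (not_lt.1 h1).trans hk.le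

include hx_meas hx_indep hx_law in
theorem integral_comp_pair {u : E → E → ℝ} (hu : Measurable (Function.uncurry u))
    {i j : ℕ} (hij : i ≠ j) :
    ∫ ω, u (x i ω) (x j ω) ∂μ = ∫ z, u z.1 z.2 ∂(P.prod P) := by
  have h := (hx_indep.indepFun hij).map_prod_eq_prod_map_map (hx_meas i).aemeasurable
    (hx_meas j).aemeasurable
  rw [hx_law, hx_law] at h
  rw [← h, integral_map ((hx_meas i).prodMk (hx_meas j)).aemeasurable]
  exact hu.aestronglyMeasurable

include hx_meas hx_indep hx_law in
-- As τ is injective, the pairs (i, m + τ i) have no index in common, so the summands are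
-- independent and Hoeffding's inequality applies.
theorem measure_shift_average_gt_le {u : E → E → ℝ} (hu : Measurable (Function.uncurry u))
    (hmem : ∀ y z, u y z ∈ Set.Icc (0 : ℝ) 1) {m : ℕ} (τ : Fin m → Fin m)
    (hτ : Function.Injective τ) {ε : ℝ} (hε : 0 ≤ ε) :
    μ {ω | ε < |(1 / (m : ℝ)) * ∑ i : Fin m, u (x i ω) (x (m + τ i) ω)
        - ∫ z, u z.1 z.2 ∂(P.prod P)|} ≤
      ENNReal.ofReal (2 * Real.exp (-(2 * m * ε ^ 2))) := by
  have hmeas : ∀ i : Fin m, Measurable fun ω => u (x i ω) (x (m + τ i) ω) := fun i =>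
    hu.comp ((hx_meas i).prodMk (hx_meas _))
  refine hoeffding_average (Y := fun (i : Fin m) ω => u (x i ω) (x (m + τ i) ω)) hmeas
    (fun i ω => hmem _ _)
    (fun i => integral_comp_pair hx_meas hx_indep hx_law hu (by have := i.2; omega)) ?_ hε
  intro S a ha
  -- The sample indices seen by the new pair and by the earlier pairs; independence of the terms
  -- comes from the disjointness of these sets.
  set T : Finset ℕ := {(a : ℕ), m + τ a} with hT
  set U : Finset ℕ := S.image (fun i : Fin m => (i : ℕ)) ∪ S.image (fun i => m + (τ i : ℕ)) with hU
  have hdisj : Disjoint T U := by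
    rw [Finset.disjoint_left]
    intro k hk hk'
    simp only [hT, hU, Finset.mem_insert, Finset.mem_singleton, Finset.mem_union,
      Finset.mem_image] at hk hk'
    have hav := a.2
    rcases hk with rfl | rfl
    · rcases hk' with ⟨i, hi, h⟩ | ⟨i, hi, h⟩
      · exact ha (Fin.ext h ▸ hi)
      · omega
    · rcases hk' with ⟨i, hi, h⟩ | ⟨i, hi, h⟩
      · have := i.2; omega
      · have h' : τ i = τ a := Fin.ext (by omega)
        exact ha (hτ h' ▸ hi)
  have h := hx_indep.indepFun_finset T U hdisj hx_meas
  have haT : (a : ℕ) ∈ T := by simp [hT]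
  have haT' : m + (τ a : ℕ) ∈ T := by simp [hT]
  have hiU : ∀ i ∈ S, (i : ℕ) ∈ U := fun i hi =>
    Finset.mem_union_left _ (Finset.mem_image_of_mem _ hi)
  have hiU' : ∀ i ∈ S, m + (τ i : ℕ) ∈ U := fun i hi =>
    Finset.mem_union_right _ (Finset.mem_image.2 ⟨i, hi, rfl⟩)
  have h2 := h.comp (φ := fun w : T → E => u (w ⟨a, haT⟩) (w ⟨_, haT'⟩))
    (ψ := fun w : U → E => ∑ i ∈ S.attach, u (w ⟨i, hiU i i.2⟩) (w ⟨_, hiU' i i.2⟩))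
    (hu.comp (f := fun w : T → E => (w ⟨a, haT⟩, w ⟨m + τ a, haT'⟩))
      ((measurable_pi_apply _).prodMk (measurable_pi_apply _)))
    (Finset.measurable_fun_sum _ fun i _ =>
      hu.comp (f := fun w : U → E => (w ⟨i, hiU i i.2⟩, w ⟨m + τ i, hiU' i i.2⟩))
        ((measurable_pi_apply _).prodMk (measurable_pi_apply _)))
  have heq : (fun ω => ∑ i ∈ S, u (x i ω) (x (m + τ i) ω)) =
      (fun w : U → E => ∑ i ∈ S.attach, u (w ⟨i, hiU i i.2⟩) (w ⟨_, hiU' i i.2⟩)) ∘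
        fun ω (i : U) => x i ω := by
    ext ω
    exact (Finset.sum_attach S fun i => u (x i ω) (x (m + τ i) ω)).symm
  rw [heq]
  exact h2

/-- The sum `i + k` is taken modulo m: the m cyclic shifts partition the m² cross pairs into m
perfect matchings. -/
theorem crossMean_eq_average_shifts {E : Type*} (m : ℕ) [NeZero m] (y : ℕ → E) (u : E → E → ℝ) :
    crossMean m y u =
      (1 / (m : ℝ)) * ∑ k : Fin m, (1 / (m : ℝ)) * ∑ i : Fin m, u (y i) (y (m + (i + k : Fin m))) := by
  rw [crossMean, ← Finset.mul_sum, ← mul_assoc, Finset.sum_comm (γ := Fin m)]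
  congr 1
  · ring
  rw [Finset.sum_comm]
  nth_rewrite 2 [Finset.sum_comm]
  refine Finset.sum_congr rfl fun i _ => ?_
  exact (Equiv.sum_comp (Equiv.addLeft i) fun j : Fin m => u (y i) (y (m + j))).symm

include hx_meas hx_indep hx_law in
/-- **Uniform law of large numbers for two-sample averages** over families of subexponential
cardinality. -/
theorem ae_forall_crossMean_near {ι : Type*} (C : ℕ → Finset ι)
    (hC : ∀ a : ℝ, 0 < a → ∀ᶠ n : ℕ in atTop, ((C n).card : ℝ) ≤ Real.exp (a * n))
    (u : ℕ → ι → E → E → ℝ) (hu : ∀ n, ∀ j ∈ C n, Measurable (Function.uncurry (u n j)))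
    (hmem : ∀ n, ∀ j ∈ C n, ∀ y z, u n j y z ∈ Set.Icc (0 : ℝ) 1) :
    ∀ᵐ ω ∂μ, ∀ ε : ℝ, 0 < ε → ∀ᶠ n : ℕ in atTop, ∀ j ∈ C n,
      |crossMean (n / 2) (fun i => x i ω) (u n j) - ∫ z, u n j z.1 z.2 ∂(P.prod P)| ≤ ε := by
  have key : ∀ k : ℕ, ∀ᵐ ω ∂μ, ∀ᶠ n : ℕ in atTop, ∀ j ∈ C n,
      ω ∉ {ω | 1 / ((k : ℝ) + 1) < |crossMean (n / 2) (fun i => x i ω) (u n j)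
        - ∫ z, u n j z.1 z.2 ∂(P.prod P)|} := by
    intro k
    set ε : ℝ := 1 / ((k : ℝ) + 1) with hε
    have hε0 : 0 < ε := by positivity
    -- Hoeffding's exponent 2mε² is at least (ε²/2)n because n ≤ 4m.
    refine ae_eventually_forall_notMem C hC _ (c := ε ^ 2 / 2) (by positivity) ?_
    filter_upwards [eventually_ge_atTop 2] with n hn j hj
    obtain ⟨m, hm⟩ : ∃ m, m = n / 2 := ⟨_, rfl⟩
    rw [← hm]
    have hm1 : 1 ≤ m := by omega
    have hmn : (n : ℝ) ≤ 4 * m := by exact_mod_cast (by omega : n ≤ 4 * m)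
    have hnm : (m : ℝ) ≤ n := by exact_mod_cast (by omega : m ≤ n)
    have : NeZero m := ⟨by omega⟩
    have hm0 : (0 : ℝ) < m := by exact_mod_cast hm1
    set e := ∫ z, u n j z.1 z.2 ∂(P.prod P) with he
    -- If the average over the shifts deviates by more than ε, then so does one of the shifts; the
    -- union bound costs a factor m ≤ n.
    have hsub : {ω | ε < |crossMean m (fun i => x i ω) (u n j) - e|} ⊆
        ⋃ k : Fin m, {ω | ε < |(1 / (m : ℝ)) *
          ∑ i : Fin m, u n j (x i ω) (x (m + (i + k : Fin m)) ω) - e|} := by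
      intro ω (hω : ε < |crossMean m (fun i => x i ω) (u n j) - e|)
      by_contra hcon
      rw [Set.mem_iUnion, not_exists] at hcon
      have hcon' : ∀ k : Fin m, |(1 / (m : ℝ)) *
          ∑ i : Fin m, u n j (x i ω) (x (m + (i + k : Fin m)) ω) - e| ≤ ε := fun k =>
        not_lt.1 (hcon k)
      refine absurd hω (not_lt.2 ?_)
      rw [crossMean_eq_average_shifts]
      have h1 : (1 / (m : ℝ)) * ∑ k : Fin m, (1 / (m : ℝ)) *
            ∑ i : Fin m, u n j (x i ω) (x (m + (i + k : Fin m)) ω) - e =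
          (1 / (m : ℝ)) * ∑ k : Fin m, ((1 / (m : ℝ)) *
            ∑ i : Fin m, u n j (x i ω) (x (m + (i + k : Fin m)) ω) - e) := by
        rw [Finset.sum_sub_distrib, mul_sub]
        simp [hm0.ne']
      rw [h1, abs_mul, abs_of_pos (by positivity)]
      calc (1 / (m : ℝ)) * |_| ≤ (1 / (m : ℝ)) * ∑ k : Fin m, ε := by
            gcongr
            exact (Finset.abs_sum_le_sum_abs _ _).trans (Finset.sum_le_sum fun k _ => hcon' k)
        _ = ε := by simp [hm0.ne']
    calc μ {ω | ε < |crossMean m (fun i => x i ω) (u n j) - e|}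
        ≤ ∑ k : Fin m, μ {ω | ε < |(1 / (m : ℝ)) *
          ∑ i : Fin m, u n j (x i ω) (x (m + (i + k : Fin m)) ω) - e|} :=
          (measure_mono hsub).trans (measure_iUnion_fintype_le _ _)
      _ ≤ ∑ k : Fin m, ENNReal.ofReal (2 * Real.exp (-(2 * m * ε ^ 2))) :=
          Finset.sum_le_sum fun k _ => measure_shift_average_gt_le hx_meas hx_indep hx_law
            (hu n j hj) (hmem n j hj) (fun i => i + k) (add_left_injective k) hε0.le
      _ = ENNReal.ofReal (m * (2 * Real.exp (-(2 * m * ε ^ 2)))) := by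
          rw [Finset.sum_const, nsmul_eq_mul, ENNReal.ofReal_mul (by positivity)]
          simp
      _ ≤ ENNReal.ofReal (2 * n * Real.exp (-(ε ^ 2 / 2 * n))) := by
          refine ENNReal.ofReal_le_ofReal ?_
          have h2 : -(2 * m * ε ^ 2) ≤ -(ε ^ 2 / 2 * n) := by nlinarith [sq_nonneg ε]
          calc (m : ℝ) * (2 * Real.exp (-(2 * m * ε ^ 2)))
              ≤ n * (2 * Real.exp (-(ε ^ 2 / 2 * n))) := by gcongr
            _ = _ := by ring
  filter_upwards [ae_all_iff.2 key] with ω hω ε hε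
  obtain ⟨k, hk⟩ := exists_nat_one_div_lt hε
  filter_upwards [hω k] with n hn j hj
  have h1 : ¬ (1 / ((k : ℝ) + 1) < |crossMean (n / 2) (fun i => x i ω) (u n j)
    - ∫ z, u n j z.1 z.2 ∂(P.prod P)|) := hn j hj
  exact (not_lt.1 h1).trans hk.le

end Concentration

/-! ### Average nearest-neighbour distances -/

section NearestNeighbours

variable {d n : ℕ} (s : Fin n → Pt d) (x : Pt d)

/-- The number of sample points other than `x` within distance `t` of `x`. -/
noncomputable def countWithin (t : ℝ) : ℕ :=
  open Classical in (Finset.univ.filter (fun i => s i ≠ x ∧ dist x (s i) ≤ t)).card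

theorem countP_sortedDists (t : ℝ) :
    (sortedDists s x).countP (fun r => decide (r ≤ t)) = countWithin s x t := by
  classical
  rw [← Multiset.coe_countP, sortedDists, Multiset.sort_eq, Multiset.countP_map, countWithin]
  rw [← Finset.filter_val, Finset.card_val, Finset.filter_filter]

theorem pairwise_sortedDists : (sortedDists s x).Pairwise (· ≤ ·) := by
  classical
  exact Multiset.pairwise_sort _ _

theorem nonneg_of_mem_sortedDists {r : ℝ} (hr : r ∈ sortedDists s x) : 0 ≤ r := by
  classical
  rw [sortedDists, Multiset.mem_sort, Multiset.mem_map] at hr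
  obtain ⟨i, -, rfl⟩ := hr
  exact dist_nonneg

theorem nnDist_nonneg (j : ℕ) : 0 ≤ nnDist s j x := by
  unfold nnDist
  rcases lt_or_ge (j - 1) (sortedDists s x).length with h | h
  · rw [List.getD_eq_getElem _ _ h]
    exact nonneg_of_mem_sortedDists s x (List.getElem_mem h)
  · rw [List.getD_eq_default _ _ h]

/-- In a sorted list the entry at position `k` is at most `t` iff more than `k` entries are. -/
theorem getElem_le_iff_lt_countP {l : List ℝ} (hl : l.Pairwise (· ≤ ·)) (t : ℝ) {k : ℕ}
    (hk : k < l.length) : l[k] ≤ t ↔ k < l.countP (fun r => decide (r ≤ t)) := by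
  induction l generalizing k with
  | nil => simp at hk
  | cons a l ih =>
    rw [List.pairwise_cons] at hl
    rw [List.countP_cons]
    rcases k with _ | k
    · simp only [List.getElem_cons_zero]
      by_cases ha : a ≤ t
      · simp [ha]
      · have h0 : l.countP (fun r => decide (r ≤ t)) = 0 := by
          rw [List.countP_eq_zero]
          intro r hr
          have := hl.1 r hr
          simp only [decide_eq_true_eq]; linarith [not_le.1 ha]
        simp [ha, h0]
    · have hk' : k < l.length := by simpa using hk
      simp only [List.getElem_cons_succ]
      rw [ih hl.2 hk']
      by_cases ha : a ≤ t
      · simp [ha]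
      · have h0 : l.countP (fun r => decide (r ≤ t)) = 0 := by
          rw [List.countP_eq_zero]
          intro r hr
          have := hl.1 r hr
          simp only [decide_eq_true_eq]; linarith [not_le.1 ha]
        simp [ha, h0]

/-- The hypothesis `hR` makes the list long enough for position j - 1 to be a genuine entry, so the
default value 0 is never read. -/
theorem nnDist_le_iff {j : ℕ} {R : ℝ} (hj : 1 ≤ j) (hR : j ≤ countWithin s x R) (t : ℝ) :
    nnDist s j x ≤ t ↔ j ≤ countWithin s x t := by
  have hlen : j - 1 < (sortedDists s x).length := by
    have := List.countP_le_length (p := fun r => decide (r ≤ R)) (l := sortedDists s x)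
    rw [countP_sortedDists] at this
    omega
  rw [nnDist, List.getD_eq_getElem _ _ hlen,
    getElem_le_iff_lt_countP (pairwise_sortedDists s x) t hlen, countP_sortedDists]
  omega

/-- The number of the first `K` nearest-neighbour distances that exceed `t`. -/
theorem sum_lt_nnDist {K : ℕ} {R : ℝ} (hR : K ≤ countWithin s x R) (t : ℝ) :
    ∑ j ∈ Finset.Icc 1 K, (Set.Iio (nnDist s j x)).indicator (1 : ℝ → ℝ) t =
      (K : ℝ) - min (K : ℝ) (countWithin s x t) := by
  have h1 : ∀ j ∈ Finset.Icc 1 K, (Set.Iio (nnDist s j x)).indicator (1 : ℝ → ℝ) t =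
      1 - if j ≤ countWithin s x t then 1 else 0 := by
    intro j hj
    rw [Finset.mem_Icc] at hj
    have := nnDist_le_iff s x hj.1 (hj.2.trans hR) t
    by_cases h : j ≤ countWithin s x t
    · have h2 : t ∉ Set.Iio (nnDist s j x) := not_lt.2 (this.2 h)
      simp [h, h2]
    · have h2 : t ∈ Set.Iio (nnDist s j x) := not_le.1 (mt this.1 h)
      simp [h, h2]
  rw [Finset.sum_congr rfl h1, Finset.sum_sub_distrib, Finset.sum_ite]
  have h2 : (Finset.Icc 1 K).filter (fun j => j ≤ countWithin s x t) =
      Finset.Icc 1 (min K (countWithin s x t)) := by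
    ext j; simp only [Finset.mem_filter, Finset.mem_Icc]; omega
  rw [h2]
  simp

/-- Layer-cake formula: each distance is the integral of the indicator of t < D_(j), and K - min(K,
count) of these indicators equal 1 at t. Comparing values of G thus becomes comparing counts. -/
theorem sum_nnDist_eq_integral {K : ℕ} {R : ℝ} (hR : K ≤ countWithin s x R) :
    ∑ j ∈ Finset.Icc 1 K, nnDist s j x =
      ∫ t in Set.Ioc 0 R, ((K : ℝ) - min (K : ℝ) (countWithin s x t)) := by
  simp_rw [← sum_lt_nnDist s x hR]
  rw [integral_finsetSum]
  · refine Finset.sum_congr rfl fun j hj => ?_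
    rw [Finset.mem_Icc] at hj
    have hjR : nnDist s j x ≤ R := (nnDist_le_iff s x hj.1 (hj.2.trans hR) R).2 (hj.2.trans hR)
    rw [integral_indicator_one measurableSet_Iio, measureReal_restrict_apply measurableSet_Iio]
    have : Set.Iio (nnDist s j x) ∩ Set.Ioc 0 R = Set.Ioo 0 (nnDist s j x) := by
      ext t
      simp only [Set.mem_inter_iff, Set.mem_Iio, Set.mem_Ioc, Set.mem_Ioo]
      constructor
      · rintro ⟨h1, h2, h3⟩; exact ⟨h2, h1⟩
      · rintro ⟨h1, h2⟩; exact ⟨h2, h1, by linarith⟩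
    rw [this, Real.volume_real_Ioo_of_le (nnDist_nonneg s x j), sub_zero]
  · intro j _
    exact (integrable_const (1 : ℝ)).indicator measurableSet_Iio

theorem integrableOn_sub_min_countWithin {K : ℕ} {R : ℝ} (hR : K ≤ countWithin s x R) :
    IntegrableOn (fun t => (K : ℝ) - min (K : ℝ) (countWithin s x t)) (Set.Ioc 0 R) := by
  simp_rw [← sum_lt_nnDist s x hR]
  exact integrable_finsetSum _ fun j _ =>
    (integrable_const (1 : ℝ)).indicator measurableSet_Iio

/-- Comparison of average nearest-neighbour distances from a comparison of the counts. -/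
theorem avgNNDist_lt_of_countWithin (y : Pt d) {K : ℕ} (hK : 0 < K) {R r e γ : ℝ}
    (hr : 0 ≤ r) (hrR : r ≤ R) (he : 0 ≤ e)
    (hxR : K ≤ countWithin s x R) (hyR : K ≤ countWithin s y R)
    (hle : ∀ t, 0 ≤ t → t ≤ R → (countWithin s x t : ℝ) ≤ countWithin s y t + e)
    (hgap : ∀ t, r / 2 ≤ t → t ≤ r → (countWithin s x t : ℝ) + γ ≤ countWithin s y t ∧
      (countWithin s x t : ℝ) + γ ≤ K)
    (hfin : e * R < γ * (r / 2)) :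
    avgNNDist K s y < avgNNDist K s x := by
  have hR0 : 0 ≤ R := hr.trans hrR
  unfold avgNNDist
  refine mul_lt_mul_of_pos_left ?_ (by positivity)
  rw [← sub_pos, sum_nnDist_eq_integral s x hxR, sum_nnDist_eq_integral s y hyR, ← integral_sub
    (integrableOn_sub_min_countWithin s x hxR) (integrableOn_sub_min_countWithin s y hyR)]
  -- The difference of the two integrands is at least -e throughout and at least γ on (r/2, r].
  have hlow : ∫ t in Set.Ioc 0 R, (-e + (Set.Ioc (r / 2) r).indicator (fun _ => γ) t) =
      γ * (r / 2) - e * R := by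
    rw [integral_add (integrable_const _) ((integrable_const γ).indicator measurableSet_Ioc),
      setIntegral_const, integral_indicator_const _ measurableSet_Ioc,
      measureReal_restrict_apply measurableSet_Ioc]
    have : Set.Ioc (r / 2) r ∩ Set.Ioc 0 R = Set.Ioc (r / 2) r := by
      refine Set.inter_eq_left.2 fun t ht => ⟨?_, ht.2.trans hrR⟩
      linarith [ht.1]
    rw [this, Real.volume_real_Ioc_of_le hR0, Real.volume_real_Ioc_of_le (by linarith)]
    simp only [smul_eq_mul]
    ring
  have hmono : ∫ t in Set.Ioc 0 R, (-e + (Set.Ioc (r / 2) r).indicator (fun _ => γ) t) ≤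
      ∫ t in Set.Ioc 0 R, ((K : ℝ) - min (K : ℝ) (countWithin s x t) -
        ((K : ℝ) - min (K : ℝ) (countWithin s y t))) := by
    refine setIntegral_mono_on ?_ ?_ measurableSet_Ioc ?_
    · exact (integrable_const _).add ((integrable_const γ).indicator measurableSet_Ioc)
    · exact (integrableOn_sub_min_countWithin s x hxR).sub
        (integrableOn_sub_min_countWithin s y hyR)
    · intro t ht
      have h1 := hle t ht.1.le ht.2
      by_cases htr : t ∈ Set.Ioc (r / 2) r
      · obtain ⟨h2, h3⟩ := hgap t htr.1.le htr.2
        rw [Set.indicator_of_mem htr]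
        have h4 := min_le_right (K : ℝ) (countWithin s x t)
        have h5 := le_min h3 h2
        linarith
      · rw [Set.indicator_of_notMem htr]
        have h2 : min (K : ℝ) (countWithin s x t) ≤ min (K : ℝ) (countWithin s y t) + e := by
          rw [← min_add_add_right]
          exact min_le_min (by linarith) h1
        linarith
  linarith

end NearestNeighbours

/-! ### From local sample counts to the order of the average distances -/

section LocalCount

variable {E : Type*} {n : ℕ}

theorem empMean_mono {s : Fin n → E} {u v : E → ℝ} (h : ∀ i, u (s i) ≤ v (s i)) :
    empMean s u ≤ empMean s v :=
  mul_le_mul_of_nonneg_left (Finset.sum_le_sum fun i _ => h i) (by positivity)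

theorem empMean_congr {s : Fin n → E} {u v : E → ℝ} (h : ∀ i, u (s i) = v (s i)) :
    empMean s u = empMean s v := by
  unfold empMean; simp_rw [h]

theorem empMean_nonneg {s : Fin n → E} {u : E → ℝ} (h : ∀ i, 0 ≤ u (s i)) :
    0 ≤ empMean s u :=
  mul_nonneg (by positivity) (Finset.sum_nonneg fun i _ => h i)

theorem empMean_sum {ι : Type*} (s : Fin n → E) (T : Finset ι) (u : ι → E → ℝ) :
    empMean s (fun z => ∑ c ∈ T, u c z) = ∑ c ∈ T, empMean s (u c) := by
  unfold empMean
  rw [Finset.sum_comm, Finset.mul_sum]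

theorem empMean_indicator (s : Fin n → E) (A : Set E) :
    open Classical in
    empMean s (A.indicator 1) =
      (1 / (n : ℝ)) * ((Finset.univ.filter (fun i => s i ∈ A)).card : ℝ) := by
  classical
  unfold empMean
  simp [Set.indicator_apply]

variable {d : ℕ}

/-- The volume of the unit ball. -/
noncomputable def unitVol (d : ℕ) : ℝ := volume.real (Metric.ball (0 : Pt d) 1)

theorem unitVol_pos (d : ℕ) : 0 < unitVol d := by
  unfold unitVol
  exact ENNReal.toReal_pos (Metric.measure_ball_pos volume _ one_pos).ne' measure_ball_lt_top.ne

theorem volume_real_closedBall (x : Pt d) {r : ℝ} (hr : 0 ≤ r) :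
    volume.real (Metric.closedBall x r) = r ^ d * unitVol d := by
  rw [unitVol, Measure.addHaar_real_closedBall volume x hr, finrank_euclideanSpace_fin]

/-- The sample fractions of the balls about `x` of radius at most `R ρ` agree, up to `ε ρ^d`, with
the volumes of the balls weighted by the density at `x`. -/
def HasLocalCount (f₀ : Pt d → ℝ) (R ε ρ : ℝ) (s : Fin n → Pt d) (x : Pt d) : Prop :=
  ∀ t, 0 ≤ t → t ≤ R * ρ →
    |empMean s ((Metric.closedBall x t).indicator 1) - f₀ x * unitVol d * t ^ d| ≤ ε * ρ ^ d

theorem countWithin_le (s : Fin n → Pt d) (hn : 0 < n) (x : Pt d) (t : ℝ) :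
    (countWithin s x t : ℝ) ≤ n * empMean s ((Metric.closedBall x t).indicator 1) := by
  classical
  rw [empMean_indicator, ← mul_assoc, mul_one_div_cancel (by positivity), one_mul]
  have : countWithin s x t ≤
      (Finset.univ.filter (fun i => s i ∈ Metric.closedBall x t)).card := by
    unfold countWithin
    refine Finset.card_le_card fun i hi => ?_
    simp only [Finset.mem_filter, Finset.mem_univ, true_and] at hi ⊢
    rw [Metric.mem_closedBall, dist_comm]; exact hi.2
  exact_mod_cast (by convert this)

/-- Sample points equal to `x` are left out of the count; they are exactly those in the ball of
radius 0. -/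
theorem le_countWithin (s : Fin n → Pt d) (hn : 0 < n) (x : Pt d) (t : ℝ) :
    n * empMean s ((Metric.closedBall x t).indicator 1) -
      n * empMean s ((Metric.closedBall x 0).indicator 1) ≤ (countWithin s x t : ℝ) := by
  classical
  rw [empMean_indicator, empMean_indicator, ← mul_assoc, ← mul_assoc,
    mul_one_div_cancel (by positivity), one_mul, one_mul, sub_le_iff_le_add]
  have : (Finset.univ.filter (fun i => s i ∈ Metric.closedBall x t)).card ≤ countWithin s x t +
      (Finset.univ.filter (fun i => s i ∈ Metric.closedBall x 0)).card := by
    unfold countWithin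
    refine le_trans (Finset.card_le_card fun i hi => ?_) (Finset.card_union_le _ _)
    simp only [Finset.mem_filter, Finset.mem_univ, true_and, Finset.mem_union,
      Metric.mem_closedBall, Metric.closedBall_zero, Set.mem_singleton_iff] at hi ⊢
    by_cases h : s i = x
    · exact Or.inr h
    · left; rw [dist_comm]; exact ⟨h, hi⟩
  exact_mod_cast (by convert this)

/-- Taking t = 0 in the local count shows that copies of `x` make up at most ερ^d of the sample,
since 0^d = 0 for d > 0. Removing them accounts for the second ε in the lower bound. -/
theorem HasLocalCount.abs_countWithin_sub_le {f₀ : Pt d → ℝ} {R ε ρ : ℝ} {s : Fin n → Pt d}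
    {x : Pt d} (h : HasLocalCount f₀ R ε ρ s x) (hd : 0 < d) (hn : 0 < n) (hR : 0 ≤ R)
    (hρ : 0 ≤ ρ) {t : ℝ} (ht : 0 ≤ t) (htR : t ≤ R * ρ) :
    (countWithin s x t : ℝ) ≤ n * (f₀ x * unitVol d * t ^ d) + ε * (n * ρ ^ d) ∧
      n * (f₀ x * unitVol d * t ^ d) - 2 * ε * (n * ρ ^ d) ≤ countWithin s x t := by
  have h0 := (abs_le.1 (h 0 le_rfl (by positivity))).2
  have h1 := abs_le.1 (h t ht htR)
  have h2 := countWithin_le s hn x t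
  have h3 := le_countWithin s hn x t
  rw [zero_pow hd.ne', mul_zero, sub_zero] at h0
  have hn0 : (0 : ℝ) < n := by exact_mod_cast hn
  have h4 := mul_le_mul_of_nonneg_left h0 hn0.le
  have h5 := mul_le_mul_of_nonneg_left h1.1 hn0.le
  have h6 := mul_le_mul_of_nonneg_left h1.2 hn0.le
  constructor <;> nlinarith

/-- If the sample has the right local counts at `x` and `y`, then the point of larger density has
the smaller average nearest-neighbour distance. -/
theorem exists_localCount_compare (hd : 0 < d) {δ fmin fmax : ℝ} (hδ : 0 < δ) (hfmin : 0 < fmin)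
    (hfmax : 0 < fmax) :
    ∃ R : ℝ, 0 < R ∧ ∃ ε : ℝ, 0 < ε ∧ ∀ (f₀ : Pt d → ℝ) (n K : ℕ) (ρ : ℝ) (s : Fin n → Pt d)
      (x y : Pt d), 0 < n → 0 < K → 0 < ρ → n * ρ ^ d = K → HasLocalCount f₀ R ε ρ s x →
      HasLocalCount f₀ R ε ρ s y → fmin ≤ f₀ x → f₀ x + δ ≤ f₀ y → f₀ y ≤ fmax →
      avgNNDist K s y < avgNNDist K s x := by
  set v := unitVol d with hv
  have hv0 : 0 < v := unitVol_pos d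
  -- A ball of radius Rρ is expected to hold at least 2K sample points, so it contains the K nearest
  -- neighbours despite the error 2εK.
  set R : ℝ := max 1 (2 / (fmin * v)) with hRdef
  have hR1 : 1 ≤ R := le_max_left _ _
  have hRd : 2 ≤ fmin * v * R ^ d := by
    have h1 : 2 / (fmin * v) ≤ R ^ d := (le_max_right _ _).trans (le_self_pow₀ hR1 hd.ne')
    rw [div_le_iff₀ (by positivity)] at h1
    linarith
  -- Up to radius rρ at most about K/2 points are expected, so the truncation of the counts at K
  -- does not hide the gap between them.
  set r : ℝ := min 1 (1 / (2 * (fmax * v))) with hrdef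
  have hr0 : 0 < r := lt_min one_pos (by positivity)
  have hr1 : r ≤ 1 := min_le_left _ _
  have hrd : fmax * v * r ^ d ≤ 1 / 2 := by
    have h1 : r ^ d ≤ 1 / (2 * (fmax * v)) :=
      (pow_le_of_le_one hr0.le hr1 hd.ne').trans (min_le_right _ _)
    calc fmax * v * r ^ d ≤ fmax * v * (1 / (2 * (fmax * v))) := by gcongr
      _ = 1 / 2 := by field_simp
  -- In units of K, the least gap between the expected counts over radii in [rρ/2, rρ]. The choice
  -- of ε makes this gain outweigh the error 3εK accumulated up to Rρ.
  set g : ℝ := δ * v * (r / 2) ^ d with hgdef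
  have hg0 : 0 < g := by positivity
  refine ⟨R, by linarith, min (1 / 2) (g * r / (24 * R)), by positivity, ?_⟩
  set ε : ℝ := min (1 / 2) (g * r / (24 * R)) with hεdef
  have hε0 : 0 < ε := by positivity
  have hε1 : ε ≤ 1 / 2 := min_le_left _ _
  have hε2 : 24 * R * ε ≤ g * r := by
    have : ε ≤ g * r / (24 * R) := min_le_right _ _
    rw [le_div_iff₀ (by positivity)] at this
    linarith
  intro f₀ n K ρ s x y hn hK hρ hnρ hx hy hfx hxy hfy
  have hK0 : (0 : ℝ) < K := by exact_mod_cast hK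
  have hbx := fun t ht htR => hx.abs_countWithin_sub_le hd hn (by linarith) hρ.le (t := t) ht htR
  have hby := fun t ht htR => hy.abs_countWithin_sub_le hd hn (by linarith) hρ.le (t := t) ht htR
  simp only [hnρ, ← hv] at hbx hby
  have hscale : ∀ (a τ : ℝ), n * (a * v * (τ * ρ) ^ d) = a * v * τ ^ d * K := by
    intro a τ; rw [← hnρ]; ring
  have hfy0 : fmin ≤ f₀ y := by linarith
  have hcount : ∀ z, fmin ≤ f₀ z →
      n * (f₀ z * v * (R * ρ) ^ d) - 2 * ε * K ≤ countWithin s z (R * ρ) →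
      K ≤ countWithin s z (R * ρ) := by
    intro z hz h
    rw [hscale] at h
    have h1 : 2 ≤ f₀ z * v * R ^ d := hRd.trans (by gcongr)
    have h2 : (K : ℝ) ≤ countWithin s z (R * ρ) := by nlinarith
    exact_mod_cast h2
  refine avgNNDist_lt_of_countWithin s x y hK (R := R * ρ) (r := r * ρ) (e := 3 * ε * K)
    (γ := (g - 3 * ε) * K) (by positivity) (by gcongr; linarith) (by positivity)
    (hcount x hfx (hbx _ (by positivity) le_rfl).2)
    (hcount y hfy0 (hby _ (by positivity) le_rfl).2) ?_ ?_ ?_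
  · intro t ht htR
    have h1 := (hbx t ht htR).1
    have h2 := (hby t ht htR).2
    have h3 : n * (f₀ x * v * t ^ d) ≤ n * (f₀ y * v * t ^ d) := by gcongr; linarith
    linarith
  · intro t ht1 ht2
    have ht0 : 0 ≤ t := le_trans (by positivity) ht1
    have htR : t ≤ R * ρ := ht2.trans (by gcongr; linarith)
    have h1 := (hbx t ht0 htR).1
    have h2 := (hby t ht0 htR).2
    have h3 : g * K ≤ n * (δ * v * t ^ d) := by
      have h4 := hscale δ (r / 2)
      rw [hgdef, ← h4]
      gcongr
      linarith
    have h4 : n * (f₀ x * v * t ^ d) + n * (δ * v * t ^ d) ≤ n * (f₀ y * v * t ^ d) := by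
      rw [← mul_add, ← add_mul, ← add_mul]
      gcongr
    have h5 : n * (f₀ y * v * t ^ d) ≤ 1 / 2 * K := by
      have h6 := hscale fmax r
      calc n * (f₀ y * v * t ^ d) ≤ n * (fmax * v * (r * ρ) ^ d) := by gcongr
        _ = fmax * v * r ^ d * K := h6
        _ ≤ 1 / 2 * K := by gcongr
    constructor
    · nlinarith
    · nlinarith
  · have h1 : 3 * ε * R < (g - 3 * ε) * (r / 2) := by nlinarith
    calc 3 * ε * K * (R * ρ) = (3 * ε * R) * (K * ρ) := by ring
      _ < ((g - 3 * ε) * (r / 2)) * (K * ρ) := by gcongr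
      _ = _ := by ring

end LocalCount

/-! ### Histograms -/

section Histogram

variable {d n : ℕ}

/-- The index of the cube of side `h` that contains `z`. -/
noncomputable def cell (h : ℝ) (z : Pt d) : Fin d → ℤ := fun k => ⌊z k / h⌋

/-- The indicator function of a finite union of cubes of side `h`. -/
noncomputable def cellsInd (h : ℝ) (T : Finset (Fin d → ℤ)) (z : Pt d) : ℝ :=
  if cell h z ∈ T then 1 else 0

theorem measurable_cell (h : ℝ) : Measurable (cell h : Pt d → Fin d → ℤ) := by
  refine measurable_pi_iff.2 fun k => Int.measurable_floor.comp ?_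
  fun_prop

theorem measurable_cellsInd (h : ℝ) (T : Finset (Fin d → ℤ)) :
    Measurable (cellsInd h T : Pt d → ℝ) :=
  Measurable.ite (measurable_cell h T.measurableSet) measurable_const measurable_const

theorem cellsInd_mem (h : ℝ) (T : Finset (Fin d → ℤ)) (z : Pt d) :
    cellsInd h T z ∈ Set.Icc (0 : ℝ) 1 := by
  unfold cellsInd; split_ifs <;> simp

theorem integrable_of_mem_unitInterval {E : Type*} [MeasurableSpace E] {P : Measure E}
    [IsFiniteMeasure P] {u : E → ℝ} (hu : Measurable u) (h : ∀ z, u z ∈ Set.Icc (0 : ℝ) 1) :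
    Integrable u P :=
  Integrable.of_mem_Icc 0 1 hu.aemeasurable (Eventually.of_forall h)

theorem cellsInd_eq_sum (h : ℝ) (T : Finset (Fin d → ℤ)) :
    (cellsInd h T : Pt d → ℝ) = fun z => ∑ c ∈ T, cellsInd h {c} z := by
  ext z
  simp [cellsInd]

/-- The discrepancy between the sample average and the mean of a union of cubes. -/
noncomputable def discrepancy (P : Measure (Pt d)) (h : ℝ) (s : Fin n → Pt d)
    (T : Finset (Fin d → ℤ)) : ℝ :=
  empMean s (cellsInd h T) - ∫ z, cellsInd h T z ∂P

variable {P : Measure (Pt d)} [IsProbabilityMeasure P] {h : ℝ} {s : Fin n → Pt d}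

theorem discrepancy_eq_sum (T : Finset (Fin d → ℤ)) :
    discrepancy P h s T = ∑ c ∈ T, discrepancy P h s {c} := by
  unfold discrepancy
  rw [Finset.sum_sub_distrib, cellsInd_eq_sum h T, empMean_sum, integral_finsetSum]
  exact fun c _ => integrable_of_mem_unitInterval (measurable_cellsInd _ _) (cellsInd_mem _ _)

/-- The cubes of nonnegative and of negative discrepancy form two unions, each of discrepancy at
most Δ. This is why all unions, and not only single cubes, are controlled. -/
theorem sum_abs_discrepancy_le {Δ : ℝ} (hΔ : ∀ T, |discrepancy P h s T| ≤ Δ)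
    (T : Finset (Fin d → ℤ)) : ∑ c ∈ T, |discrepancy P h s {c}| ≤ 2 * Δ := by
  rw [← Finset.sum_filter_add_sum_filter_not T (fun c => 0 ≤ discrepancy P h s {c}), two_mul]
  refine add_le_add ?_ ?_
  · rw [Finset.sum_congr rfl fun c hc => abs_of_nonneg (Finset.mem_filter.1 hc).2,
      ← discrepancy_eq_sum]
    exact (le_abs_self _).trans (hΔ _)
  · rw [Finset.sum_congr rfl fun c hc => abs_of_neg (not_le.1 (Finset.mem_filter.1 hc).2),
      Finset.sum_neg_distrib, ← discrepancy_eq_sum]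
    exact (neg_le_abs _).trans (hΔ _)

theorem dist_le_of_cell_eq (hh : 0 < h) {z w : Pt d} (hzw : cell h z = cell h w) :
    dist z w ≤ d * h := by
  have hk : ∀ k, |z k - w k| ≤ h := by
    intro k
    have h1 := Int.abs_sub_lt_one_of_floor_eq_floor (congrFun hzw k)
    rw [← sub_div, abs_div, abs_of_pos hh, div_lt_one hh] at h1
    exact h1.le
  rw [EuclideanSpace.dist_eq]
  refine Real.sqrt_le_iff.2 ⟨by positivity, ?_⟩
  calc ∑ k, dist (z k) (w k) ^ 2 ≤ ∑ _k : Fin d, h ^ 2 := by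
        refine Finset.sum_le_sum fun k _ => ?_
        rw [Real.dist_eq]
        exact pow_le_pow_left₀ (abs_nonneg _) (hk k) 2
    _ = d * h ^ 2 := by simp
    _ ≤ (d * h) ^ 2 := by
        rw [mul_pow]
        gcongr
        exact_mod_cast Nat.le_self_pow two_ne_zero d

/-- The offsets between the indices of cubes with at most `L - 1` cubes between them. -/
noncomputable def offsets (d L : ℕ) : Finset (Fin d → ℤ) :=
  Fintype.piFinset fun _ => Finset.Icc (-(L : ℤ)) L

theorem cell_sub_cell_mem_offsets (hh : 0 < h) {z x : Pt d} {L : ℕ} (hzx : dist z x ≤ L * h) :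
    cell h z - cell h x ∈ offsets d L := by
  rw [offsets, Fintype.mem_piFinset]
  intro k
  have h1 : |z k - x k| ≤ L * h := by
    refine le_trans ?_ hzx
    rw [dist_eq_norm]
    exact PiLp.norm_apply_le (z - x) k
  rw [abs_le] at h1
  have h2 : z k / h ≤ x k / h + L := by
    rw [div_add' _ _ _ hh.ne']; gcongr; linarith
  have h3 : x k / h ≤ z k / h + L := by
    rw [div_add' _ _ _ hh.ne']; gcongr; linarith
  have h4 : ⌊z k / h⌋ ≤ ⌊x k / h⌋ + L := by
    have := Int.floor_le_floor h2; rwa [Int.floor_add_natCast] at this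
  have h5 : ⌊x k / h⌋ ≤ ⌊z k / h⌋ + L := by
    have := Int.floor_le_floor h3; rwa [Int.floor_add_natCast] at this
  simp only [Pi.sub_apply, cell, Finset.mem_Icc]
  constructor <;> linarith

/-- The cubes near `x` that meet the ball of radius `r` about `x`. -/
noncomputable def meetingCells (h : ℝ) (L : ℕ) (x : Pt d) (r : ℝ) : Finset (Fin d → ℤ) :=
  open Classical in
  ((offsets d L).image fun v => cell h x + v).filter fun c => ∃ z, cell h z = c ∧ dist z x ≤ r

theorem indicator_closedBall_le_cellsInd (hh : 0 < h) {x : Pt d} {L : ℕ} {r : ℝ}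
    (hr : r ≤ L * h) (z : Pt d) :
    (Metric.closedBall x r).indicator 1 z ≤ cellsInd h (meetingCells h L x r) z := by
  classical
  by_cases hz : z ∈ Metric.closedBall x r
  · have hzr : dist z x ≤ r := hz
    have hmem : cell h z ∈ meetingCells h L x r := by
      rw [meetingCells, Finset.mem_filter]
      refine ⟨Finset.mem_image.2 ⟨_, cell_sub_cell_mem_offsets hh (hzr.trans hr), ?_⟩, z, rfl, hzr⟩
      simp
    simp [hz, cellsInd, hmem]
  · rw [Set.indicator_of_notMem hz]
    exact (cellsInd_mem _ _ _).1

theorem cellsInd_le_indicator_closedBall (hh : 0 < h) {x : Pt d} {L : ℕ} {r : ℝ} (z : Pt d) :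
    cellsInd h (meetingCells h L x r) z ≤ (Metric.closedBall x (r + d * h)).indicator 1 z := by
  classical
  unfold cellsInd
  split_ifs with hz
  · rw [meetingCells, Finset.mem_filter] at hz
    obtain ⟨-, w, hw, hwx⟩ := hz
    have : z ∈ Metric.closedBall x (r + d * h) := by
      rw [Metric.mem_closedBall]
      have := dist_triangle z w x
      have := dist_le_of_cell_eq hh hw.symm
      linarith
    simp [this]
  · exact Set.indicator_nonneg (fun _ _ => zero_le_one) _

theorem abs_discrepancy_meetingCells_le {D : Finset (Fin d → ℤ)} {a : ℝ} (ha : 0 ≤ a)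
    (hD : ∀ c, c ∉ D → |discrepancy P h s {c}| ≤ a) {x : Pt d} {L : ℕ}
    (hx : ∀ v ∈ offsets d L, cell h x + v ∉ D) (r : ℝ) :
    |discrepancy P h s (meetingCells h L x r)| ≤ (offsets d L).card * a := by
  classical
  rw [discrepancy_eq_sum]
  refine (Finset.abs_sum_le_sum_abs _ _).trans ?_
  calc ∑ c ∈ meetingCells h L x r, |discrepancy P h s {c}|
      ≤ ∑ c ∈ meetingCells h L x r, a := by
        refine Finset.sum_le_sum fun c hc => hD c ?_
        rw [meetingCells, Finset.mem_filter, Finset.mem_image] at hc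
        obtain ⟨⟨v, hv, rfl⟩, -⟩ := hc
        exact hx v hv
    _ = (meetingCells h L x r).card * a := by rw [Finset.sum_const, nsmul_eq_mul]
    _ ≤ _ := by
        refine mul_le_mul_of_nonneg_right (Nat.cast_le.2 ?_) ha
        unfold meetingCells
        exact (Finset.card_le_card (Finset.filter_subset _ _)).trans
          (Finset.card_image_le (s := offsets d L))

/-- The cubes that meet the ball cover it and lie in the ball enlarged by d h, a bound for their
diameter. -/
theorem empMean_closedBall_le {D : Finset (Fin d → ℤ)} {a : ℝ} (ha : 0 ≤ a) (hh : 0 < h)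
    (hD : ∀ c, c ∉ D → |discrepancy P h s {c}| ≤ a) {x : Pt d} {L : ℕ}
    (hx : ∀ v ∈ offsets d L, cell h x + v ∉ D) {r : ℝ} (hr : r ≤ L * h) :
    empMean s ((Metric.closedBall x r).indicator 1) ≤
      P.real (Metric.closedBall x (r + d * h)) + (offsets d L).card * a := by
  have h1 := (abs_le.1 (abs_discrepancy_meetingCells_le ha hD hx r)).2
  rw [discrepancy] at h1
  have h2 : empMean s ((Metric.closedBall x r).indicator 1) ≤
      empMean s (cellsInd h (meetingCells h L x r)) :=
    empMean_mono fun i => indicator_closedBall_le_cellsInd hh hr (s i)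
  have h3 : ∫ z, cellsInd h (meetingCells h L x r) z ∂P ≤
      ∫ z, (Metric.closedBall x (r + d * h)).indicator 1 z ∂P := by
    refine integral_mono (integrable_of_mem_unitInterval (measurable_cellsInd _ _)
      (cellsInd_mem _ _)) ?_ fun z => cellsInd_le_indicator_closedBall hh z
    exact (integrable_const (1 : ℝ)).indicator measurableSet_closedBall
  rw [integral_indicator_one measurableSet_closedBall] at h3
  linarith

theorem le_empMean_closedBall {D : Finset (Fin d → ℤ)} {a : ℝ} (ha : 0 ≤ a) (hh : 0 < h)
    (hD : ∀ c, c ∉ D → |discrepancy P h s {c}| ≤ a) {x : Pt d} {L : ℕ}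
    (hx : ∀ v ∈ offsets d L, cell h x + v ∉ D) {r : ℝ} (hr : r ≤ L * h) :
    P.real (Metric.closedBall x r) - (offsets d L).card * a ≤
      empMean s ((Metric.closedBall x (r + d * h)).indicator 1) := by
  have h1 := (abs_le.1 (abs_discrepancy_meetingCells_le ha hD hx r)).1
  rw [discrepancy] at h1
  have h2 : empMean s (cellsInd h (meetingCells h L x r)) ≤
      empMean s ((Metric.closedBall x (r + d * h)).indicator 1) :=
    empMean_mono fun i => cellsInd_le_indicator_closedBall hh (s i)
  have h3 : ∫ z, (Metric.closedBall x r).indicator 1 z ∂P ≤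
      ∫ z, cellsInd h (meetingCells h L x r) z ∂P := by
    refine integral_mono ((integrable_const (1 : ℝ)).indicator measurableSet_closedBall)
      (integrable_of_mem_unitInterval (measurable_cellsInd _ _) (cellsInd_mem _ _))
      fun z => indicator_closedBall_le_cellsInd hh hr z
  rw [integral_indicator_one measurableSet_closedBall] at h3
  linarith

/-- The fraction of the sample lying near a deviant cube. -/
theorem empMean_near_le {D : Finset (Fin d → ℤ)} {a Δ q : ℝ} (ha : 0 < a)
    (hΔ : ∀ T, |discrepancy P h s T| ≤ Δ) (hD : ∀ c ∈ D, a < |discrepancy P h s {c}|)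
    (hq : ∀ c : Fin d → ℤ, ∫ z, cellsInd h {c} z ∂P ≤ q) (hq0 : 0 ≤ q) (L : ℕ) :
    empMean s ({x : Pt d | ∃ v ∈ offsets d L, cell h x + v ∈ D}.indicator 1) ≤
      (offsets d L).card * ((2 * q / a + 1) * Δ) := by
  classical
  -- Markov's inequality for the sum of the absolute discrepancies.
  have hcard : (D.card : ℝ) * a ≤ 2 * Δ := by
    refine le_trans ?_ (sum_abs_discrepancy_le hΔ D)
    rw [← nsmul_eq_mul, ← Finset.sum_const]
    exact Finset.sum_le_sum fun c hc => (hD c hc).le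
  -- The translate of D by -v is again a union of cubes: its sample share is its mass, at most |D|
  -- q, plus a discrepancy of at most Δ.
  have hv : ∀ v, empMean s (cellsInd h (D.image fun c => c - v)) ≤ (2 * q / a + 1) * Δ := by
    intro v
    have h1 := (abs_le.1 (hΔ (D.image fun c => c - v))).2
    rw [discrepancy] at h1
    have h2 : ∫ z, cellsInd h (D.image fun c => c - v) z ∂P ≤ D.card * q := by
      rw [cellsInd_eq_sum, integral_finsetSum]
      · calc _ ≤ ∑ c ∈ D.image fun c => c - v, q := Finset.sum_le_sum fun c _ => hq c
          _ = (D.image fun c => c - v).card * q := by rw [Finset.sum_const, nsmul_eq_mul]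
          _ ≤ _ := mul_le_mul_of_nonneg_right (Nat.cast_le.2 Finset.card_image_le) hq0
      · exact fun c _ => integrable_of_mem_unitInterval (measurable_cellsInd _ _)
          (cellsInd_mem _ _)
    have h3 : (D.card : ℝ) * q ≤ 2 * q / a * Δ := by
      rw [div_mul_eq_mul_div, le_div_iff₀ ha]
      nlinarith
    linarith
  calc empMean s ({x : Pt d | ∃ v ∈ offsets d L, cell h x + v ∈ D}.indicator 1)
      ≤ empMean s (fun z => ∑ v ∈ offsets d L, cellsInd h (D.image fun c => c - v) z) := by
        refine empMean_mono fun i => ?_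
        by_cases hi : s i ∈ {x : Pt d | ∃ v ∈ offsets d L, cell h x + v ∈ D}
        · rw [Set.indicator_of_mem hi]
          obtain ⟨v, hv, hvD⟩ := hi
          have h1 : cellsInd h (D.image fun c => c - v) (s i) = 1 := by
            rw [cellsInd, if_pos]
            exact Finset.mem_image.2 ⟨_, hvD, by simp⟩
          rw [Pi.one_apply, ← h1]
          exact Finset.single_le_sum
            (f := fun v => cellsInd h (D.image fun c => c - v) (s i))
            (fun w _ => (cellsInd_mem h _ _).1) hv
        · rw [Set.indicator_of_notMem hi]
          exact Finset.sum_nonneg fun w _ => (cellsInd_mem h _ _).1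
    _ = ∑ v ∈ offsets d L, empMean s (cellsInd h (D.image fun c => c - v)) := empMean_sum _ _ _
    _ ≤ ∑ v ∈ offsets d L, (2 * q / a + 1) * Δ := Finset.sum_le_sum fun v _ => hv v
    _ = _ := by rw [Finset.sum_const, nsmul_eq_mul]

end Histogram

/-! ### Local counts of the nominal sample -/

section LocalCounts

variable {d : ℕ} {X : Set (Pt d)} {f₀ : Pt d → ℝ}

namespace IsNominalDensity

theorem integrable (hf : IsNominalDensity X f₀) : Integrable f₀ := by
  refine ⟨hf.measurable.aestronglyMeasurable, ?_⟩
  rw [hasFiniteIntegral_iff_ofReal (Eventually.of_forall hf.nonneg), hf.total_mass]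
  exact ENNReal.one_lt_top

theorem nominal_real_eq (hf : IsNominalDensity X f₀) (A : Set (Pt d)) :
    (nominal f₀).real A = ∫ z in A, f₀ z := by
  rw [measureReal_def, nominal_apply, integral_eq_lintegral_of_nonneg_ae
    (Eventually.of_forall hf.nonneg) hf.measurable.aestronglyMeasurable]

theorem nominal_real_le {C : ℝ} (hC : ∀ x, f₀ x ≤ C) (hC0 : 0 ≤ C)
    {A : Set (Pt d)} (hA : MeasurableSet A) (hfin : volume A ≠ ∞) :
    (nominal f₀).real A ≤ C * volume.real A := by
  rw [measureReal_def, measureReal_def, ← ENNReal.toReal_ofReal hC0, ← ENNReal.toReal_mul]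
  exact ENNReal.toReal_mono (ENNReal.mul_ne_top ENNReal.ofReal_ne_top hfin)
    (nominal_le A hA fun x _ => hC x)

end IsNominalDensity

/-- The integral of the oscillation of `f₀` over the ball of radius `r` about `x`. -/
noncomputable def oscIntegral (f₀ : Pt d → ℝ) (x : Pt d) (r : ℝ) : ℝ :=
  ∫ z in Metric.closedBall x r, |f₀ z - f₀ x|

theorem integrableOn_abs_sub (hf : IsNominalDensity X f₀) (x : Pt d) (r : ℝ) :
    IntegrableOn (fun z => |f₀ z - f₀ x|) (Metric.closedBall x r) :=
  (hf.integrable.integrableOn.sub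
    (integrableOn_const (by exact measure_closedBall_lt_top.ne))).abs

theorem oscIntegral_mono (hf : IsNominalDensity X f₀) (x : Pt d) {r r' : ℝ} (h : r ≤ r') :
    oscIntegral f₀ x r ≤ oscIntegral f₀ x r' :=
  setIntegral_mono_set (integrableOn_abs_sub hf x r')
    (Eventually.of_forall fun _ => abs_nonneg _)
    (Metric.closedBall_subset_closedBall h).eventuallyLE

theorem abs_nominal_closedBall_sub_le (hf : IsNominalDensity X f₀) (x : Pt d) {r : ℝ}
    (hr : 0 ≤ r) :
    |(nominal f₀).real (Metric.closedBall x r) - f₀ x * unitVol d * r ^ d| ≤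
      oscIntegral f₀ x r := by
  have h1 : f₀ x * unitVol d * r ^ d = ∫ _z in Metric.closedBall x r, f₀ x := by
    rw [setIntegral_const, volume_real_closedBall x hr, smul_eq_mul]; ring
  rw [hf.nominal_real_eq, h1, ← integral_sub hf.integrable.integrableOn
    (integrableOn_const (by exact measure_closedBall_lt_top.ne))]
  exact abs_integral_le_integral_abs

theorem measurable_oscIntegral (hf : IsNominalDensity X f₀) (r : ℝ) :
    Measurable fun x => oscIntegral f₀ x r := by
  have h1 : ∀ x, oscIntegral f₀ x r =
      ∫ z, {q : Pt d × Pt d | dist q.2 q.1 ≤ r}.indicator (fun q => |f₀ q.2 - f₀ q.1|) (x, z) := by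
    intro x
    rw [oscIntegral, ← integral_indicator measurableSet_closedBall]
    rfl
  simp_rw [h1]
  have h2 : MeasurableSet {q : Pt d × Pt d | dist q.2 q.1 ≤ r} :=
    (isClosed_le (by fun_prop) continuous_const).measurableSet
  have h3 : Measurable fun q : Pt d × Pt d => |f₀ q.2 - f₀ q.1| := by
    have := hf.measurable
    fun_prop
  exact ((h3.indicator h2).stronglyMeasurable.integral_prod_right').measurable

/-- By Lebesgue differentiation the mean oscillation over shrinking balls vanishes almost
everywhere, hence in P-measure. The jump of f₀ at the boundary of X is covered too, with no
regularity of X. -/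
theorem tendsto_nominal_oscIntegral_gt (hf : IsNominalDensity X f₀) {R : ℝ} (hR : 0 < R)
    {ρ : ℕ → ℝ} (hρ_pos : ∀ᶠ n in atTop, 0 < ρ n) (hρ : Tendsto ρ atTop (𝓝 0)) {b : ℝ}
    (hb : 0 < b) :
    Tendsto (fun n => (nominal f₀).real {x | b * ρ n ^ d < oscIntegral f₀ x (R * ρ n)})
      atTop (𝓝 0) := by
  have := hf.isProbabilityMeasure
  have hv := unitVol_pos d
  have hδ : Tendsto (fun n => R * ρ n) atTop (𝓝[>] 0) := by
    rw [tendsto_nhdsWithin_iff]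
    refine ⟨by simpa using hρ.const_mul R, ?_⟩
    filter_upwards [hρ_pos] with n hn
    exact mul_pos hR hn
  have hae : ∀ᵐ x ∂(volume : Measure (Pt d)),
      Tendsto (fun n => oscIntegral f₀ x (R * ρ n) / ρ n ^ d) atTop (𝓝 0) := by
    filter_upwards [IsUnifLocDoublingMeasure.ae_tendsto_average_norm_sub volume
      hf.integrable.locallyIntegrable 1] with x hx
    have h1 := hx (fun _ => x) (fun n => R * ρ n) hδ (by
      filter_upwards [hρ_pos] with n hn
      rw [one_mul]
      exact Metric.mem_closedBall_self (by positivity))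
    have h2 := h1.const_mul (R ^ d * unitVol d)
    rw [mul_zero] at h2
    refine h2.congr' ?_
    filter_upwards [hρ_pos] with n hn
    rw [setAverage_eq, volume_real_closedBall x (by positivity), smul_eq_mul, mul_pow, oscIntegral]
    simp only [Real.norm_eq_abs]
    field_simp
  have hac : nominal f₀ ≪ volume := withDensity_absolutelyContinuous _ _
  have hmeas := tendstoInMeasure_of_tendsto_ae (μ := nominal f₀)
    (fun n => ((measurable_oscIntegral hf (R * ρ n)).div_const (ρ n ^ d)).aestronglyMeasurable)
    (hac hae)
  rw [tendstoInMeasure_iff_measureReal_dist] at hmeas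
  refine squeeze_zero' (Eventually.of_forall fun n => measureReal_nonneg) ?_ (hmeas b hb)
  filter_upwards [hρ_pos] with n hn
  refine measureReal_mono fun x hx => ?_
  have hx' : b * ρ n ^ d < oscIntegral f₀ x (R * ρ n) := hx
  change b ≤ dist _ _
  rw [Real.dist_eq, sub_zero]
  refine le_trans ?_ (le_abs_self _)
  rw [le_div_iff₀ (by positivity)]
  exact hx'.le

theorem abs_pow_sub_pow_le_of_le {a b c : ℝ} (ha : 0 ≤ a) (hb : 0 ≤ b) (hac : a ≤ c)
    (hbc : b ≤ c) (m : ℕ) : |a ^ m - b ^ m| ≤ |a - b| * m * c ^ (m - 1) := by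
  refine (abs_pow_sub_pow_le a b m).trans ?_
  gcongr
  rw [abs_of_nonneg ha, abs_of_nonneg hb]
  exact max_le hac hbc

/-- Away from deviant cubes and from points where the density oscillates, the sample has the right
local counts. -/
theorem abs_empMean_closedBall_sub_le (hf : IsNominalDensity X f₀) (hd : 0 < d) {C : ℝ}
    (hC : ∀ x, f₀ x ≤ C) {n : ℕ} {s : Fin n → Pt d} {D : Finset (Fin d → ℤ)} {a b h r : ℝ}
    (ha : 0 ≤ a) (hh : 0 < h)
    (hD : ∀ c, c ∉ D → |discrepancy (nominal f₀) h s {c}| ≤ a) {x : Pt d} {L : ℕ}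
    (hx : ∀ v ∈ offsets d L, cell h x + v ∉ D) (hr : r ≤ L * h)
    (hb : oscIntegral f₀ x (r + d * h) ≤ b) {t : ℝ} (ht : 0 ≤ t) (htr : t ≤ r) :
    |empMean s ((Metric.closedBall x t).indicator 1) - f₀ x * unitVol d * t ^ d| ≤
      (offsets d L).card * a + b + C * unitVol d * (d * h * d * (r + d * h) ^ (d - 1)) := by
  have := hf.isProbabilityMeasure
  have hv := unitVol_pos d
  set v := unitVol d
  have hdh : 0 < d * h := by positivity
  have hc0 : 0 ≤ (r + d * h) ^ (d - 1) := pow_nonneg (by linarith) _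
  have hfx := hf.nonneg x
  have hscale : ∀ w, 0 ≤ w → f₀ x * v * w ≤ C * v * w := fun w hw => by
    gcongr
    exact hC x
  have hb0 : 0 ≤ b := (integral_nonneg fun _ => abs_nonneg _).trans hb
  rw [abs_le]
  constructor
  · rcases le_total (d * h) t with hdt | hdt
    · have h1 := le_empMean_closedBall (s := s) ha hh hD hx (r := t - d * h) (by linarith)
      rw [sub_add_cancel] at h1
      have h2 := (abs_le.1 (abs_nominal_closedBall_sub_le hf x
        (r := t - d * h) (by linarith))).1
      have h3 := oscIntegral_mono hf x (r := t - d * h) (r' := r + d * h) (by linarith)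
      have h4 := abs_pow_sub_pow_le_of_le (a := t) (b := t - d * h) (c := r + d * h) ht
        (by linarith) (by linarith) (by linarith) d
      rw [sub_sub_cancel, abs_of_pos hdh] at h4
      have h5 := hscale _ ((abs_nonneg _).trans h4)
      have h6 : f₀ x * v * (t ^ d - (t - d * h) ^ d) ≤
          f₀ x * v * (d * h * d * (r + d * h) ^ (d - 1)) := by
        gcongr
        exact (le_abs_self _).trans h4
      linarith
    -- For t ≤ d h the radius cannot be reduced by d h, but then the target f₀(x) v t^d is itself
    -- below the shell error.
    · have h1 : 0 ≤ empMean s ((Metric.closedBall x t).indicator 1) :=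
        empMean_nonneg fun i => Set.indicator_nonneg (fun _ _ => zero_le_one) _
      have h4 := abs_pow_sub_pow_le_of_le (a := t) (b := 0) (c := r + d * h) ht
        le_rfl (by linarith) (by linarith) d
      rw [zero_pow hd.ne', sub_zero, sub_zero, abs_of_nonneg ht] at h4
      have h5 : t ^ d ≤ d * h * d * (r + d * h) ^ (d - 1) := by
        refine (le_abs_self _).trans (h4.trans ?_)
        gcongr
      have h6 : f₀ x * v * t ^ d ≤ f₀ x * v * (d * h * d * (r + d * h) ^ (d - 1)) := by gcongr
      have h7 := hscale (d * h * d * (r + d * h) ^ (d - 1)) (by positivity)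
      have h8 : 0 ≤ ((offsets d L).card : ℝ) * a := by positivity
      linarith
  · have h1 := empMean_closedBall_le (s := s) ha hh hD hx (r := t) (by linarith)
    have h2 := (abs_le.1 (abs_nominal_closedBall_sub_le hf x (r := t + d * h) (by linarith))).2
    have h3 := oscIntegral_mono hf x (r := t + d * h) (r' := r + d * h) (by linarith)
    have h4 := abs_pow_sub_pow_le_of_le (a := t + d * h) (b := t) (c := r + d * h) (by linarith)
      ht (by linarith) (by linarith) d
    rw [add_sub_cancel_left, abs_of_pos hdh] at h4
    have h5 := hscale _ ((abs_nonneg _).trans h4)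
    have h6 : f₀ x * v * ((t + d * h) ^ d - t ^ d) ≤
        f₀ x * v * (d * h * d * (r + d * h) ^ (d - 1)) := by
      gcongr
      exact (le_abs_self _).trans h4
    linarith

theorem integral_cellsInd_singleton_le (hf : IsNominalDensity X f₀) {C : ℝ}
    (hC : ∀ x, f₀ x ≤ C) (hC0 : 0 ≤ C) {h : ℝ} (hh : 0 < h) (c : Fin d → ℤ) :
    ∫ z, cellsInd h {c} z ∂(nominal f₀) ≤ C * ((d * h) ^ d * unitVol d) := by
  have := hf.isProbabilityMeasure
  have hv := unitVol_pos d
  by_cases hc : ∃ z : Pt d, cell h z = c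
  · obtain ⟨w, hw⟩ := hc
    have h1 : ∫ z, cellsInd h {c} z ∂(nominal f₀) ≤
        ∫ z, (Metric.closedBall w (d * h)).indicator 1 z ∂(nominal f₀) := by
      refine integral_mono (integrable_of_mem_unitInterval (measurable_cellsInd _ _)
        (cellsInd_mem _ _)) ((integrable_const (1 : ℝ)).indicator measurableSet_closedBall)
        fun z => ?_
      unfold cellsInd
      split_ifs with hz
      · have : z ∈ Metric.closedBall w (d * h) :=
          dist_le_of_cell_eq hh ((Finset.mem_singleton.1 hz).trans hw.symm)
        simp [this]
      · exact Set.indicator_nonneg (fun _ _ => zero_le_one) _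
    rw [integral_indicator_one measurableSet_closedBall] at h1
    refine h1.trans ?_
    rw [← volume_real_closedBall w (by positivity)]
    exact IsNominalDensity.nominal_real_le hC hC0 measurableSet_closedBall measure_closedBall_lt_top.ne
  · have h0 : (cellsInd h {c} : Pt d → ℝ) = fun _ => 0 := by
      ext z
      rw [cellsInd, if_neg]
      exact fun hz => hc ⟨z, Finset.mem_singleton.1 hz⟩
    rw [h0, integral_zero]
    positivity

/-- The cubes of side `h` that meet the ball of radius `B` about the origin. -/
noncomputable def boxCells (d : ℕ) (B h : ℝ) : Finset (Fin d → ℤ) :=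
  offsets d ⌈B / h⌉₊

theorem cell_mem_boxCells {B h : ℝ} (hh : 0 < h) {x : Pt d} (hx : ‖x‖ ≤ B) :
    cell h x ∈ boxCells d B h := by
  have h0 : cell h (0 : Pt d) = 0 := by ext k; simp [cell]
  have h1 := cell_sub_cell_mem_offsets (z := x) (x := 0) (L := ⌈B / h⌉₊) hh (by
    rw [dist_zero_right]
    refine hx.trans ?_
    rw [← div_le_iff₀ hh]
    exact Nat.le_ceil _)
  rwa [h0, sub_zero] at h1

theorem card_offsets (d L : ℕ) : (offsets d L).card = (2 * L + 1) ^ d := by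
  rw [offsets, Fintype.card_piFinset]
  simp only [Int.card_Icc, Finset.prod_const, Finset.card_univ, Fintype.card_fin]
  congr 1
  omega

theorem card_boxCells_le {B h : ℝ} (hB : 0 ≤ B) (hh : 0 < h) (hh1 : h ≤ 1) :
    ((boxCells d B h).card : ℝ) ≤ (2 * B + 3) ^ d / h ^ d := by
  rw [boxCells, card_offsets, ← div_pow]
  push_cast
  gcongr
  have h1 := (Nat.ceil_lt_add_one (show 0 ≤ B / h by positivity)).le
  have h2 : 1 ≤ 1 / h := by rw [le_div_iff₀ hh]; linarith
  calc (2 * (⌈B / h⌉₊ : ℝ) + 1) ≤ 2 * (B / h + 1) + 1 := by gcongr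
    _ = 2 * (B / h) + 3 * 1 := by ring
    _ ≤ 2 * (B / h) + 3 * (1 / h) := by gcongr
    _ = _ := by ring

/-- The number of unions of cubes of side `θ ρ` within a bounded region is subexponential in `n`
when `n ρ^d → ∞`. -/
theorem card_powerset_boxCells_le {B θ : ℝ} (hB : 0 ≤ B) (hθ : 0 < θ) {ρ : ℕ → ℝ}
    (hρ_pos : ∀ᶠ n in atTop, 0 < ρ n) (hρ : Tendsto ρ atTop (𝓝 0))
    (hnρ : Tendsto (fun n : ℕ => n * ρ n ^ d) atTop atTop) (a : ℝ) (ha : 0 < a) :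
    ∀ᶠ n : ℕ in atTop, ((boxCells d B (θ * ρ n)).powerset.card : ℝ) ≤ Real.exp (a * n) := by
  have hθρ : Tendsto (fun n => θ * ρ n) atTop (𝓝 0) := by simpa using hρ.const_mul θ
  filter_upwards [hρ_pos, hθρ.eventually (ge_mem_nhds one_pos),
    hnρ.eventually_ge_atTop ((2 * B + 3) ^ d / θ ^ d / a)] with n hn h1 h2
  have h3 := card_boxCells_le (d := d) hB (mul_pos hθ hn) h1
  rw [Finset.card_powerset]
  push_cast
  calc (2 : ℝ) ^ (boxCells d B (θ * ρ n)).card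
      ≤ Real.exp 1 ^ (boxCells d B (θ * ρ n)).card := by
        gcongr
        linarith [Real.add_one_le_exp 1]
    _ = Real.exp ((boxCells d B (θ * ρ n)).card) := by rw [← Real.exp_nat_mul, mul_one]
    _ ≤ Real.exp (a * n) := by
        refine Real.exp_le_exp.2 (h3.trans ?_)
        rw [div_le_iff₀ (by positivity)] at h2
        rw [mul_pow, ← div_div, div_le_iff₀ (by positivity)]
        linarith

/-- Neither the sample nor P charges cubes that miss X, so a finite family of unions represents them
all. -/
theorem discrepancy_inter_boxCells (hf : IsNominalDensity X f₀) {B h : ℝ} (hh : 0 < h)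
    (hB : ∀ x ∈ X, ‖x‖ ≤ B) {n : ℕ} {s : Fin n → Pt d} (hs : ∀ i, s i ∈ X)
    (T : Finset (Fin d → ℤ)) :
    discrepancy (nominal f₀) h s T = discrepancy (nominal f₀) h s (T ∩ boxCells d B h) := by
  have h1 : ∀ x ∈ X, cellsInd h T x = cellsInd h (T ∩ boxCells d B h) x := by
    intro x hx
    simp [cellsInd, cell_mem_boxCells hh (hB x hx)]
  unfold discrepancy
  rw [empMean_congr fun i => h1 _ (hs i)]
  congr 1
  refine integral_congr_ae ?_
  filter_upwards [hf.ae_mem] with x hx using h1 x hx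

end LocalCounts

section SampleLocalCounts

variable {d : ℕ} {X : Set (Pt d)} {f₀ : Pt d → ℝ} {Ω : Type*} [MeasurableSpace Ω]
  {μ : Measure Ω} {x : ℕ → Ω → Pt d}

theorem ae_sample_mem (hf : IsNominalDensity X f₀) (hx_meas : ∀ i, Measurable (x i))
    (hx_law : ∀ i, μ.map (x i) = nominal f₀) : ∀ᵐ ω ∂μ, ∀ i, x i ω ∈ X := by
  refine ae_all_iff.2 fun i => ?_
  have h := hf.ae_mem
  rw [← hx_law i] at h
  exact ae_of_ae_map (hx_meas i).aemeasurable h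

/-- Almost surely, all but a vanishing fraction of the sample points have the right local counts. -/
theorem ae_eventually_fraction_not_hasLocalCount [IsProbabilityMeasure μ]
    (hf : IsNominalDensity X f₀) (hd : 0 < d) (hx_meas : ∀ i, Measurable (x i))
    (hx_indep : iIndepFun x μ) (hx_law : ∀ i, μ.map (x i) = nominal f₀) {ρ : ℕ → ℝ}
    (hρ_pos : ∀ᶠ n in atTop, 0 < ρ n) (hρ : Tendsto ρ atTop (𝓝 0))
    (hnρ : Tendsto (fun n : ℕ => n * ρ n ^ d) atTop atTop) {R ε : ℝ} (hR : 0 < R) (hε : 0 < ε) :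
    ∀ᵐ ω ∂μ, ∀ τ : ℝ, 0 < τ → ∀ᶠ n : ℕ in atTop,
      empMean (fun i : Fin n => x i ω)
        ({z | ¬ HasLocalCount f₀ R ε (ρ n) (fun i : Fin n => x i ω) z}.indicator 1) ≤ τ := by
  have := hf.isProbabilityMeasure
  obtain ⟨C, hC0, hC⟩ := hf.exists_upper_bound
  obtain ⟨B, hB0, hB⟩ := hf.isCompact.isBounded.exists_pos_norm_le
  have hv := unitVol_pos d
  set v := unitVol d with hvdef
  have hd0 : (0 : ℝ) < d := by exact_mod_cast hd
  -- the side of the cubes is `θ ρ`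
  set A : ℝ := C * v * (d * d * (R + d) ^ (d - 1)) with hA
  have hA0 : 0 < A := by positivity
  set θ : ℝ := min 1 (ε / (3 * A)) with hθdef
  have hθ0 : 0 < θ := by positivity
  have hθ1 : θ ≤ 1 := min_le_left _ _
  have hθA : A * θ ≤ ε / 3 := by
    have : θ ≤ ε / (3 * A) := min_le_right _ _
    rw [le_div_iff₀ (by positivity)] at this
    linarith
  set L : ℕ := ⌈R / θ⌉₊ with hL
  have hLθ : R ≤ L * θ := by
    rw [← div_le_iff₀ hθ0]; exact Nat.le_ceil _
  set κ : ℝ := ((offsets d L).card : ℝ) with hκ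
  have hκ0 : 0 < κ := by
    rw [hκ, card_offsets]; positivity
  -- The tolerance ε has three equal shares: the discrepancies of up to κ cubes, each at most ε'ρ^d;
  -- the oscillation of f₀; and the shell of width d h, which the choice of θ makes thin.
  set ε' : ℝ := ε / (3 * κ) with hε'
  have hε'0 : 0 < ε' := by positivity
  set q : ℝ := C * ((d * θ) ^ d * v) with hq
  set R' : ℝ := R + d * θ with hR'
  have hR'0 : 0 < R' := by positivity
  -- the two uniform laws of large numbers
  have hgrid := ae_forall_empMean_near hx_meas hx_indep hx_law
    (fun n => (boxCells d B (θ * ρ n)).powerset)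
    (card_powerset_boxCells_le hB0.le hθ0 hρ_pos hρ hnρ)
    (fun n T => cellsInd (θ * ρ n) T) (fun n T _ => measurable_cellsInd _ _)
    (fun n T _ => cellsInd_mem _ _)
  set osc : ℕ → Set (Pt d) := fun n => {z | ε / 3 * ρ n ^ d < oscIntegral f₀ z (R' * ρ n)} with hosc
  have hosc_meas : ∀ n, MeasurableSet (osc n) := fun n =>
    measurableSet_lt measurable_const (measurable_oscIntegral hf _)
  have hosc_law := ae_forall_empMean_near hx_meas hx_indep hx_law (fun _ => {()})
    (fun a ha => by
      filter_upwards with n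
      rw [Finset.card_singleton, Nat.cast_one]
      exact Real.one_le_exp (by positivity))
    (fun n _ => (osc n).indicator 1)
    (fun n _ _ => measurable_const.indicator (hosc_meas n))
    (fun n _ _ z => by
      by_cases hz : z ∈ osc n <;> simp [hz])
  filter_upwards [hgrid, hosc_law, ae_sample_mem hf hx_meas hx_law] with ω h1 h2 hX τ hτ
  -- Makes the sample share near deviant cubes at most τ/2. It can be independent of n because the
  -- mass bound of a cube and the threshold `a` both scale as ρ^d.
  set Δ : ℝ := τ / (2 * (κ * (2 * q / ε' + 1))) with hΔ
  have hq0 : 0 < q := by positivity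
  have hΔ0 : 0 < Δ := by positivity
  filter_upwards [hρ_pos, h1 Δ hΔ0, h2 (τ / 4) (by positivity),
    (tendsto_nominal_oscIntegral_gt hf hR'0 hρ_pos hρ (b := ε / 3) (by positivity)).eventually
      (ge_mem_nhds (show (0 : ℝ) < τ / 4 by positivity))] with n hn hn1 hn2 hn3
  set s : Fin n → Pt d := fun i => x i ω with hs
  have hsX : ∀ i, s i ∈ X := fun i => hX i
  set h : ℝ := θ * ρ n with hh
  have hh0 : 0 < h := by positivity
  have hdisc : ∀ T, |discrepancy (nominal f₀) h s T| ≤ Δ := by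
    intro T
    rw [discrepancy_inter_boxCells hf hh0 hB hsX]
    exact hn1 _ (Finset.mem_powerset.2 Finset.inter_subset_right)
  set a : ℝ := ε' * ρ n ^ d with ha
  have ha0 : 0 < a := by positivity
  set D : Finset (Fin d → ℤ) :=
    (boxCells d B h).filter fun c => a < |discrepancy (nominal f₀) h s {c}| with hD
  have hDin : ∀ c ∈ D, a < |discrepancy (nominal f₀) h s {c}| := fun c hc =>
    (Finset.mem_filter.1 hc).2
  have hDout : ∀ c, c ∉ D → |discrepancy (nominal f₀) h s {c}| ≤ a := by
    intro c hc
    by_cases hcb : c ∈ boxCells d B h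
    · by_contra hlt
      exact hc (Finset.mem_filter.2 ⟨hcb, not_le.1 hlt⟩)
    · rw [discrepancy_inter_boxCells hf hh0 hB hsX, Finset.singleton_inter_of_notMem hcb,
        discrepancy_eq_sum, Finset.sum_empty, abs_zero]
      exact ha0.le
  have hgood : ∀ z, z ∉ osc n → (∀ v ∈ offsets d L, cell h z + v ∉ D) →
      HasLocalCount f₀ R ε (ρ n) s z := by
    intro z hz hnear t ht htR
    have hoz : oscIntegral f₀ z (R * ρ n + d * h) ≤ ε / 3 * ρ n ^ d := by
      have : R * ρ n + d * h = R' * ρ n := by rw [hh, hR']; ring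
      rw [this]
      exact not_lt.1 hz
    have h3 := abs_empMean_closedBall_sub_le hf hd hC ha0.le hh0 hDout hnear
      (r := R * ρ n) (by rw [hh, ← mul_assoc]; gcongr) hoz ht htR
    refine h3.trans ?_
    have h4 : κ * a = ε / 3 * ρ n ^ d := by
      rw [ha, hε']; field_simp
    have h5 : (R * ρ n + d * h) ^ (d - 1) ≤ (R + d) ^ (d - 1) * ρ n ^ (d - 1) := by
      rw [← mul_pow]
      refine pow_le_pow_left₀ (by positivity) ?_ _
      rw [hh, add_mul]
      have : d * (θ * ρ n) ≤ d * (1 * ρ n) := by gcongr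
      linarith
    have h6 : C * v * (d * h * d * (R * ρ n + d * h) ^ (d - 1)) ≤ ε / 3 * ρ n ^ d := by
      calc C * v * (d * h * d * (R * ρ n + d * h) ^ (d - 1))
          ≤ C * v * (d * h * d * ((R + d) ^ (d - 1) * ρ n ^ (d - 1))) := by gcongr
        _ = A * θ * (ρ n ^ (d - 1) * ρ n) := by rw [hA, hh]; ring
        _ = A * θ * ρ n ^ d := by rw [pow_sub_one_mul hd.ne']
        _ ≤ _ := by gcongr
    linarith
  have hqcell : ∀ c : Fin d → ℤ, ∫ z, cellsInd h {c} z ∂(nominal f₀) ≤ q * ρ n ^ d := by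
    intro c
    refine (integral_cellsInd_singleton_le hf hC hC0.le hh0 c).trans (le_of_eq ?_)
    rw [hq, hh]; ring
  have hnear := empMean_near_le (L := L) ha0 hdisc hDin hqcell (by positivity)
  have hratio : 2 * (q * ρ n ^ d) / a = 2 * q / ε' := by
    rw [ha]; field_simp
  rw [hratio] at hnear
  have hosc_le : empMean s ((osc n).indicator 1) ≤ τ / 2 := by
    have h3 := (abs_le.1 (hn2 () (Finset.mem_singleton_self _))).2
    rw [integral_indicator_one (hosc_meas n)] at h3
    linarith
  have hnear_le : κ * ((2 * q / ε' + 1) * Δ) = τ / 2 := by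
    rw [hΔ]; field_simp
  rw [hnear_le] at hnear
  have hunion : empMean s ({z | ¬ HasLocalCount f₀ R ε (ρ n) s z}.indicator 1) ≤
      empMean s (fun z => (osc n).indicator 1 z +
        {z : Pt d | ∃ v ∈ offsets d L, cell h z + v ∈ D}.indicator 1 z) := by
    refine empMean_mono fun i => ?_
    by_cases hi : HasLocalCount f₀ R ε (ρ n) s (s i)
    · rw [Set.indicator_of_notMem (show s i ∉ {z | ¬ HasLocalCount f₀ R ε (ρ n) s z} from
        not_not.2 hi)]
      exact add_nonneg (Set.indicator_nonneg (fun _ _ => zero_le_one) _)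
        (Set.indicator_nonneg (fun _ _ => zero_le_one) _)
    · rw [Set.indicator_of_mem (show s i ∈ {z | ¬ HasLocalCount f₀ R ε (ρ n) s z} from hi)]
      by_cases ho : s i ∈ osc n
      · rw [Set.indicator_of_mem ho]
        exact le_add_of_nonneg_right (Set.indicator_nonneg (fun _ _ => zero_le_one) _)
      · have hex : s i ∈ {z : Pt d | ∃ v ∈ offsets d L, cell h z + v ∈ D} := by
          by_contra hno
          exact hi (hgood _ ho fun v hv hvD => hno ⟨v, hv, hvD⟩)
        rw [Set.indicator_of_mem hex]
        exact le_add_of_nonneg_left (Set.indicator_nonneg (fun _ _ => zero_le_one) _)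
  have hadd : empMean s (fun z => (osc n).indicator 1 z +
        {z : Pt d | ∃ v ∈ offsets d L, cell h z + v ∈ D}.indicator 1 z) =
      empMean s ((osc n).indicator 1) +
        empMean s ({z : Pt d | ∃ v ∈ offsets d L, cell h z + v ∈ D}.indicator 1) := by
    unfold empMean
    rw [Finset.sum_add_distrib, mul_add]
  linarith

end SampleLocalCounts

/-! ### The preference pairs follow the density -/

section Preferences

variable {d : ℕ} {X : Set (Pt d)} {f₀ : Pt d → ℝ}

/-- In dimension 0 the whole mass sits at one point, hence on one level, which the Lipschitz bound
forbids. -/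
theorem IsNominalDensity.dim_pos (hf : IsNominalDensity X f₀) : 0 < d := by
  rcases Nat.eq_zero_or_pos d with rfl | h
  · exfalso
    have := hf.isProbabilityMeasure
    obtain ⟨M, hM, hlip⟩ := hf.exists_levelMass_lipschitz
    have h1 := hlip (f₀ 0 - 1 / (2 * M)) (1 / (2 * M)) (by positivity)
    have hpos : 0 < 1 / (2 * M) := by positivity
    rw [hf.levelMass_sub (by linarith)] at h1
    have h2 : {x | f₀ 0 - 1 / (2 * M) < f₀ x ∧ f₀ x ≤ f₀ 0 - 1 / (2 * M) + 1 / (2 * M)} =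
        Set.univ := by
      refine Set.eq_univ_of_forall fun x => ?_
      have hx : x = 0 := Subsingleton.elim _ _
      subst hx
      change _ ∧ _
      constructor <;> linarith
    rw [h2, probReal_univ] at h1
    have h3 : M * (1 / (2 * M)) = 1 / 2 := by field_simp
    linarith
  · exact h

/-- The pairs of sample points whose densities differ by at least `δ` and which the average
nearest-neighbour distances do not rank accordingly. -/
noncomputable def misordered {n : ℕ} (f₀ : Pt d → ℝ) (K : ℕ) (δ : ℝ) (s : Fin n → Pt d) :
    Finset (Fin n × Fin n) :=
  open Classical in
  Finset.univ.filter fun q =>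
    f₀ (s q.1) + δ ≤ f₀ (s q.2) ∧ ¬ avgNNDist K s (s q.2) < avgNNDist K s (s q.1)

theorem misordered_anti {n : ℕ} (K : ℕ) (s : Fin n → Pt d) {δ δ' : ℝ} (h : δ ≤ δ') :
    misordered f₀ K δ' s ⊆ misordered f₀ K δ s := by
  classical
  intro q hq
  unfold misordered at hq ⊢
  rw [Finset.mem_filter] at hq ⊢
  exact ⟨hq.1, by linarith [hq.2.1], hq.2.2⟩

theorem card_filter_fst_or_snd_le {n : ℕ} (p : Fin n → Prop) [DecidablePred p] :
    (Finset.univ.filter fun q : Fin n × Fin n => p q.1 ∨ p q.2).card ≤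
      2 * (n * (Finset.univ.filter p).card) := by
  classical
  rw [Finset.filter_or]
  refine (Finset.card_union_le _ _).trans (le_of_eq ?_)
  have h1 : (Finset.univ.filter fun q : Fin n × Fin n => p q.1) =
      (Finset.univ.filter p) ×ˢ Finset.univ := by
    ext q; simp
  have h2 : (Finset.univ.filter fun q : Fin n × Fin n => p q.2) =
      Finset.univ ×ˢ (Finset.univ.filter p) := by
    ext q; simp
  rw [h1, h2, Finset.card_product, Finset.card_product, Finset.card_univ, Fintype.card_fin]
  ring

theorem tendsto_div_of_isBigO_sqrt {K : ℕ → ℕ}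
    (hK : (fun n => (K n : ℝ)) =O[atTop] fun n : ℕ => (n : ℝ) ^ (0.5 : ℝ)) :
    Tendsto (fun n : ℕ => (K n : ℝ) / n) atTop (𝓝 0) := by
  have h1 : (fun n : ℕ => (n : ℝ) ^ (0.5 : ℝ)) =o[atTop] fun n : ℕ => (n : ℝ) := by
    refine Asymptotics.isLittleO_of_tendsto' ?_ ?_
    · filter_upwards [eventually_gt_atTop 0] with n hn h0
      exact absurd h0 (by positivity)
    · have h2 : Tendsto (fun n : ℕ => (n : ℝ) ^ (-(0.5 : ℝ))) atTop (𝓝 0) :=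
        (tendsto_rpow_neg_atTop (by norm_num)).comp tendsto_natCast_atTop_atTop
      refine h2.congr' ?_
      filter_upwards [eventually_gt_atTop 0] with n hn
      have hn0 : (0 : ℝ) < n := by exact_mod_cast hn
      rw [← Real.rpow_sub_one hn0.ne']
      norm_num
  exact (hK.trans_isLittleO h1).tendsto_div_nhds_zero

variable {Ω : Type*} [MeasurableSpace Ω] {μ : Measure Ω} [IsProbabilityMeasure μ]
  {x : ℕ → Ω → Pt d}

/-- Almost surely, the fraction of the misordered pairs vanishes. -/
theorem ae_eventually_card_misordered_le (hf : IsNominalDensity X f₀)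
    (hx_meas : ∀ i, Measurable (x i)) (hx_indep : iIndepFun x μ)
    (hx_law : ∀ i, μ.map (x i) = nominal f₀) {K : ℕ → ℕ}
    (hK : Tendsto (fun n : ℕ => (K n : ℝ) / n) atTop (𝓝 0)) (hK_top : Tendsto K atTop atTop) :
    ∀ᵐ ω ∂μ, ∀ δ : ℝ, 0 < δ → ∀ τ : ℝ, 0 < τ → ∀ᶠ n : ℕ in atTop,
      ((misordered f₀ (K n) δ (fun i : Fin n => x i ω)).card : ℝ) ≤ τ * n ^ 2 := by
  classical
  have hd := hf.dim_pos
  have hd0 : (0 : ℝ) < d := by exact_mod_cast hd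
  obtain ⟨C, hC0, hC⟩ := hf.exists_upper_bound
  obtain ⟨m, hm0, hm⟩ := hf.lower_bound
  -- The scale with nρ^d = K, at which a ball holds a number of sample points of order K.
  set ρ : ℕ → ℝ := fun n => ((K n : ℝ) / n) ^ ((d : ℝ)⁻¹) with hρdef
  have hKpos : ∀ᶠ n in atTop, 0 < K n := hK_top.eventually_gt_atTop 0
  have hρ_pos : ∀ᶠ n in atTop, 0 < ρ n := by
    filter_upwards [hKpos, eventually_gt_atTop 0] with n hn hn0
    exact Real.rpow_pos_of_pos (by positivity) _
  have hρ : Tendsto ρ atTop (𝓝 0) := by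
    have := hK.rpow_const (p := (d : ℝ)⁻¹) (Or.inr (by positivity))
    rwa [Real.zero_rpow (by positivity)] at this
  have hnρ_eq : ∀ᶠ n : ℕ in atTop, n * ρ n ^ d = K n := by
    filter_upwards [eventually_gt_atTop 0] with n hn
    rw [hρdef]
    simp only
    rw [Real.rpow_inv_natCast_pow (by positivity) hd.ne']
    field_simp
  have hnρ : Tendsto (fun n : ℕ => n * ρ n ^ d) atTop atTop :=
    (tendsto_natCast_atTop_atTop.comp hK_top).congr' (by
      filter_upwards [hnρ_eq] with n hn using hn.symm)
  have key : ∀ k : ℕ, ∀ᵐ ω ∂μ, ∀ τ : ℝ, 0 < τ → ∀ᶠ n : ℕ in atTop,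
      ((misordered f₀ (K n) (1 / ((k : ℝ) + 1)) (fun i : Fin n => x i ω)).card : ℝ) ≤
        τ * n ^ 2 := by
    intro k
    obtain ⟨R, hR, ε, hε, hcomp⟩ := exists_localCount_compare hd
      (show 0 < 1 / ((k : ℝ) + 1) by positivity) hm0 hC0
    filter_upwards [ae_eventually_fraction_not_hasLocalCount hf hd hx_meas hx_indep hx_law hρ_pos
      hρ hnρ hR hε, ae_sample_mem hf hx_meas hx_law] with ω hω hX τ hτ
    filter_upwards [hω (τ / 2) (by positivity), hKpos, hρ_pos, hnρ_eq, eventually_gt_atTop 0]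
      with n h1 hKn hρn hnρn hn
    set s : Fin n → Pt d := fun i => x i ω with hs
    have hn0 : (0 : ℝ) < n := by exact_mod_cast hn
    -- A misordered pair has an endpoint with wrong local counts, so the pairs number at most 2n
    -- times such points.
    have hsub : misordered f₀ (K n) (1 / ((k : ℝ) + 1)) s ⊆
        Finset.univ.filter fun q : Fin n × Fin n => ¬ HasLocalCount f₀ R ε (ρ n) s (s q.1) ∨
          ¬ HasLocalCount f₀ R ε (ρ n) s (s q.2) := by
      intro q hq
      unfold misordered at hq
      rw [Finset.mem_filter] at hq ⊢
      refine ⟨Finset.mem_univ _, ?_⟩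
      by_contra hcon
      push Not at hcon
      exact hq.2.2 (hcomp f₀ n (K n) (ρ n) s _ _ hn hKn hρn hnρn hcon.1 hcon.2 (hm _ (hX _))
        hq.2.1 (hC _))
    have h2 := (Finset.card_le_card hsub).trans
      (card_filter_fst_or_snd_le fun i => ¬ HasLocalCount f₀ R ε (ρ n) s (s i))
    have h3 : ((Finset.univ.filter fun i => ¬ HasLocalCount f₀ R ε (ρ n) s (s i)).card : ℝ) ≤
        τ / 2 * n := by
      rw [empMean_indicator, one_div_mul_eq_div, div_le_iff₀ hn0] at h1
      refine le_trans (le_of_eq ?_) h1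
      congr!
    have h4 : ((misordered f₀ (K n) (1 / ((k : ℝ) + 1)) s).card : ℝ) ≤
        2 * (n * (Finset.univ.filter fun i => ¬ HasLocalCount f₀ R ε (ρ n) s (s i)).card) := by
      exact_mod_cast h2
    calc _ ≤ _ := h4
      _ ≤ 2 * (n * (τ / 2 * n)) := by gcongr
      _ = τ * n ^ 2 := by ring
  filter_upwards [ae_all_iff.2 key] with ω hω δ hδ τ hτ
  obtain ⟨k, hk⟩ := exists_nat_one_div_lt hδ
  filter_upwards [hω k τ hτ] with n hn
  refine le_trans ?_ hn
  exact_mod_cast Finset.card_le_card (misordered_anti (K n) _ hk.le)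

end Preferences

/-! ### Level sets of the density in the sample -/

section Levels

variable {d : ℕ} {X : Set (Pt d)} {f₀ : Pt d → ℝ}

/-- The fraction of the sample points of density at most `t`. -/
noncomputable def levelFraction {n : ℕ} (f₀ : Pt d → ℝ) (s : Fin n → Pt d) (t : ℝ) : ℝ :=
  empMean s ({z | f₀ z ≤ t}.indicator 1)

theorem levelFraction_mono {n : ℕ} (s : Fin n → Pt d) : Monotone (levelFraction f₀ s) := by
  intro t t' h
  refine empMean_mono fun i => Set.indicator_le_indicator_of_subset ?_ (fun _ => zero_le_one) _
  exact fun z (hz : f₀ z ≤ t) => hz.trans h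

/-- The Glivenko–Cantelli theorem for the density levels. -/
theorem ae_eventually_levelFraction_near {Ω : Type*} [MeasurableSpace Ω] {μ : Measure Ω}
    [IsProbabilityMeasure μ] {x : ℕ → Ω → Pt d} (hf : IsNominalDensity X f₀)
    (hx_meas : ∀ i, Measurable (x i)) (hx_indep : iIndepFun x μ)
    (hx_law : ∀ i, μ.map (x i) = nominal f₀) :
    ∀ᵐ ω ∂μ, ∀ τ : ℝ, 0 < τ → ∀ᶠ n : ℕ in atTop, ∀ t,
      |levelFraction f₀ (fun i : Fin n => x i ω) t - levelMass f₀ t| ≤ τ := by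
  have := hf.isProbabilityMeasure
  obtain ⟨C, hC0, hC⟩ := hf.exists_upper_bound
  obtain ⟨m, hm0, hm⟩ := hf.lower_bound
  obtain ⟨M, hM, hlip⟩ := hf.exists_levelMass_lipschitz
  have hlevel : ∀ t, MeasurableSet {z | f₀ z ≤ t} := fun t =>
    measurableSet_le hf.measurable measurable_const
  have key : ∀ k : ℕ, ∀ᵐ ω ∂μ, ∀ᶠ n : ℕ in atTop, ∀ t,
      |levelFraction f₀ (fun i : Fin n => x i ω) t - levelMass f₀ t| ≤
        (1 + M) * (1 / ((k : ℝ) + 1)) := by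
    intro k
    set δ : ℝ := 1 / ((k : ℝ) + 1) with hδ
    have hδ0 : 0 < δ := by positivity
    -- A grid of step δ over [0, C]; between grid levels, monotonicity and the Lipschitz bound cost
    -- Mδ.
    set N : ℕ := ⌈C / δ⌉₊ with hN
    have hlaw := ae_forall_empMean_near hx_meas hx_indep hx_law
      (fun _ => Finset.range (N + 1)) (fun a ha => by
        have h1 : Tendsto (fun n : ℕ => Real.exp (a * n)) atTop atTop :=
          Real.tendsto_exp_atTop.comp (tendsto_natCast_atTop_atTop.const_mul_atTop ha)
        exact h1.eventually_ge_atTop _)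
      (fun _ j => {z | f₀ z ≤ j * δ}.indicator 1)
      (fun _ j _ => measurable_const.indicator (hlevel _))
      (fun _ j _ z => by by_cases hz : z ∈ {z | f₀ z ≤ j * δ} <;> simp [hz])
    filter_upwards [hlaw, ae_sample_mem hf hx_meas hx_law] with ω hω hX
    filter_upwards [hω δ hδ0, eventually_gt_atTop 0] with n hn hn0 t
    set s : Fin n → Pt d := fun i => x i ω with hs
    have hgrid : ∀ j ∈ Finset.range (N + 1),
        |levelFraction f₀ s (j * δ) - levelMass f₀ (j * δ)| ≤ δ := by
      intro j hj
      have h1 := hn j hj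
      rw [integral_indicator_one (hlevel _)] at h1
      exact h1
    have hbound : 0 ≤ (1 + M) * δ := by positivity
    rcases lt_or_ge t 0 with ht | ht
    · have h1 : levelFraction f₀ s t = 0 := by
        unfold levelFraction empMean
        rw [Finset.sum_eq_zero, mul_zero]
        intro i _
        have hz : s i ∉ {z | f₀ z ≤ t} := fun (hz : f₀ (s i) ≤ t) => by
          linarith [hf.nonneg (s i)]
        exact Set.indicator_of_notMem hz _
      rw [h1, hf.levelMass_of_lt hm (ht.trans hm0), sub_zero, abs_zero]
      exact hbound
    rcases lt_or_ge t C with htC | htC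
    · set j : ℕ := ⌊t / δ⌋₊ with hj
      have hj1 : j * δ ≤ t := by
        rw [← le_div_iff₀ hδ0]; exact Nat.floor_le (by positivity)
      have hj2 : t ≤ (j + 1 : ℕ) * δ := by
        rw [← div_le_iff₀ hδ0]; push_cast; exact (Nat.lt_floor_add_one _).le
      have hjN : j + 1 ≤ N := by
        rw [Nat.add_one_le_iff, hN, Nat.lt_ceil]
        refine lt_of_le_of_lt (Nat.floor_le (by positivity)) ?_
        gcongr
      have h1 := abs_le.1 (hgrid j (Finset.mem_range.2 (by omega)))
      have h2 := abs_le.1 (hgrid (j + 1) (Finset.mem_range.2 (by omega)))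
      have h3 := hlip (j * δ) δ hδ0.le
      have h4 : j * δ + δ = (j + 1 : ℕ) * δ := by push_cast; ring
      rw [h4] at h3
      have h5 := levelFraction_mono (f₀ := f₀) s hj1
      have h6 := levelFraction_mono (f₀ := f₀) s hj2
      have h7 := hf.levelMass_mono hj1
      have h8 := hf.levelMass_mono hj2
      rw [abs_le]
      constructor <;> linarith
    · have h1 : levelFraction f₀ s t = 1 := by
        have : {z | f₀ z ≤ t} = Set.univ := Set.eq_univ_of_forall fun z => (hC z).trans htC
        unfold levelFraction empMean
        rw [this]
        have hn1 : (n : ℝ) ≠ 0 := by positivity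
        simp [hn1]
      rw [h1, hf.levelMass_of_le hC htC, sub_self, abs_zero]
      exact hbound
  filter_upwards [ae_all_iff.2 key] with ω hω τ hτ
  obtain ⟨k, hk⟩ := exists_nat_one_div_lt (show 0 < τ / (1 + M) by positivity)
  filter_upwards [hω k] with n hn t
  refine (hn t).trans ?_
  rw [lt_div_iff₀ (by positivity)] at hk
  linarith

/-- Few sample points have a density close to a given level. -/
theorem empMean_near_level_le {n : ℕ} {s : Fin n → Pt d} {M τ : ℝ}
    (hM : ∀ t r : ℝ, 0 ≤ r → levelMass f₀ (t + r) - levelMass f₀ t ≤ M * r)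
    (hτ : ∀ t, |levelFraction f₀ s t - levelMass f₀ t| ≤ τ) {δ : ℝ} (hδ : 0 < δ) (a : ℝ) :
    empMean s ({z | |f₀ z - a| ≤ δ}.indicator 1) ≤ 3 * M * δ + 2 * τ := by
  -- Subtracting at a - 2δ keeps the points of density exactly a - δ in the band, whence 3δ and not
  -- 2δ in the bound.
  have h1 : empMean s ({z | |f₀ z - a| ≤ δ}.indicator 1) + levelFraction f₀ s (a - 2 * δ) ≤
      levelFraction f₀ s (a + δ) := by
    unfold levelFraction empMean
    rw [← mul_add, ← Finset.sum_add_distrib]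
    refine mul_le_mul_of_nonneg_left (Finset.sum_le_sum fun i _ => ?_) (by positivity)
    by_cases h2 : f₀ (s i) ≤ a + δ
    · rw [Set.indicator_of_mem (show s i ∈ {z | f₀ z ≤ a + δ} from h2)]
      by_cases h3 : f₀ (s i) ≤ a - 2 * δ
      · rw [Set.indicator_of_mem (show s i ∈ {z | f₀ z ≤ a - 2 * δ} from h3),
          Set.indicator_of_notMem, zero_add]
        intro (h4 : |f₀ (s i) - a| ≤ δ)
        linarith [(abs_le.1 h4).1]
      · rw [Set.indicator_of_notMem (show s i ∉ {z | f₀ z ≤ a - 2 * δ} from h3), add_zero]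
        exact Set.indicator_le_self' (fun _ _ => zero_le_one) _
    · rw [Set.indicator_of_notMem (show s i ∉ {z | f₀ z ≤ a + δ} from h2),
        Set.indicator_of_notMem, Set.indicator_of_notMem, add_zero]
      · intro (h3 : f₀ (s i) ≤ a - 2 * δ)
        linarith
      · intro (h3 : |f₀ (s i) - a| ≤ δ)
        linarith [(abs_le.1 h3).2]
  have h2 := hM (a - 2 * δ) (3 * δ) (by positivity)
  have h3 : a - 2 * δ + 3 * δ = a + δ := by ring
  rw [h3] at h2
  have h4 := (abs_le.1 (hτ (a + δ))).2
  have h5 := (abs_le.1 (hτ (a - 2 * δ))).1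
  linarith

/-- The pairs of sample points whose densities differ by at most `δ`. -/
noncomputable def closePairs {n : ℕ} (f₀ : Pt d → ℝ) (δ : ℝ) (s : Fin n → Pt d) :
    Finset (Fin n × Fin n) :=
  open Classical in Finset.univ.filter fun q => |f₀ (s q.1) - f₀ (s q.2)| ≤ δ

/-- The pairs of sample points whose densities increase by at least `δ`. -/
noncomputable def increasingPairs {n : ℕ} (f₀ : Pt d → ℝ) (δ : ℝ) (s : Fin n → Pt d) :
    Finset (Fin n × Fin n) :=
  open Classical in Finset.univ.filter fun q => f₀ (s q.1) + δ ≤ f₀ (s q.2)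

theorem card_closePairs_le {n : ℕ} (hn : 0 < n) {s : Fin n → Pt d} {δ c : ℝ}
    (h : ∀ a, empMean s ({z | |f₀ z - a| ≤ δ}.indicator 1) ≤ c) :
    ((closePairs f₀ δ s).card : ℝ) ≤ c * n ^ 2 := by
  classical
  have hn0 : (0 : ℝ) < n := by exact_mod_cast hn
  have h1 : ((closePairs f₀ δ s).card : ℝ) =
      ∑ j, ∑ i, {z | |f₀ z - f₀ (s j)| ≤ δ}.indicator (1 : Pt d → ℝ) (s i) := by
    rw [closePairs, Finset.card_filter, Nat.cast_sum, ← Finset.univ_product_univ,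
      Finset.sum_product_right]
    refine Finset.sum_congr rfl fun j _ => Finset.sum_congr rfl fun i _ => ?_
    simp [Set.indicator_apply]
  rw [h1]
  calc _ ≤ ∑ _j : Fin n, c * n := by
        refine Finset.sum_le_sum fun j _ => ?_
        have := h (f₀ (s j))
        rw [empMean, one_div_mul_eq_div, div_le_iff₀ hn0] at this
        exact this
    _ = c * n ^ 2 := by simp; ring

/-- Every pair is increasing, the swap of an increasing pair, or close. With few close and few
misordered pairs, this bounds the number of preference pairs from below. -/
theorem sq_le_card_increasingPairs {n : ℕ} (s : Fin n → Pt d) (δ : ℝ) :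
    (n : ℝ) ^ 2 ≤ 2 * (increasingPairs f₀ δ s).card + (closePairs f₀ δ s).card := by
  classical
  have h1 : (Finset.univ : Finset (Fin n × Fin n)) ⊆
      (increasingPairs f₀ δ s ∪ (increasingPairs f₀ δ s).image Prod.swap) ∪
        closePairs f₀ δ s := by
    intro q _
    simp only [Finset.mem_union, Finset.mem_image, increasingPairs, closePairs, Finset.mem_filter,
      Finset.mem_univ, true_and]
    by_cases h2 : f₀ (s q.1) + δ ≤ f₀ (s q.2)
    · exact Or.inl (Or.inl h2)
    by_cases h3 : f₀ (s q.2) + δ ≤ f₀ (s q.1)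
    · exact Or.inl (Or.inr ⟨q.swap, h3, Prod.swap_swap q⟩)
    · right
      rw [abs_le]; constructor <;> linarith [not_le.1 h2, not_le.1 h3]
  have h2 := (Finset.card_le_card h1).trans ((Finset.card_union_le _ _).trans
    (Nat.add_le_add_right ((Finset.card_union_le _ _).trans
      (Nat.add_le_add_left Finset.card_image_le _)) _))
  rw [Finset.card_univ, Fintype.card_prod, Fintype.card_fin] at h2
  have h3 : (n : ℝ) * n ≤ (increasingPairs f₀ δ s).card + (increasingPairs f₀ δ s).card +
      (closePairs f₀ δ s).card := by exact_mod_cast h2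
  linarith

theorem card_increasingPairs_le {n : ℕ} (s : Fin n → Pt d) (K : ℕ) (δ : ℝ) :
    (increasingPairs f₀ δ s).card ≤ (prefPairs K s).card + (misordered f₀ K δ s).card := by
  classical
  refine (Finset.card_le_card fun q hq => ?_).trans (Finset.card_union_le _ _)
  rw [increasingPairs, Finset.mem_filter] at hq
  rw [Finset.mem_union]
  by_cases h : avgNNDist K s (s q.2) < avgNNDist K s (s q.1)
  · left
    rw [prefPairs, Finset.mem_filter]
    exact ⟨Finset.mem_univ _, h⟩
  · right
    rw [misordered, Finset.mem_filter]
    exact ⟨Finset.mem_univ _, hq.2, h⟩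

/-- The risk of an approximation of a steep multiple of `-f₀`. -/
theorem sum_hinge_le {n : ℕ} {σ : ℝ} {s : Fin n → Pt d} (hs : ∀ i, s i ∈ X) (K : ℕ)
    {h : RBFSpace d σ} {T δ C : ℝ} (hT : 0 < T) (hTδ : T * δ = 2)
    (hh : ∀ z ∈ X, |h z - (-(T * f₀ z))| ≤ 1 / 2) (hf0 : ∀ z, 0 ≤ f₀ z) (hC : ∀ z, f₀ z ≤ C) :
    ∑ q ∈ prefPairs K s, hinge (h (s q.1) - h (s q.2)) ≤
      4 * (closePairs f₀ δ s).card + (2 + T * C) * (misordered f₀ K δ s).card := by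
  classical
  have hTC : 0 ≤ T * C := mul_nonneg hT.le ((hf0 0).trans (hC 0))
  have h1 : ∀ q ∈ prefPairs K s, hinge (h (s q.1) - h (s q.2)) ≤
      (if q ∈ closePairs f₀ δ s then 4 else 0) +
        (if q ∈ (misordered f₀ K δ s).image Prod.swap then (2 + T * C) else 0) := by
    intro q hq
    rw [prefPairs, Finset.mem_filter] at hq
    have h2 := abs_le.1 (hh _ (hs q.1))
    have h3 := abs_le.1 (hh _ (hs q.2))
    have hnn1 : (0 : ℝ) ≤ if q ∈ closePairs f₀ δ s then 4 else 0 := by split_ifs <;> norm_num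
    have hnn2 : (0 : ℝ) ≤
        if q ∈ (misordered f₀ K δ s).image Prod.swap then (2 + T * C) else 0 := by
      split_ifs
      · linarith
      · exact le_rfl
    -- A rise by δ gives a margin of at least Tδ - 1 = 1, hence no loss. A fall by δ within a
    -- preference pair means that the swapped pair is misordered. Otherwise the pair is close and
    -- loses at most 2 + Tδ = 4.
    by_cases h4 : f₀ (s q.1) + δ ≤ f₀ (s q.2)
    · have h5 : T * (f₀ (s q.1) + δ) ≤ T * f₀ (s q.2) := by gcongr
      have h6 : hinge (h (s q.1) - h (s q.2)) = 0 := by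
        rw [hinge, max_eq_left]; linarith
      rw [h6]; positivity
    by_cases h5 : f₀ (s q.2) + δ ≤ f₀ (s q.1)
    · have h6 : q ∈ (misordered f₀ K δ s).image Prod.swap := by
        refine Finset.mem_image.2 ⟨q.swap, ?_, Prod.swap_swap q⟩
        rw [misordered, Finset.mem_filter]
        exact ⟨Finset.mem_univ _, h5, not_lt.2 hq.2.le⟩
      have h7 : T * f₀ (s q.1) ≤ T * C := by gcongr; exact hC _
      have h8 : 0 ≤ T * f₀ (s q.2) := mul_nonneg hT.le (hf0 _)
      have h9 : hinge (h (s q.1) - h (s q.2)) ≤ 2 + T * C := by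
        rw [hinge]; exact max_le (by linarith) (by linarith)
      rw [if_pos h6]; linarith
    · have h6 : q ∈ closePairs f₀ δ s := by
        rw [closePairs, Finset.mem_filter]
        refine ⟨Finset.mem_univ _, ?_⟩
        rw [abs_le]; constructor <;> linarith [not_le.1 h4, not_le.1 h5]
      have h7 : T * f₀ (s q.1) ≤ T * (f₀ (s q.2) + δ) := by
        gcongr
        exact (not_le.1 h5).le
      have h9 : hinge (h (s q.1) - h (s q.2)) ≤ 4 := by
        rw [hinge]; exact max_le (by norm_num) (by linarith)
      rw [if_pos h6]; linarith
  calc _ ≤ ∑ q ∈ prefPairs K s, ((if q ∈ closePairs f₀ δ s then (4 : ℝ) else 0) +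
        (if q ∈ (misordered f₀ K δ s).image Prod.swap then (2 + T * C) else 0)) :=
        Finset.sum_le_sum h1
    _ ≤ ∑ q : Fin n × Fin n, ((if q ∈ closePairs f₀ δ s then (4 : ℝ) else 0) +
        (if q ∈ (misordered f₀ K δ s).image Prod.swap then (2 + T * C) else 0)) := by
        refine Finset.sum_le_sum_of_subset_of_nonneg (Finset.subset_univ _) fun q _ _ => ?_
        split_ifs <;> linarith
    _ = 4 * (closePairs f₀ δ s).card +
        (2 + T * C) * ((misordered f₀ K δ s).image Prod.swap).card := by
        rw [Finset.sum_add_distrib, Finset.sum_ite_mem, Finset.sum_ite_mem, Finset.univ_inter,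
          Finset.univ_inter, Finset.sum_const, Finset.sum_const, nsmul_eq_mul, nsmul_eq_mul]
        ring
    _ ≤ _ := by
        have := mul_le_mul_of_nonneg_left (Nat.cast_le (α := ℝ).2
          (Finset.card_image_le (s := misordered f₀ K δ s) (f := Prod.swap)))
          (show 0 ≤ 2 + T * C by linarith)
        linarith

end Levels

/-! ### Covers of the balls of the reproducing kernel Hilbert space -/

section Covers

variable {d : ℕ} {X : Set (Pt d)} {σ : ℝ}

/-- The centres of `Metric.coveringNumber` belong to the covered set, so they lift to elements of H
and are continuous functions. -/
theorem exists_finset_cover {R : ℝ} {ε : ℝ≥0} (h : ballCoveringNumber X σ R ε ≠ ⊤) :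
    ∃ C : Finset (RBFSpace d σ), (C.card : ℕ∞) ≤ ballCoveringNumber X σ R ε ∧
      ∀ g : RBFSpace d σ, ‖g‖ ≤ R → ∃ c ∈ C, ∀ z ∈ X, |g z - c z| ≤ ε := by
  classical
  obtain ⟨C', hsub, hfin, hcov, hcard⟩ := Metric.exists_set_encard_eq_coveringNumber h
  have hsub' : ∀ c ∈ C', ∃ g ∈ Metric.closedBall (0 : RBFSpace d σ) R,
      UniformFun.ofFun (fun z : X => g (z : Pt d)) = c := fun c hc => hsub hc
  choose! φ hφ using hsub'
  refine ⟨hfin.toFinset.image φ, ?_, fun g hg => ?_⟩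
  · unfold ballCoveringNumber
    rw [← hcard, hfin.encard_eq_coe_toFinset_card]
    exact_mod_cast Finset.card_image_le
  · obtain ⟨c, hc, hgc⟩ := hcov ⟨g, mem_closedBall_zero_iff.2 hg, rfl⟩
    refine ⟨φ c, Finset.mem_image.2 ⟨c, hfin.mem_toFinset.2 hc, rfl⟩, fun z hz => ?_⟩
    have h1 : edist (UniformFun.ofFun fun z : X => g (z : Pt d)) c ≤ ε := hgc
    rw [← (hφ c hc).2, UniformFun.edist_le] at h1
    have h2 := h1 ⟨z, hz⟩
    rw [UniformFun.toFun_ofFun, UniformFun.toFun_ofFun, edist_dist, ENNReal.ofReal_le_iff_le_toReal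
      ENNReal.coe_ne_top, Real.dist_eq] at h2
    exact h2

/-- Once λ_n ≤ 1, a bound exp(a n λ_n) is at most exp(a n). In particular the covering number is
finite from some n on. -/
theorem eventually_ballCoveringNumber_le {lam : ℕ → ℝ} (hlam_pos : ∀ n, 0 < lam n)
    (hlam : Tendsto lam atTop (𝓝 0)) {ε : ℝ≥0}
    (hcover : Tendsto (fun n : ℕ =>
      ENNReal.log (ballCoveringNumber X σ (1 / √(lam n)) ε : ℝ≥0∞) /
        (((n : ℝ) * lam n : ℝ) : EReal)) atTop (𝓝 0)) (a : ℝ) (ha : 0 < a) :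
    ∀ᶠ n : ℕ in atTop, (ballCoveringNumber X σ (1 / √(lam n)) ε : ℝ≥0∞) ≤
      ENNReal.ofReal (Real.exp (a * n)) := by
  have ha' : (0 : EReal) < (a : EReal) := by exact_mod_cast ha
  filter_upwards [hcover.eventually (ge_mem_nhds ha'), hlam.eventually (ge_mem_nhds one_pos),
    eventually_gt_atTop 0] with n h1 h2 hn
  have hn0 : (0 : ℝ) < n := by exact_mod_cast hn
  have hpos : 0 < (n : ℝ) * lam n := mul_pos hn0 (hlam_pos n)
  rw [EReal.div_le_iff_le_mul (by exact_mod_cast hpos) (EReal.coe_ne_top _), ← EReal.coe_mul] at h1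
  rw [← ENNReal.log_le_log_iff, ENNReal.log_ofReal_of_pos (Real.exp_pos _), Real.log_exp]
  refine h1.trans ?_
  rw [EReal.coe_le_coe_iff]
  calc (n : ℝ) * lam n * a ≤ n * 1 * a := by gcongr
    _ = a * n := by ring

/-- The balls of radius `1 / √λ_n` have uniform covers of subexponential cardinality. -/
theorem exists_seq_finset_cover {lam : ℕ → ℝ} (hlam_pos : ∀ n, 0 < lam n)
    (hlam : Tendsto lam atTop (𝓝 0)) {ε : ℝ≥0}
    (hcover : Tendsto (fun n : ℕ =>
      ENNReal.log (ballCoveringNumber X σ (1 / √(lam n)) ε : ℝ≥0∞) /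
        (((n : ℝ) * lam n : ℝ) : EReal)) atTop (𝓝 0)) :
    ∃ C : ℕ → Finset (RBFSpace d σ),
      (∀ a : ℝ, 0 < a → ∀ᶠ n : ℕ in atTop, ((C n).card : ℝ) ≤ Real.exp (a * n)) ∧
      ∀ᶠ n : ℕ in atTop, ∀ g : RBFSpace d σ, ‖g‖ ≤ 1 / √(lam n) →
        ∃ c ∈ C n, ∀ z ∈ X, |g z - c z| ≤ ε := by
  have hex : ∀ n, ∃ C : Finset (RBFSpace d σ), ballCoveringNumber X σ (1 / √(lam n)) ε ≠ ⊤ →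
      (C.card : ℕ∞) ≤ ballCoveringNumber X σ (1 / √(lam n)) ε ∧
      ∀ g : RBFSpace d σ, ‖g‖ ≤ 1 / √(lam n) → ∃ c ∈ C, ∀ z ∈ X, |g z - c z| ≤ ε := by
    intro n
    by_cases h : ballCoveringNumber X σ (1 / √(lam n)) ε = ⊤
    · exact ⟨∅, fun h' => absurd h h'⟩
    · obtain ⟨C, hC⟩ := exists_finset_cover h
      exact ⟨C, fun _ => hC⟩
  choose C hC using hex
  have hfin : ∀ n (a : ℝ), (ballCoveringNumber X σ (1 / √(lam n)) ε : ℝ≥0∞) ≤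
      ENNReal.ofReal (Real.exp (a * n)) → ballCoveringNumber X σ (1 / √(lam n)) ε ≠ ⊤ := by
    intro n a h htop
    rw [htop] at h
    exact absurd h (by simp)
  refine ⟨C, fun a ha => ?_, ?_⟩
  · filter_upwards [eventually_ballCoveringNumber_le hlam_pos hlam hcover a ha] with n hn
    have h1 := (hC n (hfin n a hn)).1
    have h2 : (((C n).card : ℕ∞) : ℝ≥0∞) ≤ ENNReal.ofReal (Real.exp (a * n)) :=
      (ENat.toENNReal_le.2 h1).trans hn
    rw [ENat.toENNReal_coe, ← ENNReal.ofReal_natCast,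
      ENNReal.ofReal_le_ofReal_iff (Real.exp_pos _).le] at h2
    exact h2
  · filter_upwards [eventually_ballCoveringNumber_le hlam_pos hlam hcover 1 one_pos] with n hn
    exact (hC n (hfin n 1 hn)).2

end Covers

/-! ### The objective at the ranker vanishes -/

section Objective

variable {d : ℕ} {X : Set (Pt d)} {f₀ : Pt d → ℝ} {Ω : Type*} [MeasurableSpace Ω]
  {μ : Measure Ω} [IsProbabilityMeasure μ] {x : ℕ → Ω → Pt d}

/-- The ranker is compared with one h close to -(2/δ)f₀ on X. As h depends on τ but not on n, its
penalty λ_n‖h‖² vanishes; its loss comes only from close and misordered pairs. -/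
theorem ae_eventually_empRisk_isRanker_le (hf : IsNominalDensity X f₀)
    (hx_meas : ∀ i, Measurable (x i)) (hx_indep : iIndepFun x μ)
    (hx_law : ∀ i, μ.map (x i) = nominal f₀) {K : ℕ → ℕ}
    (hK : Tendsto (fun n : ℕ => (K n : ℝ) / n) atTop (𝓝 0)) (hK_top : Tendsto K atTop atTop)
    {σ : ℝ} (hσ : 0 < σ) {lam : ℕ → ℝ} (hlam_pos : ∀ n, 0 < lam n)
    (hlam : Tendsto lam atTop (𝓝 0)) :
    ∀ᵐ ω ∂μ, ∀ τ : ℝ, 0 < τ → ∀ᶠ n : ℕ in atTop, ∀ g : RBFSpace d σ,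
      IsRanker (K n) (lam n) (fun i : Fin n => x i ω) g →
        empRisk (K n) (fun i : Fin n => x i ω) g ≤ τ := by
  obtain ⟨C, hC0, hC⟩ := hf.exists_upper_bound
  obtain ⟨M, hM, hlip⟩ := hf.exists_levelMass_lipschitz
  filter_upwards [ae_sample_mem hf hx_meas hx_law,
    ae_eventually_levelFraction_near hf hx_meas hx_indep hx_law,
    ae_eventually_card_misordered_le hf hx_meas hx_indep hx_law hK hK_top] with ω hX h1 h2 τ hτ
  -- the threshold `δ` makes the contribution of the close pairs small
  set A : ℝ := 3 * M + 2 with hA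
  have hA0 : 0 < A := by positivity
  set δ : ℝ := min (1 / (4 * A)) (τ / (48 * A)) with hδ
  have hδ0 : 0 < δ := by positivity
  have hδ1 : A * δ ≤ 1 / 4 := by
    have : δ ≤ 1 / (4 * A) := min_le_left _ _
    rw [le_div_iff₀ (by positivity)] at this
    linarith
  have hδ2 : 16 * (A * δ) ≤ τ / 3 := by
    have : δ ≤ τ / (48 * A) := min_le_right _ _
    rw [le_div_iff₀ (by positivity)] at this
    linarith
  set T : ℝ := 2 / δ with hT
  have hT0 : 0 < T := by positivity
  have hTδ : T * δ = 2 := by rw [hT]; field_simp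
  obtain ⟨h, hh⟩ := exists_near_continuousOn hf.isCompact hσ
    (u := fun z => -(T * f₀ z)) (hf.continuousOn.const_smul T).neg (ε := 1 / 2) (by norm_num)
  set B : ℝ := 2 + T * C with hB
  have hB0 : 0 < B := by positivity
  have hlamh : Tendsto (fun n => lam n * ‖h‖ ^ 2) atTop (𝓝 0) := by
    simpa using hlam.mul_const (‖h‖ ^ 2)
  filter_upwards [h1 δ hδ0, h2 δ hδ0 (min (1 / 8) (τ / (12 * B))) (by positivity),
    hlamh.eventually (ge_mem_nhds (show (0 : ℝ) < τ / 3 by positivity)),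
    eventually_gt_atTop 0] with n hn1 hn2 hn3 hn g hg
  set s : Fin n → Pt d := fun i => x i ω with hs
  have hn0 : (0 : ℝ) < n := by exact_mod_cast hn
  have hclose : ((closePairs f₀ δ s).card : ℝ) ≤ A * δ * n ^ 2 := by
    refine card_closePairs_le hn fun a => ?_
    refine (empMean_near_level_le hlip hn1 hδ0 a).trans (le_of_eq ?_)
    rw [hA]; ring
  have hmis1 : ((misordered f₀ (K n) δ s).card : ℝ) ≤ 1 / 8 * n ^ 2 :=
    hn2.trans (by gcongr; exact min_le_left _ _)
  have hmis2 : B * ((misordered f₀ (K n) δ s).card : ℝ) ≤ τ / 12 * n ^ 2 := by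
    calc B * ((misordered f₀ (K n) δ s).card : ℝ) ≤ B * (τ / (12 * B) * n ^ 2) := by
          gcongr
          exact hn2.trans (by gcongr; exact min_le_right _ _)
      _ = _ := by field_simp
  have hclose1 : A * δ * (n : ℝ) ^ 2 ≤ 1 / 4 * n ^ 2 := by gcongr
  -- At most n²/4 close pairs leave at least 3n²/8 increasing ones, of which at most n²/8 are
  -- misordered.
  have hpref : (n : ℝ) ^ 2 / 4 ≤ (prefPairs (K n) s).card := by
    have h3 := sq_le_card_increasingPairs (f₀ := f₀) s δ
    have h4 : ((increasingPairs f₀ δ s).card : ℝ) ≤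
        (prefPairs (K n) s).card + (misordered f₀ (K n) δ s).card := by
      exact_mod_cast card_increasingPairs_le s (K n) δ
    linarith
  have hpos : (0 : ℝ) < (prefPairs (K n) s).card := lt_of_lt_of_le (by positivity) hpref
  have hsum := sum_hinge_le (fun i => hX i) (K n) hT0 hTδ hh hf.nonneg hC (s := s)
  have hrisk : empRisk (K n) s h ≤ 2 * τ / 3 := by
    rw [empRisk, one_div_mul_eq_div, div_le_iff₀ hpos]
    have h5 : 16 * (A * δ) * (n : ℝ) ^ 2 ≤ τ / 3 * n ^ 2 := by gcongr
    have h6 : 2 * τ / 3 * ((n : ℝ) ^ 2 / 4) ≤ 2 * τ / 3 * (prefPairs (K n) s).card := by gcongr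
    linarith
  have h7 := hg h
  have h8 : 0 ≤ lam n * ‖g‖ ^ 2 := mul_nonneg (hlam_pos n).le (sq_nonneg _)
  linarith

end Objective

/-! ### Misranked pairs -/

section Misrank

variable {d n : ℕ} {X : Set (Pt d)} {f₀ : Pt d → ℝ} {δ : ℝ}

/-- The hinge loss truncated at `1`. -/
def ramp (t : ℝ) : ℝ := min 1 (hinge t)

theorem ramp_mem (t : ℝ) : ramp t ∈ Set.Icc (0 : ℝ) 1 :=
  ⟨le_min zero_le_one (hinge_nonneg t), min_le_left _ _⟩

/-- The truncated loss still charges 1 for a wrong order, yet stays bounded whatever the norm of the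
ranker, which is only known to be at most 1/√λ_n. -/
theorem ramp_of_nonpos {t : ℝ} (ht : t ≤ 0) : ramp t = 1 :=
  min_eq_left ((by linarith : 1 ≤ 1 - t).trans (le_max_right _ _))

theorem continuous_ramp : Continuous ramp := continuous_const.min continuous_hinge

theorem ramp_le_add {a b ε : ℝ} (h : |a - b| ≤ ε) : ramp a ≤ ramp b + ε := by
  have h1 := abs_le.1 h
  have h2 : 0 ≤ ε := (abs_nonneg _).trans h
  have h3 : hinge a ≤ hinge b + ε := by
    unfold hinge
    exact max_le (by linarith [le_max_left 0 (1 - b)]) (by linarith [le_max_right 0 (1 - b)])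
  unfold ramp
  rcases le_total 1 (hinge b) with h4 | h4
  · rw [min_eq_left h4]
    exact (min_le_left _ _).trans (by linarith)
  · rw [min_eq_right h4]
    exact (min_le_right _ _).trans h3

/-- The loss of `g` at a pair of points whose densities increase by at least `δ`. -/
noncomputable def misrank (f₀ : Pt d → ℝ) (δ : ℝ) (g : Pt d → ℝ) (y z : Pt d) : ℝ :=
  if f₀ y + δ ≤ f₀ z then ramp (g y - g z) else 0

theorem misrank_mem (g : Pt d → ℝ) (y z : Pt d) : misrank f₀ δ g y z ∈ Set.Icc (0 : ℝ) 1 := by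
  unfold misrank
  split_ifs
  · exact ramp_mem _
  · exact ⟨le_rfl, zero_le_one⟩

theorem misrank_le_add {g c : Pt d → ℝ} {ε : ℝ} (hgc : ∀ z ∈ X, |g z - c z| ≤ ε) {y z : Pt d}
    (hy : y ∈ X) (hz : z ∈ X) : misrank f₀ δ g y z ≤ misrank f₀ δ c y z + 2 * ε := by
  have h1 := abs_le.1 (hgc y hy)
  have h2 := abs_le.1 (hgc z hz)
  unfold misrank
  split_ifs
  · refine ramp_le_add (abs_le.2 ⟨?_, ?_⟩) <;> linarith
  · linarith

theorem measurable_misrank (hf : Measurable f₀) {g : Pt d → ℝ} (hg : Measurable g) (δ : ℝ) :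
    Measurable (Function.uncurry (misrank f₀ δ g)) := by
  refine Measurable.ite (measurableSet_le ((hf.comp measurable_fst).add_const _)
    (hf.comp measurable_snd)) ?_ measurable_const
  exact continuous_ramp.measurable.comp
    ((hg.comp measurable_fst).sub (hg.comp measurable_snd))

/-- A pair of rising density that G orders accordingly is a preference pair, where the hinge
dominates the ramp; the other rising pairs are misordered and cost at most 1 each. -/
theorem sum_misrank_le {σ : ℝ} (K : ℕ) (s : Fin n → Pt d) (g : RBFSpace d σ) :
    ∑ i, ∑ j, misrank f₀ δ g (s i) (s j) ≤
      n ^ 2 * empRisk K s g + (misordered f₀ K δ s).card := by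
  classical
  have h1 : ∀ q : Fin n × Fin n, misrank f₀ δ g (s q.1) (s q.2) ≤
      (if q ∈ prefPairs K s then hinge (g (s q.1) - g (s q.2)) else 0) +
        (if q ∈ misordered f₀ K δ s then 1 else 0) := by
    intro q
    have hnn : 0 ≤ if q ∈ prefPairs K s then hinge (g (s q.1) - g (s q.2)) else 0 := by
      split_ifs
      · exact hinge_nonneg _
      · exact le_rfl
    by_cases h2 : f₀ (s q.1) + δ ≤ f₀ (s q.2)
    · by_cases h3 : avgNNDist K s (s q.2) < avgNNDist K s (s q.1)
      · rw [misrank, if_pos h2, if_pos (by rw [prefPairs, Finset.mem_filter]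
                                           exact ⟨Finset.mem_univ _, h3⟩)]
        have h4 : ramp (g (s q.1) - g (s q.2)) ≤ hinge (g (s q.1) - g (s q.2)) := min_le_right _ _
        have h5 : (0 : ℝ) ≤ if q ∈ misordered f₀ K δ s then 1 else 0 := by split_ifs <;> norm_num
        linarith
      · have h4 : q ∈ misordered f₀ K δ s := by
          rw [misordered, Finset.mem_filter]
          exact ⟨Finset.mem_univ _, h2, h3⟩
        rw [if_pos h4]
        linarith [(misrank_mem (f₀ := f₀) (δ := δ) g (s q.1) (s q.2)).2]
    · rw [misrank, if_neg h2]
      positivity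
  have h2 : ∑ q ∈ prefPairs K s, hinge (g (s q.1) - g (s q.2)) ≤ n ^ 2 * empRisk K s g := by
    have hcard : ((prefPairs K s).card : ℝ) ≤ n ^ 2 := by
      have := Finset.card_le_univ (prefPairs K s)
      rw [Fintype.card_prod, Fintype.card_fin, ← sq] at this
      exact_mod_cast this
    rcases Nat.eq_zero_or_pos (prefPairs K s).card with h0 | h0
    · rw [Finset.card_eq_zero.1 h0, Finset.sum_empty]
      exact mul_nonneg (sq_nonneg _) (empRisk_nonneg K s g)
    · refine le_trans (le_of_eq ?_)
        (mul_le_mul_of_nonneg_right hcard (empRisk_nonneg K s g))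
      have h0' : ((prefPairs K s).card : ℝ) ≠ 0 := by positivity
      rw [empRisk]
      field_simp
  calc ∑ i, ∑ j, misrank f₀ δ g (s i) (s j)
      = ∑ q : Fin n × Fin n, misrank f₀ δ g (s q.1) (s q.2) := by
        rw [← Finset.univ_product_univ, Finset.sum_product]
    _ ≤ ∑ q : Fin n × Fin n, ((if q ∈ prefPairs K s then hinge (g (s q.1) - g (s q.2)) else 0) +
        (if q ∈ misordered f₀ K δ s then 1 else 0)) := Finset.sum_le_sum fun q _ => h1 q
    _ = ∑ q ∈ prefPairs K s, hinge (g (s q.1) - g (s q.2)) + (misordered f₀ K δ s).card := by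
        rw [Finset.sum_add_distrib, Finset.sum_ite_mem, Finset.sum_ite_mem, Finset.univ_inter,
          Finset.univ_inter, Finset.sum_const, nsmul_eq_mul, mul_one]
    _ ≤ _ := by linarith

/-- The cross pairs are among all n² pairs, and n² ≤ 16⌊n/2⌋² for n ≥ 2. -/
theorem crossMean_le {E : Type*} (hn : 2 ≤ n) (y : ℕ → E) {u : E → E → ℝ}
    (hu : ∀ a b, 0 ≤ u a b) {τ : ℝ}
    (h : ∑ i : Fin n, ∑ j : Fin n, u (y i) (y j) ≤ τ * n ^ 2) :
    crossMean (n / 2) y u ≤ 16 * τ := by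
  set m : ℕ := n / 2 with hm
  have hm0 : 0 < m := by omega
  have hm0' : (0 : ℝ) < m := by exact_mod_cast hm0
  have hnm : (n : ℝ) ≤ 4 * m := by exact_mod_cast (by omega : n ≤ 4 * m)
  have h1 : ∑ i : Fin m, ∑ j : Fin m, u (y i) (y (m + j)) ≤
      ∑ i : Fin n, ∑ j : Fin n, u (y i) (y j) := by
    rw [Fin.sum_univ_eq_sum_range (fun i => ∑ j : Fin m, u (y i) (y (m + j))) m,
      Fin.sum_univ_eq_sum_range (fun i => ∑ j : Fin n, u (y i) (y j)) n]
    refine (Finset.sum_le_sum fun i _ => ?_).trans (Finset.sum_le_sum_of_subset_of_nonneg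
      (Finset.range_subset_range.2 (by omega)) fun i _ _ => Finset.sum_nonneg fun j _ => hu _ _)
    rw [Fin.sum_univ_eq_sum_range (fun j => u (y i) (y (m + j))) m,
      Fin.sum_univ_eq_sum_range (fun j => u (y i) (y j)) n]
    have h2 := Finset.sum_Ico_eq_sum_range (fun j => u (y i) (y j)) m (m + m)
    rw [Nat.add_sub_cancel_left] at h2
    rw [← h2]
    refine Finset.sum_le_sum_of_subset_of_nonneg (fun j hj => ?_) fun j _ _ => hu _ _
    rw [Finset.mem_Ico] at hj
    exact Finset.mem_range.2 (by omega)
  have hS : 0 ≤ ∑ i : Fin n, ∑ j : Fin n, u (y i) (y j) :=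
    Finset.sum_nonneg fun i _ => Finset.sum_nonneg fun j _ => hu _ _
  have hτ : 0 ≤ τ := by
    have : (0 : ℝ) < (n : ℝ) ^ 2 := by positivity
    exact nonneg_of_mul_nonneg_left (hS.trans h) this
  rw [crossMean, one_div_mul_eq_div, div_le_iff₀ (by positivity)]
  calc _ ≤ τ * (n : ℝ) ^ 2 := h1.trans h
    _ ≤ τ * (4 * m) ^ 2 := by gcongr
    _ = _ := by ring

end Misrank

/-! ### The score and the p-value -/

section Score

variable {d n : ℕ} {X : Set (Pt d)} {f₀ : Pt d → ℝ} {δ σ : ℝ}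

theorem score_eq_empMean (s : Fin n → Pt d) (g : RBFSpace d σ) (η : Pt d) :
    score s g η = empMean s ({z | g η < g z}.indicator 1) := by
  classical
  unfold score empMean
  congr 1
  rw [Finset.card_filter, Nat.cast_sum]
  refine Finset.sum_congr rfl fun i _ => ?_
  simp [Set.indicator_apply]

theorem measurable_score (s : Fin n → Pt d) (g : RBFSpace d σ) : Measurable (score s g) := by
  have h : score s g = fun η => empMean s fun z => {η | g η < g z}.indicator 1 η := by
    funext η
    rw [score_eq_empMean]
    exact empMean_congr fun i => by simp [Set.indicator_apply]
  rw [h]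
  unfold empMean
  refine (Finset.measurable_fun_sum _ fun i _ => ?_).const_mul _
  exact measurable_const.indicator
    (measurableSet_lt (continuous_apply g).measurable measurable_const)

theorem empMean_add (s : Fin n → Pt d) (u v : Pt d → ℝ) :
    empMean s (fun z => u z + v z) = empMean s u + empMean s v := by
  unfold empMean
  rw [Finset.sum_add_distrib, mul_add]

theorem empMean_le_add_const {s : Fin n → Pt d} {u v : Pt d → ℝ} {a : ℝ} (ha : 0 ≤ a)
    (h : ∀ i, u (s i) ≤ v (s i) + a) : empMean s u ≤ empMean s v + a := by
  refine (empMean_mono (v := fun z => v z + a) h).trans ?_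
  rw [empMean_add]
  refine add_le_add le_rfl ?_
  unfold empMean
  rw [Finset.sum_const, Finset.card_univ, Fintype.card_fin, nsmul_eq_mul, one_div, ← mul_assoc]
  exact mul_le_of_le_one_left ha inv_mul_le_one

/-- The indicators of g(η) < g(x_i) and f₀(x_i) ≤ f₀(η) differ only if the densities are within δ or
g orders the pair against the density, where one of the two misranking losses is 1. -/
theorem abs_score_sub_levelFraction_le (hδ : 0 < δ) (s : Fin n → Pt d) (g : RBFSpace d σ)
    (η : Pt d) :
    |score s g η - levelFraction f₀ s (f₀ η)| ≤
      empMean s (fun z => misrank f₀ δ g z η) + empMean s (fun z => misrank f₀ δ g η z) +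
        empMean s ({z | |f₀ z - f₀ η| ≤ δ}.indicator 1) := by
  rw [score_eq_empMean, levelFraction, ← empMean_add, ← empMean_add]
  unfold empMean
  rw [← mul_sub, ← Finset.sum_sub_distrib, abs_mul, abs_of_nonneg (by positivity)]
  refine mul_le_mul_of_nonneg_left ((Finset.abs_sum_le_sum_abs _ _).trans
    (Finset.sum_le_sum fun i _ => ?_)) (by positivity)
  have h1 := misrank_mem (f₀ := f₀) (δ := δ) g (s i) η
  have h2 := misrank_mem (f₀ := f₀) (δ := δ) g η (s i)
  simp only [Set.indicator_apply, Pi.one_apply, Set.mem_ofPred_eq]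
  by_cases h3 : |f₀ (s i) - f₀ η| ≤ δ
  · rw [if_pos h3]
    split_ifs <;> norm_num <;> linarith [h1.1, h2.1]
  rw [if_neg h3, add_zero]
  rcases lt_abs.1 (not_le.1 h3) with h4 | h4
  · rw [if_neg (by linarith : ¬ f₀ (s i) ≤ f₀ η)]
    by_cases h5 : g η < g (s i)
    · rw [misrank, misrank, if_pos (by linarith : f₀ η + δ ≤ f₀ (s i)),
        ramp_of_nonpos (t := g η - g (s i)) (by linarith), if_pos h5,
        if_neg (by linarith : ¬ f₀ (s i) + δ ≤ f₀ η)]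
      norm_num
    · rw [if_neg h5, sub_zero, abs_zero]
      linarith [h1.1, h2.1]
  · rw [if_pos (by linarith : f₀ (s i) ≤ f₀ η)]
    by_cases h5 : g η < g (s i)
    · rw [if_pos h5, sub_self, abs_zero]
      linarith [h1.1, h2.1]
    · rw [misrank, misrank, if_neg (by linarith : ¬ f₀ η + δ ≤ f₀ (s i)), if_neg h5,
        if_pos (by linarith : f₀ (s i) + δ ≤ f₀ η),
        ramp_of_nonpos (t := g (s i) - g η) (by linarith)]
      norm_num

/-- The mean error of the score, in terms of an approximation `c` of the ranker `g`. -/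
theorem integral_abs_score_sub_pValue_le (hf : IsNominalDensity X f₀) {s : Fin n → Pt d}
    (hs : ∀ i, s i ∈ X) {g c : RBFSpace d σ} {ε M τ W : ℝ} (hε : 0 ≤ ε) (hδ : 0 < δ)
    (hgc : ∀ z ∈ X, |g z - c z| ≤ ε)
    (hM : ∀ t r : ℝ, 0 ≤ r → levelMass f₀ (t + r) - levelMass f₀ t ≤ M * r)
    (hτ : ∀ t, |levelFraction f₀ s t - levelMass f₀ t| ≤ τ)
    (h1 : empMean s (fun y => ∫ z, misrank f₀ δ c y z ∂(nominal f₀)) ≤ W)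
    (h2 : empMean s (fun z => ∫ y, misrank f₀ δ c y z ∂(nominal f₀)) ≤ W) :
    ∫ η, |score s g η - pValue f₀ η| ∂(nominal f₀) ≤ 2 * W + 4 * ε + 3 * M * δ + 3 * τ := by
  have := hf.isProbabilityMeasure
  have hmeas := measurable_misrank hf.measurable (continuous_apply c).measurable δ
  have hi1 : ∀ y, Integrable (fun η => misrank f₀ δ c y η) (nominal f₀) := fun y =>
    integrable_of_mem_unitInterval (hmeas.comp measurable_prodMk_left)
      (fun η => misrank_mem _ _ _)
  have hi2 : ∀ z, Integrable (fun η => misrank f₀ δ c η z) (nominal f₀) := fun z =>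
    integrable_of_mem_unitInterval (hmeas.comp measurable_prodMk_right)
      (fun η => misrank_mem _ _ _)
  have hI1 : Integrable (fun η => empMean s (fun z => misrank f₀ δ c z η)) (nominal f₀) := by
    unfold empMean
    exact (integrable_finsetSum _ fun i _ => hi1 (s i)).const_mul _
  have hI2 : Integrable (fun η => empMean s (fun z => misrank f₀ δ c η z)) (nominal f₀) := by
    unfold empMean
    exact (integrable_finsetSum _ fun i _ => hi2 (s i)).const_mul _
  have hv1 : ∫ η, empMean s (fun z => misrank f₀ δ c z η) ∂(nominal f₀) ≤ W := by
    refine le_trans (le_of_eq ?_) h1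
    unfold empMean
    rw [integral_const_mul, integral_finsetSum _ fun i _ => hi1 (s i)]
  have hv2 : ∫ η, empMean s (fun z => misrank f₀ δ c η z) ∂(nominal f₀) ≤ W := by
    refine le_trans (le_of_eq ?_) h2
    unfold empMean
    rw [integral_const_mul, integral_finsetSum _ fun i _ => hi2 (s i)]
  calc ∫ η, |score s g η - pValue f₀ η| ∂(nominal f₀)
      ≤ ∫ η, (empMean s (fun z => misrank f₀ δ c z η) + empMean s (fun z => misrank f₀ δ c η z) +
          (4 * ε + 3 * M * δ + 3 * τ)) ∂(nominal f₀) := by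
        -- Replacing g by c costs 2ε in each misranking term, the band around the level of η costs
        -- 3Mδ + 2τ, and passing from the level fraction to the p-value costs τ.
        refine integral_mono_of_nonneg (ae_of_all _ fun η => abs_nonneg _)
          ((hI1.add hI2).add (integrable_const _)) ?_
        filter_upwards [hf.ae_mem] with η hη
        have h3 := abs_score_sub_levelFraction_le (f₀ := f₀) hδ s g η
        have h4 : empMean s (fun z => misrank f₀ δ g z η) ≤
            empMean s (fun z => misrank f₀ δ c z η) + 2 * ε :=
          empMean_le_add_const (by positivity) fun i => misrank_le_add hgc (hs i) hη
        have h5 : empMean s (fun z => misrank f₀ δ g η z) ≤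
            empMean s (fun z => misrank f₀ δ c η z) + 2 * ε :=
          empMean_le_add_const (by positivity) fun i => misrank_le_add hgc hη (hs i)
        have h6 := empMean_near_level_le hM hτ hδ (f₀ η)
        have h7 := abs_sub_le (score s g η) (levelFraction f₀ s (f₀ η)) (pValue f₀ η)
        have h8 : |levelFraction f₀ s (f₀ η) - pValue f₀ η| ≤ τ := hτ (f₀ η)
        show |score s g η - pValue f₀ η| ≤ _
        linarith
    _ ≤ _ := by
        have h3 := integral_add (hI1.add hI2)
          (integrable_const (μ := nominal f₀) (4 * ε + 3 * M * δ + 3 * τ))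
        simp only [Pi.add_apply] at h3
        rw [h3, integral_add hI1 hI2, integral_const, probReal_univ, one_smul]
        linarith

end Score

/-! ### Convergence of the score and of the acceptance regions -/

section Convergence

variable {d : ℕ} {X : Set (Pt d)} {f₀ : Pt d → ℝ} {Ω : Type*} [MeasurableSpace Ω]
  {μ : Measure Ω} [IsProbabilityMeasure μ] {x : ℕ → Ω → Pt d}

/-- The score of the ranker converges to the `p`-value in the mean. -/
theorem ae_eventually_integral_abs_score_sub_le (hf : IsNominalDensity X f₀)
    (hx_meas : ∀ i, Measurable (x i)) (hx_indep : iIndepFun x μ)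
    (hx_law : ∀ i, μ.map (x i) = nominal f₀) {K : ℕ → ℕ}
    (hK : Tendsto (fun n : ℕ => (K n : ℝ) / n) atTop (𝓝 0)) (hK_top : Tendsto K atTop atTop)
    {σ : ℝ} (hσ : 0 < σ) {lam : ℕ → ℝ} (hlam_pos : ∀ n, 0 < lam n)
    (hlam : Tendsto lam atTop (𝓝 0))
    (hlam_cover : ∀ ε : ℝ≥0, 0 < ε → Tendsto (fun n : ℕ =>
      ENNReal.log (ballCoveringNumber X σ (1 / √(lam n)) ε : ℝ≥0∞) /
        (((n : ℝ) * lam n : ℝ) : EReal)) atTop (𝓝 0)) :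
    ∀ᵐ ω ∂μ, ∀ τ : ℝ, 0 < τ → ∀ᶠ n : ℕ in atTop, ∀ g : RBFSpace d σ,
      IsRanker (K n) (lam n) (fun i : Fin n => x i ω) g →
        ∫ η, |score (fun i : Fin n => x i ω) g η - pValue f₀ η| ∂(nominal f₀) ≤ τ := by
  have := hf.isProbabilityMeasure
  obtain ⟨M, hM, hlip⟩ := hf.exists_levelMass_lipschitz
  have key : ∀ k : ℕ, ∀ᵐ ω ∂μ, ∀ᶠ n : ℕ in atTop, ∀ g : RBFSpace d σ,
      IsRanker (K n) (lam n) (fun i : Fin n => x i ω) g →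
        ∫ η, |score (fun i : Fin n => x i ω) g η - pValue f₀ η| ∂(nominal f₀) ≤
          (139 + 3 * M) * (1 / ((k : ℝ) + 1)) := by
    intro k
    -- One ε is the density gap, the radius of the cover and every tolerance. The pair sum for c is
    -- at most 4εn² (risk, misordered pairs, 2ε for the cover), the cross mean at most 64ε, and two
    -- laws of large numbers give W = 66ε. Then 2·66 + 4 + 3 = 139.
    set ε : ℝ := 1 / ((k : ℝ) + 1) with hε
    have hε0 : 0 < ε := by positivity
    obtain ⟨C, hcard, hC⟩ := exists_seq_finset_cover hlam_pos hlam
      (hlam_cover ⟨ε, hε0.le⟩ hε0)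
    have hmeas : ∀ c : RBFSpace d σ, Measurable (Function.uncurry (misrank f₀ ε c)) := fun c =>
      measurable_misrank hf.measurable (continuous_apply c).measurable ε
    have hint : ∀ c : RBFSpace d σ, Integrable (Function.uncurry (misrank f₀ ε c))
        ((nominal f₀).prod (nominal f₀)) := fun c =>
      integrable_of_mem_unitInterval (hmeas c) fun _ => misrank_mem _ _ _
    have hmean : ∀ u : Pt d → ℝ, (∀ z, u z ∈ Set.Icc (0 : ℝ) 1) →
        ∫ z, u z ∂(nominal f₀) ∈ Set.Icc (0 : ℝ) 1 := fun u hu =>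
      ⟨integral_nonneg fun z => (hu z).1, by
        refine (integral_mono_of_nonneg (ae_of_all _ fun z => (hu z).1) (integrable_const 1)
          (ae_of_all _ fun z => (hu z).2)).trans ?_
        simp⟩
    filter_upwards [ae_sample_mem hf hx_meas hx_law,
      ae_eventually_levelFraction_near hf hx_meas hx_indep hx_law,
      ae_eventually_card_misordered_le hf hx_meas hx_indep hx_law hK hK_top,
      ae_eventually_empRisk_isRanker_le hf hx_meas hx_indep hx_law hK hK_top hσ hlam_pos hlam,
      ae_forall_crossMean_near hx_meas hx_indep hx_law C hcard
        (fun _ c => misrank f₀ ε c) (fun _ c _ => hmeas c) (fun _ c _ y z => misrank_mem _ _ _),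
      ae_forall_empMean_near hx_meas hx_indep hx_law C hcard
        (fun _ c y => ∫ z, misrank f₀ ε c y z ∂(nominal f₀))
        (fun _ c _ => (hmeas c).stronglyMeasurable.integral_prod_right.measurable)
        (fun _ c _ y => hmean _ fun z => misrank_mem _ _ _),
      ae_forall_empMean_near hx_meas hx_indep hx_law C hcard
        (fun _ c z => ∫ y, misrank f₀ ε c y z ∂(nominal f₀))
        (fun _ c _ => (hmeas c).stronglyMeasurable.integral_prod_left.measurable)
        (fun _ c _ z => hmean _ fun y => misrank_mem _ _ _)] with ω hX h1 h2 h3 h4 h5 h6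
    filter_upwards [h1 ε hε0, h2 ε hε0 ε hε0, h3 ε hε0, h4 ε hε0, h5 ε hε0, h6 ε hε0, hC,
      eventually_ge_atTop 2] with n hn1 hn2 hn3 hn4 hn5 hn6 hnC hn g hg
    set s : Fin n → Pt d := fun i => x i ω with hs
    obtain ⟨c, hc, hgc⟩ := hnC g (hg.norm_le (hlam_pos n))
    have hgc' : ∀ z ∈ X, |g z - c z| ≤ ε := hgc
    have hcg : ∀ z ∈ X, |c z - g z| ≤ ε := fun z hz => by rw [abs_sub_comm]; exact hgc' z hz
    have hsum : ∑ i, ∑ j, misrank f₀ ε c (s i) (s j) ≤ (4 * ε) * n ^ 2 := by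
      have hE := sum_misrank_le (f₀ := f₀) (δ := ε) (K n) s g
      have hE' : (n : ℝ) ^ 2 * empRisk (K n) s g ≤ n ^ 2 * ε := by gcongr; exact hn3 g hg
      have hle : ∑ i, ∑ j, misrank f₀ ε c (s i) (s j) ≤
          ∑ i : Fin n, ∑ j : Fin n, (misrank f₀ ε g (s i) (s j) + 2 * ε) :=
        Finset.sum_le_sum fun i _ => Finset.sum_le_sum fun j _ =>
          misrank_le_add hcg (hX i) (hX j)
      have heq : ∑ i : Fin n, ∑ j : Fin n, (misrank f₀ ε g (s i) (s j) + 2 * ε) =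
          ∑ i, ∑ j, misrank f₀ ε g (s i) (s j) + 2 * ε * n ^ 2 := by
        simp only [Finset.sum_add_distrib, Finset.sum_const, Finset.card_univ, Fintype.card_fin,
          nsmul_eq_mul]
        ring
      linarith
    have hcross : crossMean (n / 2) (fun i => x i ω) (misrank f₀ ε c) ≤ 16 * (4 * ε) :=
      crossMean_le hn (fun i => x i ω) (fun a b => (misrank_mem _ _ _).1) hsum
    have hI := (abs_le.1 (hn4 c hc)).1
    have hI1 : ∫ y, ∫ z, misrank f₀ ε c y z ∂(nominal f₀) ∂(nominal f₀) =
        ∫ z, misrank f₀ ε c z.1 z.2 ∂((nominal f₀).prod (nominal f₀)) :=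
      (integral_prod _ (hint c)).symm
    have hI2 : ∫ z, ∫ y, misrank f₀ ε c y z ∂(nominal f₀) ∂(nominal f₀) =
        ∫ z, misrank f₀ ε c z.1 z.2 ∂((nominal f₀).prod (nominal f₀)) :=
      (integral_prod_symm _ (hint c)).symm
    have hw1 := (abs_le.1 (hn5 c hc)).2
    have hw2 := (abs_le.1 (hn6 c hc)).2
    rw [hI1] at hw1
    rw [hI2] at hw2
    refine (integral_abs_score_sub_pValue_le hf (fun i => hX i) hε0.le hε0 hgc' hlip hn1
      (W := 66 * ε) (by linarith) (by linarith)).trans ?_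
    linarith
  filter_upwards [ae_all_iff.2 key] with ω hω τ hτ
  obtain ⟨k, hk⟩ := exists_nat_one_div_lt (show 0 < τ / (139 + 3 * M) by positivity)
  filter_upwards [hω k] with n hn g hg
  refine (hn g hg).trans ?_
  rw [lt_div_iff₀ (by positivity)] at hk
  linarith

/-- Convergence in measure is inherited by finite absolutely continuous measures. -/
theorem tendstoInMeasure_of_absolutelyContinuous {α : Type*} [MeasurableSpace α] {P ν : Measure α}
    [IsFiniteMeasure P] [IsFiniteMeasure ν] (hν : ν ≪ P) {u : ℕ → α → ℝ} {v : α → ℝ}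
    (hu : ∀ n, Measurable (u n)) (h : TendstoInMeasure P u atTop v) :
    TendstoInMeasure ν u atTop v := by
  -- For finite measures, convergence in measure means almost everywhere convergence along
  -- sub-subsequences, and P-null sets are ν-null.
  rw [exists_seq_tendstoInMeasure_atTop_iff fun n => (hu n).aestronglyMeasurable] at h ⊢
  intro ns hns
  obtain ⟨ns', hns', hlim⟩ := h ns hns
  exact ⟨ns', hns', hν.ae_le hlim⟩

theorem tendstoInMeasure_of_integral_abs {α : Type*} [MeasurableSpace α] {P : Measure α}
    [IsFiniteMeasure P] {u : ℕ → α → ℝ} {v : α → ℝ}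
    (hint : ∀ n, Integrable (fun η => |u n η - v η|) P)
    (h : ∀ τ : ℝ, 0 < τ → ∀ᶠ n in atTop, ∫ η, |u n η - v η| ∂P ≤ τ) :
    TendstoInMeasure P u atTop v := by
  have hlim : Tendsto (fun n => ∫ η, |u n η - v η| ∂P) atTop (𝓝 0) := by
    refine tendsto_order.2 ⟨fun a ha => Eventually.of_forall fun n =>
      ha.trans_le (integral_nonneg fun _ => abs_nonneg _), fun a ha => ?_⟩
    filter_upwards [h (a / 2) (half_pos ha)] with n hn
    linarith
  rw [tendstoInMeasure_iff_measureReal_norm]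
  intro ε hε
  refine squeeze_zero (fun n => measureReal_nonneg) (fun n => ?_)
    (by simpa using hlim.div_const ε)
  rw [le_div_iff₀ hε, mul_comm]
  exact mul_meas_ge_le_integral_of_nonneg (ae_of_all _ fun _ => abs_nonneg _) (hint n) ε

theorem score_mem {n : ℕ} {σ : ℝ} (s : Fin n → Pt d) (g : RBFSpace d σ) (η : Pt d) :
    score s g η ∈ Set.Icc (0 : ℝ) 1 := by
  classical
  refine ⟨by unfold score; positivity, ?_⟩
  unfold score
  rw [one_div_mul_eq_div]
  refine div_le_one_of_le₀ ?_ (Nat.cast_nonneg n)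
  exact_mod_cast (Finset.card_filter_le _ _).trans (by simp)

/-- Scores converging to the `p`-value in measure yield converging acceptance regions. -/
theorem tendsto_volume_symmDiff (hf : IsNominalDensity X f₀) {u : ℕ → Pt d → ℝ}
    (hu : TendstoInMeasure (volume.restrict X) u atTop (pValue f₀)) {α : ℝ}
    (hα : α ∈ Set.Ioo (0 : ℝ) 1) :
    Tendsto (fun n : ℕ => volume (symmDiff {η | η ∈ X ∧ α < u n η} {η | α ≤ pValue f₀ η}))
      atTop (𝓝 0) := by
  have := hf.isProbabilityMeasure
  obtain ⟨m, hm0, hm⟩ := hf.lower_bound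
  have hoff : ∀ η, η ∉ X → pValue f₀ η = 0 := fun η hη => by
    show levelMass f₀ (f₀ η) = 0
    rw [hf.eq_zero η hη]
    exact hf.levelMass_of_lt hm hm0
  rw [tendstoInMeasure_iff_norm] at hu
  rw [ENNReal.tendsto_nhds_zero]
  intro r hr
  obtain ⟨r', hr'0, hr'⟩ : ∃ r' : ℝ, 0 < r' ∧ ENNReal.ofReal r' ≤ r := by
    rcases eq_or_ne r ⊤ with rfl | htop
    · exact ⟨1, one_pos, le_top⟩
    · exact ⟨r.toReal, ENNReal.toReal_pos hr.ne' htop, (ENNReal.ofReal_toReal htop).le⟩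
  -- The first two bounds keep the band around α inside (0, 1), where the p-value is uniform. The
  -- third gives the band volume at most r'/2, since its mass is at most 3ε and f₀ ≥ m on X.
  set ε : ℝ := min (min (α / 2) ((1 - α) / 4)) (r' * m / 6) with hε
  have h1α : 0 < 1 - α := by linarith [hα.2]
  have hε0 : 0 < ε := by have := hα.1; positivity
  have hε1 : ε ≤ α / 2 := (min_le_left _ _).trans (min_le_left _ _)
  have hε2 : ε ≤ (1 - α) / 4 := (min_le_left _ _).trans (min_le_right _ _)
  have hε3 : ε ≤ r' * m / 6 := min_le_right _ _
  have hnear := hf.nominal_pValue_near (α := α) (ε := ε) (by linarith [hα.1])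
    (by linarith [hα.2]) hε0
  set A : Set (Pt d) := {η | |pValue f₀ η - α| ≤ ε} with hA
  have hAm : MeasurableSet A :=
    measurableSet_le (hf.measurable_pValue.sub_const α).abs measurable_const
  have hAX : A ⊆ X := by
    intro η (hη : |pValue f₀ η - α| ≤ ε)
    by_contra hX
    rw [hoff η hX] at hη
    linarith [(abs_le.1 hη).1, hα.1]
  have hvolA : volume A ≤ ENNReal.ofReal (r' / 2) := by
    have h1 := IsNominalDensity.le_nominal A hAm (C := m) fun η hη => hm η (hAX hη)
    have h2 : nominal f₀ A ≤ ENNReal.ofReal (r' / 2 * m) := by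
      rw [← ENNReal.ofReal_toReal (measure_ne_top (nominal f₀) A)]
      refine ENNReal.ofReal_le_ofReal ?_
      have : (nominal f₀ A).toReal ≤ 3 * ε := hnear
      linarith
    have h3 : ENNReal.ofReal m ≠ 0 := by simpa using hm0
    refine (ENNReal.mul_le_mul_iff_right h3 ENNReal.ofReal_ne_top).1 ((h1.trans h2).trans ?_)
    rw [← ENNReal.ofReal_mul hm0.le, mul_comm]
  filter_upwards [(ENNReal.tendsto_nhds_zero.1 (hu ε hε0)) (ENNReal.ofReal (r' / 2))
    (by simpa using hr'0)] with n hn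
  set D := symmDiff {η | η ∈ X ∧ α < u n η} {η | α ≤ pValue f₀ η} with hD
  have hDX : D ⊆ X := by
    rintro η (⟨h1, -⟩ | ⟨h1, -⟩)
    · exact h1.1
    · by_contra hX
      have h2 : α ≤ pValue f₀ η := h1
      rw [hoff η hX] at h2
      linarith [hα.1]
  -- Where the score is within ε of the p-value, the two thresholdings disagree only if the p-value
  -- is within ε of α.
  have hDsub : D ⊆ {η | ε ≤ ‖u n η - pValue f₀ η‖} ∪ A := by
    intro η hη
    by_cases h0 : ε ≤ ‖u n η - pValue f₀ η‖
    · exact Or.inl h0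
    · right
      have h1 := abs_lt.1 (not_le.1 h0)
      rcases hη with ⟨h2, h3⟩ | ⟨h2, h3⟩
      · have h4 : α < u n η := h2.2
        have h5 : pValue f₀ η < α := not_le.1 h3
        show |pValue f₀ η - α| ≤ ε
        rw [abs_le]; constructor <;> linarith
      · have h4 : α ≤ pValue f₀ η := h2
        have h6 : η ∈ X := hDX (Or.inr ⟨h2, h3⟩)
        have h5 : u n η ≤ α := not_lt.1 fun h => h3 ⟨h6, h⟩
        show |pValue f₀ η - α| ≤ ε
        rw [abs_le]; constructor <;> linarith
  calc volume D = volume.restrict X D := (Measure.restrict_eq_self _ hDX).symm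
    _ ≤ volume.restrict X {η | ε ≤ ‖u n η - pValue f₀ η‖} + volume.restrict X A :=
        (measure_mono hDsub).trans (measure_union_le _ _)
    _ ≤ ENNReal.ofReal (r' / 2) + ENNReal.ofReal (r' / 2) :=
        add_le_add hn ((Measure.restrict_apply_le _ _).trans hvolA)
    _ = ENNReal.ofReal r' := by
        rw [← ENNReal.ofReal_add (by positivity) (by positivity), add_halves]
    _ ≤ r := hr'

end Convergence

end RankAD

theorem theorem2 {d : ℕ} {X : Set (RankAD.Pt d)} {f₀ : RankAD.Pt d → ℝ}
    (hf₀ : RankAD.IsNominalDensity X f₀)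
    -- the i.i.d. nominal data
    {Ω : Type*} [MeasurableSpace Ω] (μ : Measure Ω) [IsProbabilityMeasure μ]
    (x : ℕ → Ω → RankAD.Pt d) (hx_meas : ∀ i, Measurable (x i))
    (hx_indep : iIndepFun x μ) (hx_law : ∀ i, μ.map (x i) = RankAD.nominal f₀)
    -- the number of neighbours
    (K : ℕ → ℕ) (hK : (fun n => (K n : ℝ)) =O[atTop] fun n : ℕ => (n : ℝ) ^ (0.5 : ℝ))
    (hK_top : Tendsto K atTop atTop)
    -- the kernel bandwidth and the regularization
    (σ : ℝ) (hσ : 0 < σ)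
    (lam : ℕ → ℝ) (hlam_pos : ∀ n, 0 < lam n) (hlam : Tendsto lam atTop (𝓝 0))
    (hlam_cover : ∀ ε : ℝ≥0, 0 < ε →
      Tendsto (fun n : ℕ =>
        ENNReal.log (RankAD.ballCoveringNumber X σ (1 / √(lam n)) ε : ℝ≥0∞) /
          (((n : ℝ) * lam n : ℝ) : EReal)) atTop (𝓝 0)) :
    -- the ranker is well defined for every sample
    (∀ (n : ℕ) (s : Fin n → RankAD.Pt d),
      ∃! g : RankAD.RBFSpace d σ, RankAD.IsRanker (K n) (lam n) s g) ∧
    (∀ g : ℕ → Ω → RankAD.RBFSpace d σ,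
      (∀ n ω, RankAD.IsRanker (K n) (lam n) (fun i : Fin n => x i ω) (g n ω)) →
      ∀ᵐ ω ∂μ,
        -- the score converges to the p-value
        (∀ ν : Measure (RankAD.Pt d), IsProbabilityMeasure ν → ν ≪ volume.restrict X →
          TendstoInMeasure ν
            (fun (n : ℕ) (η : RankAD.Pt d) =>
              RankAD.score (fun i : Fin n => x i ω) (g n ω) η)
            atTop (RankAD.pValue f₀)) ∧
        -- the acceptance regions converge to the level sets of the p-value
        (∀ α ∈ Set.Ioo (0 : ℝ) 1,
          Tendsto (fun n : ℕ =>
            volume (symmDiff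
              {η | η ∈ X ∧ α < RankAD.score (fun i : Fin n => x i ω) (g n ω) η}
              {η | α ≤ RankAD.pValue f₀ η})) atTop (𝓝 0))) ∧
    -- these level sets are minimum volume sets
    (∀ α ∈ Set.Ioo (0 : ℝ) 1,
      RankAD.IsMinVolumeSet f₀ α {η | α ≤ RankAD.pValue f₀ η}) := by
  have hK' := RankAD.tendsto_div_of_isBigO_sqrt hK
  have := hf₀.isProbabilityMeasure
  have : IsFiniteMeasure (volume.restrict X) := ⟨by
    rw [Measure.restrict_apply_univ]; exact hf₀.isCompact.measure_lt_top⟩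
  refine ⟨fun n s => RankAD.existsUnique_isRanker (K n) s (hlam_pos n), fun g hg => ?_,
    fun α hα => hf₀.isMinVolumeSet hα⟩
  -- The almost sure event is fixed before ν and α, so one null set serves all of them.
  filter_upwards [RankAD.ae_eventually_integral_abs_score_sub_le hf₀ hx_meas hx_indep hx_law hK'
    hK_top hσ hlam_pos hlam hlam_cover] with ω hω
  have hmeas : ∀ n, Measurable (RankAD.score (fun i : Fin n => x i ω) (g n ω)) := fun n =>
    RankAD.measurable_score _ _
  have hP : TendstoInMeasure (RankAD.nominal f₀)
      (fun (n : ℕ) η => RankAD.score (fun i : Fin n => x i ω) (g n ω) η) atTop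
      (RankAD.pValue f₀) := by
    refine RankAD.tendstoInMeasure_of_integral_abs (fun n => ?_) fun τ hτ => ?_
    · refine RankAD.integrable_of_mem_unitInterval
        ((hmeas n).sub hf₀.measurable_pValue).abs fun η => ⟨abs_nonneg _, ?_⟩
      have h1 := RankAD.score_mem (fun i : Fin n => x i ω) (g n ω) η
      have h2 : RankAD.pValue f₀ η ≤ 1 := measureReal_le_one
      have h3 : 0 ≤ RankAD.pValue f₀ η := measureReal_nonneg
      rw [abs_le]; constructor <;> linarith [h1.1, h1.2]
    · filter_upwards [hω τ hτ] with n hn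
      exact hn (g n ω) (hg n ω)
  exact ⟨fun ν _ hν => RankAD.tendstoInMeasure_of_absolutelyContinuous
      (hν.trans hf₀.absolutelyContinuous) hmeas hP,
    fun α hα => RankAD.tendsto_volume_symmDiff hf₀
      (RankAD.tendstoInMeasure_of_absolutelyContinuous hf₀.absolutelyContinuous hmeas hP) hα⟩
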